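/- Let $p\ge 2$ be an integer. Write $D(0,1)$ for the open unit disk, $\overline D(0,1)$ for the closed one, and $\mathcal M(E)$ for the field of meromorphic functions on a nonempty connected open subset $E$ of a Riemann surface. Let $\widetilde{\mathbb C^\star}=\{(re^{ib},b): r>0,\ b\in\mathbb R\}$ be the universal cover of $\mathbb C^\star$, with the complex structure for which $\widetilde{\log}:(re^{ib},b)\mapsto \log r+ib$ is a biholomorphism onto $\mathbb C$, and put $\pi=\exp\circ\widetilde{\log}$, $\pi^\star f=f\circ\pi$, $\Sigma_0=\{(re^{ib},b): 0<r<1\}$, $\Sigma_\infty=\{(re^{ib},b): r>1\}$. Let $\phi_p$ denote the operator $f(z)\mapsto f(z^p)$ on $\mathbb C(z)$ and on functions of a complex variable, and the operator $f\mapsto f\circ\big((re^{ib},b)\mapsto(r^pe^{ipb},pb)\big)$ on meromorphic functions on $\widetilde{\mathbb C^\star}$, $\Sigma_0$, $\Sigma_\infty$; it acts on matrices entrywise. **The category $\mathcal E_{rs}$.** For $a\in\{0,1\}$, a system $\phi_p(Y)=AY$ with $A\in GL_n(\mathbb C(z))$ is regular singular at $a$ if there is an invertible $n\times n$ matrix $T$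 of germs of meromorphic functions at $a$ such that $\phi_p(T)^{-1}AT$ is analytic at $a$ with invertible value at $a$; it is regular singular at $\infty$ if the system with matrix $A(1/z)$ satisfies this condition at $0$. The objects of $\mathcal E_{rs}$ are the $A\in GL_n(\mathbb C(z))$, $n\in\mathbb N$, such that $\phi_p(Y)=AY$ is regular singular at $0$, $1$ and $\infty$. The morphisms from $A\in GL_{n_1}(\mathbb C(z))$ to $B\in GL_{n_2}(\mathbb C(z))$ are the $R\in\mathcal M_{n_2,n_1}(\mathbb C(z))$ with $\phi_p(R)A=BR$; composition is the matrix product. **The category $\mathcal C$ of connections.** Its objects are the tuples $$(A_0,A_1,A_\infty,\tilde M_0,\tilde M_\infty)\in GL_n(\mathbb C)^3\times GL_n(\mathcal M(\Sigma_0))\times GL_n(\mathcal M(\Sigma_\infty)),\quad n\in\mathbb N,$$ such that $\phi_p(\tilde M_0)=A_1\tilde M_0A_0^{-1}$ and $\phi_p(\tilde M_\infty)=A_1\tilde M_\infty A_\infty^{-1}$, and such that there exist $\tilde W_1\in GL_n(\mathcal M(\widetilde{\mathbb C^\star}))$, $W_0\in GL_n(\mathcal M(D(0,1)))$ and $W_\infty\in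 GL_n(\mathcal M(\mathbb P^1(\mathbb C)\setminus\overline D(0,1)))$ with $\tilde W_1\tilde M_0=\pi^\star W_0$ on $\Sigma_0$ and $\tilde W_1\tilde M_\infty=\pi^\star W_\infty$ on $\Sigma_\infty$. The morphisms from such an object of rank $n_1$ to an object $(B_0,B_1,B_\infty,\tilde N_0,\tilde N_\infty)$ of rank $n_2$ are the triples $$(S_0,\tilde S_1,S_\infty)\in\mathcal M_{n_2,n_1}(\mathbb C)\times\mathcal M_{n_2,n_1}\big(\mathbb C[\widetilde{\log},\widetilde{\log}^{-1}]\big)\times\mathcal M_{n_2,n_1}(\mathbb C)$$ with $S_0A_0=B_0S_0$, $\phi_p(\tilde S_1)A_1=B_1\tilde S_1$, $S_\infty A_\infty=B_\infty S_\infty$, $\tilde S_1\tilde M_0=\tilde N_0S_0$ on $\Sigma_0$ and $\tilde S_1\tilde M_\infty=\tilde N_\infty S_\infty$ on $\Sigma_\infty$; composition is the componentwise matrix product. **Statement.** The categories $\mathcal C$ and $\mathcal E_{rs}$ are equivalent. -/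

import Mathlib

open CategoryTheory Filter Topology Set

noncomputable section

namespace Mahler

/-! ### Meromorphic functions on open sets of a Riemann surface -/

section Meromorphic

variable {X Y : Type} [TopologicalSpace X] [ChartedSpace ℂ X]
  [TopologicalSpace Y] [ChartedSpace ℂ Y]

/-- `f` is meromorphic at the point `x` of the Riemann surface `X` (read in the chart at `x`;
as usual in Mathlib, the value of `f` at `x` itself is irrelevant). -/
def IsMeroAt (f : X → ℂ) (x : X) : Prop :=
  MeromorphicAt (f ∘ (chartAt ℂ x).symm) (chartAt ℂ x x)

/-- The ring `𝓜(E)` of meromorphic functions on an open set `E` of a Riemann surface: functions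
meromorphic at every point of `E`, two of them being identified when they agree on `E` outside a
set without accumulation point in `E`. It is a field when `E` is nonempty, open and connected. -/
def Mero (E : Set X) : Subring (Germ (codiscreteWithin E) ℂ) where
  carrier := {g | ∃ f : X → ℂ, (∀ x ∈ E, IsMeroAt f x) ∧ (f : Germ (codiscreteWithin E) ℂ) = g}
  mul_mem' := by
    rintro _ _ ⟨f, hf, rfl⟩ ⟨g, hg, rfl⟩
    exact ⟨f * g, fun x hx => MeromorphicAt.mul (hf x hx) (hg x hx), rfl⟩
  one_mem' := ⟨1, fun x _ => MeromorphicAt.const 1 _, rfl⟩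
  add_mem' := by
    rintro _ _ ⟨f, hf, rfl⟩ ⟨g, hg, rfl⟩
    exact ⟨f + g, fun x hx => MeromorphicAt.add (hf x hx) (hg x hx), rfl⟩
  zero_mem' := ⟨0, fun x _ => MeromorphicAt.const 0 _, rfl⟩
  neg_mem' := by
    rintro _ ⟨f, hf, rfl⟩
    exact ⟨-f, fun x hx => MeromorphicAt.neg (hf x hx), rfl⟩

/-- The class in `𝓜(E)` of a function that is meromorphic at every point of `E`. -/
def Mero.mk {E : Set X} (f : X → ℂ) (hf : ∀ x ∈ E, IsMeroAt f x) : Mero E :=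
  ⟨(f : Germ (codiscreteWithin E) ℂ), f, hf, rfl⟩

/-- Constant functions, `ℂ → 𝓜(E)`. -/
def Mero.const (E : Set X) : ℂ →+* Mero E where
  toFun c := Mero.mk (fun _ => c) fun _ _ => MeromorphicAt.const c _
  map_one' := rfl
  map_mul' _ _ := rfl
  map_zero' := rfl
  map_add' _ _ := rfl

/-- `h` maps `E` to `F`, is holomorphic at every point of `E` and is locally nonconstant there. -/
def IsHoloMap (h : X → Y) (E : Set X) (F : Set Y) : Prop :=
  ∀ x ∈ E, h x ∈ F ∧ ContinuousAt h x ∧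
    AnalyticAt ℂ (chartAt ℂ (h x) ∘ h ∘ (chartAt ℂ x).symm) (chartAt ℂ x x) ∧
    ∀ᶠ y in 𝓝[≠] x, h y ≠ h x

theorem IsHoloMap.tendsto {h : X → Y} {E : Set X} {F : Set Y} (hh : IsHoloMap h E F) :
    Tendsto h (codiscreteWithin E) (codiscreteWithin F) := by
  unfold codiscreteWithin
  refine tendsto_iSup.2 fun x => tendsto_iSup.2 fun hx => ?_
  obtain ⟨hF, hc, -, hne⟩ := hh x hx
  refine Tendsto.mono_right ?_ (le_iSup₂_of_le (h x) hF le_rfl)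
  refine tendsto_nhdsWithin_iff.2 ⟨hc.mono_left nhdsWithin_le_nhds, ?_⟩
  have h1 : 𝓝[E \ {x}] x ≤ 𝓝[≠] x := nhdsWithin_mono _ fun y hy => hy.2
  filter_upwards [h1 hne, self_mem_nhdsWithin] with y hy hyE
  exact ⟨(hh y hyE.1).1, hy⟩

theorem IsHoloMap.isMeroAt_comp {h : X → Y} {E : Set X} {F : Set Y} (hh : IsHoloMap h E F)
    {f : Y → ℂ} (hf : ∀ y ∈ F, IsMeroAt f y) : ∀ x ∈ E, IsMeroAt (f ∘ h) x := by
  intro x hx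
  obtain ⟨hF, hc, ha, -⟩ := hh x hx
  have h0 : (chartAt ℂ x).symm (chartAt ℂ x x) = x :=
    (chartAt ℂ x).left_inv (mem_chart_source ℂ x)
  have h1 : MeromorphicAt (f ∘ (chartAt ℂ (h x)).symm)
      ((chartAt ℂ (h x) ∘ h ∘ (chartAt ℂ x).symm) (chartAt ℂ x x)) := by
    simpa [h0] using! hf (h x) hF
  refine (h1.comp_analyticAt ha).congr ?_
  have hcs : ContinuousAt (h ∘ (chartAt ℂ x).symm) (chartAt ℂ x x) := by
    refine ContinuousAt.comp (by rwa [h0]) ?_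
    exact (chartAt ℂ x).continuousAt_symm (mem_chart_target ℂ x)
  have hs : (chartAt ℂ (h x)).source ∈ 𝓝 ((h ∘ (chartAt ℂ x).symm) (chartAt ℂ x x)) := by
    simpa [h0] using! chart_source_mem_nhds ℂ (h x)
  have h2 := hcs.eventually hs
  filter_upwards [nhdsWithin_le_nhds h2] with w hw
  simp only [Function.comp_apply] at hw ⊢
  rw [(chartAt ℂ (h x)).left_inv hw]

/-- Pullback of meromorphic functions, `𝓜(F) → 𝓜(E)`, `f ↦ f ∘ h`. -/
def Mero.pullback (h : X → Y) {E : Set X} {F : Set Y} (hh : IsHoloMap h E F) :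
    Mero F →+* Mero E where
  toFun g := ⟨g.1.compTendsto h hh.tendsto, by
    obtain ⟨_, f, hf, rfl⟩ := g
    exact ⟨f ∘ h, hh.isMeroAt_comp hf, rfl⟩⟩
  map_one' := rfl
  map_mul' := by
    rintro ⟨_, f, hf, rfl⟩ ⟨_, g, hg, rfl⟩
    rfl
  map_zero' := rfl
  map_add' := by
    rintro ⟨_, f, hf, rfl⟩ ⟨_, g, hg, rfl⟩
    rfl

end Meromorphic

/-! ### The universal cover of `ℂ*` -/

/-- The universal cover of `ℂ*`, the set of pairs `(r e^{ib}, b)` with `r > 0` and `b ∈ ℝ`. -/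
def CStarCover : Type := {x : ℂ × ℝ // ∃ r : ℝ, 0 < r ∧ x.1 = r * Complex.exp (x.2 * Complex.I)}

namespace CStarCover

instance : TopologicalSpace CStarCover := instTopologicalSpaceSubtype

/-- The logarithm `(r e^{ib}, b) ↦ log r + i b` on the universal cover. -/
def log (x : CStarCover) : ℂ := Real.log ‖x.1.1‖ + x.1.2 * Complex.I

theorem ne_zero (x : CStarCover) : x.1.1 ≠ 0 := by
  obtain ⟨r, hr, h⟩ := x.2
  rw [h]
  exact mul_ne_zero (by exact_mod_cast hr.ne') (Complex.exp_ne_zero _)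

theorem norm_mul_exp (x : CStarCover) :
    (‖x.1.1‖ : ℂ) * Complex.exp (x.1.2 * Complex.I) = x.1.1 := by
  obtain ⟨r, hr, h⟩ := x.2
  rw [h]
  simp [Complex.norm_exp_ofReal_mul_I, abs_of_pos hr]

/-- The logarithm is a homeomorphism from the universal cover onto `ℂ`. -/
def logHomeo : CStarCover ≃ₜ ℂ where
  toFun := log
  invFun u := ⟨(Complex.exp u, u.im), Real.exp u.re, Real.exp_pos _, by
    rw [Complex.ofReal_exp, ← Complex.exp_add, Complex.re_add_im]⟩
  left_inv x := by
    apply Subtype.ext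
    have h : 0 < ‖x.1.1‖ := norm_pos_iff.2 x.ne_zero
    refine Prod.ext ?_ ?_
    · simp only [log]
      rw [Complex.exp_add, ← Complex.ofReal_exp, Real.exp_log h, norm_mul_exp]
    · simp [log]
  right_inv u := by
    simp only [log, Complex.norm_exp, Real.log_exp, Complex.re_add_im]
  continuous_toFun := by
    have h1 : Continuous fun x : CStarCover => x.1 := continuous_subtype_val
    have h2 : Continuous fun x : CStarCover => Real.log ‖x.1.1‖ :=
      Continuous.log (by fun_prop) fun x => norm_ne_zero_iff.2 x.ne_zero
    unfold log
    fun_prop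
  continuous_invFun := by
    refine Continuous.subtype_mk ?_ _
    fun_prop

/-- The complex structure of the universal cover, for which the logarithm is biholomorphic. -/
instance : ChartedSpace ℂ CStarCover :=
  logHomeo.toOpenPartialHomeomorph.singletonChartedSpace rfl

/-- The covering map `π = exp ∘ log`, that is `(r e^{ib}, b) ↦ r e^{ib}`. -/
def proj (x : CStarCover) : ℂ := Complex.exp (log x)

/-- The map `φ_p : (r e^{ib}, b) ↦ (r^p e^{ipb}, p b)`. -/
def phi (p : ℕ) (x : CStarCover) : CStarCover :=
  ⟨(x.1.1 ^ p, p * x.1.2), by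
    obtain ⟨r, hr, h⟩ := x.2
    refine ⟨r ^ p, pow_pos hr p, ?_⟩
    simp only [h, mul_pow, ← Complex.exp_nat_mul]
    push_cast
    ring_nf⟩

/-- `Σ₀`, the part of the universal cover above `0 < |z| < 1`. -/
def Sigma0 : Set CStarCover := {x | ‖x.1.1‖ < 1}

/-- `Σ_∞`, the part of the universal cover above `|z| > 1`. -/
def SigmaInf : Set CStarCover := {x | 1 < ‖x.1.1‖}

theorem proj_eq (x : CStarCover) : proj x = x.1.1 :=
  congrArg (fun y : CStarCover => y.1.1) (logHomeo.left_inv x)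

theorem log_phi (p : ℕ) (x : CStarCover) : log (phi p x) = p * log x := by
  simp only [log, phi, norm_pow, Real.log_pow]
  push_cast
  ring

theorem chartAt_apply (x y : CStarCover) : chartAt ℂ x y = log y := rfl

theorem chartAt_symm_apply (x : CStarCover) (u : ℂ) :
    (chartAt ℂ x).symm u = logHomeo.symm u := rfl

theorem log_symm (u : ℂ) : log (logHomeo.symm u) = u := logHomeo.apply_symm_apply u

theorem continuous_log : Continuous log := logHomeo.continuous

theorem isMeroAt_log (x : CStarCover) : IsMeroAt log x := by
  have h : log ∘ (chartAt ℂ x).symm = id := funext log_symm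
  unfold IsMeroAt
  rw [h]
  exact MeromorphicAt.id _

theorem isHoloMap_phi {p : ℕ} (hp : p ≠ 0) {E : Set CStarCover} (hE : MapsTo (phi p) E E) :
    IsHoloMap (phi p) E E := by
  have hp' : (p : ℂ) ≠ 0 := by exact_mod_cast hp
  have key : phi p = fun x => logHomeo.symm (p * log x) := by
    funext x
    rw [← log_phi]
    exact (logHomeo.left_inv _).symm
  intro x hx
  refine ⟨hE hx, ?_, ?_, ?_⟩
  · rw [key]
    exact (logHomeo.symm.continuous.comp (continuous_const.mul continuous_log)).continuousAt
  · have h : (chartAt ℂ (phi p x) ∘ phi p ∘ (chartAt ℂ x).symm) = fun u => (p : ℂ) * u := by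
      funext u
      simp only [Function.comp_apply, chartAt_apply, chartAt_symm_apply, log_phi, log_symm]
    rw [h]
    fun_prop
  · filter_upwards [self_mem_nhdsWithin] with y hy h
    apply hy
    have h1 := congrArg log h
    rw [log_phi, log_phi] at h1
    exact logHomeo.injective (mul_left_cancel₀ hp' h1)

theorem mapsTo_phi_Sigma0 {p : ℕ} (hp : p ≠ 0) : MapsTo (phi p) Sigma0 Sigma0 := by
  intro x hx
  change ‖x.1.1 ^ p‖ < 1
  rw [norm_pow]
  exact pow_lt_one₀ (norm_nonneg _) hx hp

theorem mapsTo_phi_SigmaInf {p : ℕ} (hp : p ≠ 0) : MapsTo (phi p) SigmaInf SigmaInf := by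
  intro x hx
  change 1 < ‖x.1.1 ^ p‖
  rw [norm_pow]
  exact one_lt_pow₀ hx hp

theorem isHoloMap_id {E F : Set CStarCover} (h : E ⊆ F) : IsHoloMap (id : CStarCover → _) E F := by
  intro x hx
  refine ⟨h hx, continuousAt_id, ?_, ?_⟩
  · have h : (chartAt ℂ (id x) ∘ id ∘ (chartAt ℂ x).symm) = id := funext log_symm
    rw [h]
    exact analyticAt_id
  · filter_upwards [self_mem_nhdsWithin] with y hy
    exact hy

theorem eventually_proj_ne (x : CStarCover) : ∀ᶠ y in 𝓝[≠] x, proj y ≠ proj x := by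
  have h1 : ∀ᶠ u in 𝓝[≠] (log x), Complex.exp u ≠ Complex.exp (log x) :=
    (Complex.hasDerivAt_exp (log x)).eventually_ne (Complex.exp_ne_zero _)
  have h2 : Tendsto log (𝓝[≠] x) (𝓝[≠] (log x)) := by
    refine tendsto_nhdsWithin_iff.2 ⟨continuous_log.continuousAt.mono_left nhdsWithin_le_nhds, ?_⟩
    filter_upwards [self_mem_nhdsWithin] with y hy h
    exact hy (logHomeo.injective h)
  exact h2.eventually h1

theorem isHoloMap_proj : IsHoloMap proj Sigma0 (Metric.ball (0 : ℂ) 1) := by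
  intro x hx
  refine ⟨?_, ?_, ?_, eventually_proj_ne x⟩
  · rw [proj_eq, mem_ball_zero_iff]
    exact hx
  · exact (Complex.continuous_exp.comp continuous_log).continuousAt
  · have h : (chartAt ℂ (proj x) ∘ proj ∘ (chartAt ℂ x).symm) = Complex.exp := by
      funext u
      simp only [Function.comp_apply, chartAt_symm_apply, proj, log_symm, chartAt_self_eq,
        OpenPartialHomeomorph.refl_apply, id]
    rw [h]
    fun_prop

end CStarCover

/-! ### The projective line -/

namespace ProjLine

open OnePoint

/-- The chart `z ↦ 1 / z` of `ℙ¹(ℂ) = ℂ ∪ {∞}`, defined on the complement of `0`. -/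
def chartInf : OpenPartialHomeomorph (OnePoint ℂ) ℂ where
  toFun x := x.elim 0 fun z => z⁻¹
  invFun w := if w = 0 then ∞ else ((w⁻¹ : ℂ) : OnePoint ℂ)
  source := {((0 : ℂ) : OnePoint ℂ)}ᶜ
  target := univ
  map_source' _ _ := mem_univ _
  map_target' w _ := by
    by_cases hw : w = 0 <;> simp [hw]
  left_inv' x hx := by
    induction x using OnePoint.rec with
    | infty => simp
    | coe z =>
      have hz : z ≠ 0 := fun h => hx (by simp [h])
      simp [hz]
  right_inv' w _ := by
    by_cases hw : w = 0 <;> simp [hw]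
  open_source := isOpen_compl_singleton
  open_target := isOpen_univ
  continuousOn_toFun := by
    intro x hx
    apply ContinuousAt.continuousWithinAt
    induction x using OnePoint.rec with
    | infty =>
      rw [OnePoint.continuousAt_infty', coclosedCompact_eq_cocompact,
        ← Metric.cobounded_eq_cocompact]
      exact tendsto_inv₀_cobounded
    | coe z =>
      have hz : z ≠ 0 := fun h => hx (by simp [h])
      rw [OnePoint.continuousAt_coe]
      exact continuousAt_inv₀ hz
  continuousOn_invFun := by
    intro w _
    apply ContinuousAt.continuousWithinAt
    by_cases hw : w = 0
    · subst hw
      rw [continuousAt_iff_punctured_nhds]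
      have h1 : Tendsto (fun w : ℂ => ((w⁻¹ : ℂ) : OnePoint ℂ)) (𝓝[≠] 0) (𝓝 ∞) := by
        refine OnePoint.tendsto_coe_infty.comp ?_
        rw [coclosedCompact_eq_cocompact, ← Metric.cobounded_eq_cocompact]
        exact tendsto_inv₀_nhdsNE_zero
      simp only [if_true]
      refine h1.congr' ?_
      filter_upwards [self_mem_nhdsWithin] with w hw
      exact (if_neg hw).symm
    · have h1 : ContinuousAt (fun w : ℂ => ((w⁻¹ : ℂ) : OnePoint ℂ)) w :=
        (OnePoint.continuous_coe.continuousAt).comp (continuousAt_inv₀ hw)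
      refine h1.congr ?_
      filter_upwards [isOpen_ne.mem_nhds hw] with v hv
      exact (if_neg hv).symm

/-- The chart `z ↦ z` of `ℙ¹(ℂ) = ℂ ∪ {∞}`, defined on the complement of `∞`. -/
def chartFin : OpenPartialHomeomorph (OnePoint ℂ) ℂ :=
  ((OnePoint.isOpenEmbedding_coe (X := ℂ)).toOpenPartialHomeomorph _).symm

/-- The complex structure of the projective line `ℙ¹(ℂ) = ℂ ∪ {∞}`. -/
instance : ChartedSpace ℂ (OnePoint ℂ) where
  atlas := {chartFin, chartInf}
  chartAt x := x.elim chartInf fun _ => chartFin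
  mem_chart_source x := by
    induction x using OnePoint.rec with
    | infty => simp [chartInf]
    | coe z => simp [chartFin]
  chart_mem_atlas x := by
    induction x using OnePoint.rec with
    | infty => exact Or.inr rfl
    | coe z => exact Or.inl rfl

/-- `ℙ¹(ℂ)` minus the closed unit disk. -/
def exterior : Set (OnePoint ℂ) :=
  ((fun z : ℂ => (z : OnePoint ℂ)) '' Metric.closedBall (0 : ℂ) 1)ᶜ

theorem isHoloMap_coe_proj :
    IsHoloMap (fun x => ((CStarCover.proj x : ℂ) : OnePoint ℂ)) CStarCover.SigmaInf exterior := by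
  intro x hx
  refine ⟨?_, ?_, ?_, ?_⟩
  · rintro ⟨z, hz, h⟩
    have h1 : z = CStarCover.proj x := OnePoint.coe_injective h
    rw [h1, CStarCover.proj_eq, mem_closedBall_zero_iff] at hz
    exact absurd hz (not_le.2 hx)
  · exact (OnePoint.continuous_coe.comp
      (Complex.continuous_exp.comp CStarCover.continuous_log)).continuousAt
  · have h : (chartAt ℂ ((CStarCover.proj x : ℂ) : OnePoint ℂ) ∘
        (fun x => ((CStarCover.proj x : ℂ) : OnePoint ℂ)) ∘ (chartAt ℂ x).symm) =
        Complex.exp := by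
      funext u
      have h1 : (chartFin : OnePoint ℂ → ℂ) ((Complex.exp u : ℂ) : OnePoint ℂ) = Complex.exp u :=
        ((OnePoint.isOpenEmbedding_coe (X := ℂ)).toOpenPartialHomeomorph _).left_inv (mem_univ _)
      simpa [CStarCover.proj, CStarCover.chartAt_symm_apply, CStarCover.log_symm] using! h1
    rw [h]
    fun_prop
  · filter_upwards [CStarCover.eventually_proj_ne x] with y hy h
    exact hy (OnePoint.coe_injective h)

end ProjLine

/-! ### Mahler systems -/

section Systems

variable (p : ℕ) [Fact (2 ≤ p)]

theorem p_ne_zero : p ≠ 0 := by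
  have h : 2 ≤ p := Fact.out
  omega

theorem nonZeroDivisors_le_comap_expand :
    nonZeroDivisors (Polynomial ℂ) ≤
      (nonZeroDivisors (Polynomial ℂ)).comap (Polynomial.expand ℂ p) := by
  intro q hq
  rw [Submonoid.mem_comap]
  rw [mem_nonZeroDivisors_iff_ne_zero] at hq ⊢
  exact fun h0 => hq ((Polynomial.expand_eq_zero (Nat.pos_of_ne_zero (p_ne_zero p))).1 h0)

/-- The endomorphism `φ_p : f(z) ↦ f(z^p)` of the field `ℂ(z)`. -/
def ratPhi : RatFunc ℂ →+* RatFunc ℂ :=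
  RatFunc.mapRingHom (Polynomial.expand ℂ p) (nonZeroDivisors_le_comap_expand p)

/-- An object of the category `𝓔` of Mahler systems: the system `φ_p(Y) = A Y` of rank `n`, with
`A ∈ GL_n(ℂ(z))`. -/
structure MahlerSystem (p : ℕ) where
  rank : ℕ
  mat : GL (Fin rank) (RatFunc ℂ)

/-- A morphism `A → B` of Mahler systems: a matrix `R` over `ℂ(z)` with `φ_p(R) A = B R`. -/
@[ext]
structure MahlerSystem.Hom (A B : MahlerSystem p) where
  R : Matrix (Fin B.rank) (Fin A.rank) (RatFunc ℂ)
  comm : R.map (ratPhi p) * A.mat.1 = B.mat.1 * R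

instance : Category (MahlerSystem p) where
  Hom A B := MahlerSystem.Hom p A B
  id A := ⟨1, by simp⟩
  comp f g := ⟨g.R * f.R, by
    rw [Matrix.map_mul, Matrix.mul_assoc, f.comm, ← Matrix.mul_assoc, g.comm, Matrix.mul_assoc]⟩
  id_comp f := MahlerSystem.Hom.ext (Matrix.mul_one _)
  comp_id f := MahlerSystem.Hom.ext (Matrix.one_mul _)
  assoc f g h := MahlerSystem.Hom.ext (Matrix.mul_assoc _ _ _).symm

/-- The matrix-valued function `B` is regular at `a`: its entries are analytic at `a` and `B(a)`
is invertible. -/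
def RegularAt {n : ℕ} (a : ℂ) (B : ℂ → Matrix (Fin n) (Fin n) ℂ) : Prop :=
  (∀ i j, AnalyticAt ℂ (fun z => B z i j) a) ∧ IsUnit (B a)

/-- `T` is an element of `GL_n(ℂ({z - a}))`: its entries are meromorphic at `a`, and its
determinant is not identically zero near `a`. -/
def MeroInvertibleAt {n : ℕ} (a : ℂ) (T : ℂ → Matrix (Fin n) (Fin n) ℂ) : Prop :=
  (∀ i j, MeromorphicAt (fun z => T z i j) a) ∧ ∀ᶠ z in 𝓝[≠] a, IsUnit (T z)

/-- For a point `a` with `a ^ p = a`, the system `φ_p(Y) = A Y` is regular singular at `a`: some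
`T ∈ GL_n(ℂ({z - a}))` transforms it into a system with matrix `B = φ_p(T)⁻¹ A T` that is regular
at `a`. -/
def RegularSingularAt {n : ℕ} (a : ℂ) (A : ℂ → Matrix (Fin n) (Fin n) ℂ) : Prop :=
  ∃ T B : ℂ → Matrix (Fin n) (Fin n) ℂ, MeroInvertibleAt a T ∧ RegularAt a B ∧
    ∀ᶠ z in 𝓝[≠] a, B z = (T (z ^ p))⁻¹ * A z * T z

/-- The values of a matrix of rational functions (used only away from the poles). -/
def evalMat {n : ℕ} (A : Matrix (Fin n) (Fin n) (RatFunc ℂ)) (z : ℂ) :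
    Matrix (Fin n) (Fin n) ℂ :=
  A.map fun f => f.eval (RingHom.id ℂ) z

/-- The system is regular singular at `0`, `1` and `∞`; at `∞` one uses the coordinate
`w = 1 / z`, in which `z ↦ z^p` is again `w ↦ w^p`. -/
def isRegularSingular : ObjectProperty (MahlerSystem p) := fun A =>
  RegularSingularAt p 0 (evalMat A.mat.1) ∧ RegularSingularAt p 1 (evalMat A.mat.1) ∧
    RegularSingularAt p 0 fun w => evalMat A.mat.1 w⁻¹

/-- The category `𝓔_rs`, the full subcategory of `𝓔` of the Mahler systems that are regular
singular at `0`, `1` and `∞`. -/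
abbrev RegSingSystem : Type := (isRegularSingular p).FullSubcategory

end Systems

/-! ### The category of connections -/

section Connections

open CStarCover ProjLine

variable (p : ℕ) [Fact (2 ≤ p)]

/-- `φ_p` on meromorphic functions on the universal cover. -/
def phiCover : Mero (univ : Set CStarCover) →+* Mero (univ : Set CStarCover) :=
  Mero.pullback (phi p) (isHoloMap_phi (p_ne_zero p) (mapsTo_univ _ _))

/-- `φ_p` on meromorphic functions on `Σ₀`. -/
def phiZero : Mero Sigma0 →+* Mero Sigma0 :=
  Mero.pullback (phi p) (isHoloMap_phi (p_ne_zero p) (mapsTo_phi_Sigma0 (p_ne_zero p)))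

/-- `φ_p` on meromorphic functions on `Σ_∞`. -/
def phiInf : Mero SigmaInf →+* Mero SigmaInf :=
  Mero.pullback (phi p) (isHoloMap_phi (p_ne_zero p) (mapsTo_phi_SigmaInf (p_ne_zero p)))

/-- Restriction from the universal cover to a subset. -/
def restr (E : Set CStarCover) : Mero (univ : Set CStarCover) →+* Mero E :=
  Mero.pullback id (isHoloMap_id (subset_univ E))

/-- `π^⋆ : 𝓜(D(0,1)) → 𝓜(Σ₀)`. -/
def piZero : Mero (Metric.ball (0 : ℂ) 1) →+* Mero Sigma0 :=
  Mero.pullback proj isHoloMap_proj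

/-- `π^⋆ : 𝓜(ℙ¹(ℂ) \ closed unit disk) → 𝓜(Σ_∞)`. -/
def piInf : Mero exterior →+* Mero SigmaInf :=
  Mero.pullback (fun x => ((proj x : ℂ) : OnePoint ℂ)) isHoloMap_coe_proj

/-- The function `log` in `𝓜` of the universal cover. -/
def logMero : Mero (univ : Set CStarCover) := Mero.mk log fun x _ => isMeroAt_log x

/-- The function `1 / log` in `𝓜` of the universal cover. -/
def logInvMero : Mero (univ : Set CStarCover) :=
  Mero.mk (fun x => (log x)⁻¹) fun x _ => (isMeroAt_log x).inv

/-- The ring `ℂ[log, log⁻¹]` of Laurent polynomials in `log`, inside the meromorphic functions on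
the universal cover. -/
def laurentLog : Subring (Mero (univ : Set CStarCover)) :=
  Subring.closure (range (Mero.const (univ : Set CStarCover)) ∪ {logMero, logInvMero})

/-- An object `(A₀, A₁, A_∞, M₀, M_∞)` of the category `𝓒` of connections. -/
structure Connection where
  rank : ℕ
  A0 : GL (Fin rank) ℂ
  A1 : GL (Fin rank) ℂ
  Ainf : GL (Fin rank) ℂ
  M0 : GL (Fin rank) (Mero Sigma0)
  Minf : GL (Fin rank) (Mero SigmaInf)
  phi_M0 : M0.map (phiZero p) = A1.map (Mero.const Sigma0) * M0 * (A0.map (Mero.const Sigma0))⁻¹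
  phi_Minf : Minf.map (phiInf p) =
    A1.map (Mero.const SigmaInf) * Minf * (Ainf.map (Mero.const SigmaInf))⁻¹
  exists_W : ∃ (W1 : GL (Fin rank) (Mero (univ : Set CStarCover)))
    (W0 : GL (Fin rank) (Mero (Metric.ball (0 : ℂ) 1))) (Winf : GL (Fin rank) (Mero exterior)),
    W1.map (restr Sigma0) * M0 = W0.map piZero ∧
    W1.map (restr SigmaInf) * Minf = Winf.map piInf

/-- A morphism `(S₀, S₁, S_∞)` from `(A₀, A₁, A_∞, M₀, M_∞)` to `(B₀, B₁, B_∞, N₀, N_∞)` in the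
category of connections. -/
@[ext]
structure Connection.Hom (X Y : Connection p) where
  S0 : Matrix (Fin Y.rank) (Fin X.rank) ℂ
  S1 : Matrix (Fin Y.rank) (Fin X.rank) laurentLog
  Sinf : Matrix (Fin Y.rank) (Fin X.rank) ℂ
  comm0 : S0 * X.A0.1 = Y.A0.1 * S0
  comm1 : (S1.map laurentLog.subtype).map (phiCover p) * X.A1.1.map (Mero.const (univ : Set CStarCover)) =
    Y.A1.1.map (Mero.const (univ : Set CStarCover)) * S1.map laurentLog.subtype
  commInf : Sinf * X.Ainf.1 = Y.Ainf.1 * Sinf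
  conn0 : (S1.map laurentLog.subtype).map (restr Sigma0) * X.M0.1 =
    Y.M0.1 * S0.map (Mero.const Sigma0)
  connInf : (S1.map laurentLog.subtype).map (restr SigmaInf) * X.Minf.1 =
    Y.Minf.1 * Sinf.map (Mero.const SigmaInf)

instance : Category (Connection p) where
  Hom X Y := Connection.Hom p X Y
  id X := ⟨1, 1, 1, by simp, by simp, by simp, by simp, by simp⟩
  comp f g := ⟨g.S0 * f.S0, g.S1 * f.S1, g.Sinf * f.Sinf,
    by rw [Matrix.mul_assoc, f.comm0, ← Matrix.mul_assoc, g.comm0, Matrix.mul_assoc],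
    by rw [Matrix.map_mul, Matrix.map_mul, Matrix.mul_assoc, f.comm1, ← Matrix.mul_assoc, g.comm1,
      Matrix.mul_assoc],
    by rw [Matrix.mul_assoc, f.commInf, ← Matrix.mul_assoc, g.commInf, Matrix.mul_assoc],
    by rw [Matrix.map_mul, Matrix.map_mul, Matrix.map_mul, Matrix.mul_assoc, f.conn0,
      ← Matrix.mul_assoc, g.conn0, Matrix.mul_assoc],
    by rw [Matrix.map_mul, Matrix.map_mul, Matrix.map_mul, Matrix.mul_assoc, f.connInf,
      ← Matrix.mul_assoc, g.connInf, Matrix.mul_assoc]⟩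
  id_comp f := Connection.Hom.ext (Matrix.mul_one _) (Matrix.mul_one _) (Matrix.mul_one _)
  comp_id f := Connection.Hom.ext (Matrix.one_mul _) (Matrix.one_mul _) (Matrix.one_mul _)
  assoc f g h := Connection.Hom.ext (Matrix.mul_assoc _ _ _).symm (Matrix.mul_assoc _ _ _).symm
    (Matrix.mul_assoc _ _ _).symm

end Connections

end Mahler

end

/-!
A Mahler system `φ_p(Y) = A Y` that is regular singular at `0`, `1` and `∞` has a meromorphic
fundamental solution around each of these points which brings it to a constant system; the
functional equation spreads the solutions around `0` and `∞` over the whole disks `|z| < 1` and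
`|z| > 1`, and the solution around `1` over the universal cover of `ℂ*`. The three constant matrices
and the two quotients of these solutions form the connection of the system, and a connection
determines its system because meromorphic functions on the cover that descend to both disks are
rational.

*Local theory.* At `0`, a system `Y(z^p) = B(z) Y(z)` with `B(0)` invertible is brought to the
constant system `B(0)` by the limit of the products `B(z)⁻¹ B(z^p)⁻¹ ⋯ B(z^{p^{k-1}})⁻¹ B(0)^k`, which
exists near `0` by `exists_analytic_solution`; the outcome is `exists_fundamental_zero`.
At `1`, in the coordinate `u = log z`, the operator `φ_p` becomes `u ↦ p u`, and the analogous
products converge when `B(u) - B(0)` vanishes to high enough order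
(`qEquiv_const_of_high_contact`). Shearings (`1 / u` on one column of the change of unknown,
`exists_shearing`) first move all eigenvalues of `B(0)` into one annulus `s ≤ |μ| < p s`
(`exists_annulus`); the quotient of two of them is then never `p^k` with `k ≥ 1`, so that the Taylor
coefficients of `B` can be removed one after the other by solving Sylvester equations
(`exists_high_contact`). The outcome is `exists_qEquiv_const` and `exists_fundamental_one`. Both
solutions extend along the dynamics of `z ↦ z^p` and of `u ↦ u / p` by `exists_meromorphic_extension`.

*Rigidity.* A meromorphic `Q` with `Q(z^p) A = B Q(z)`, where `A` and `B` are constant, is constant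
(`eventually_const_of_mahler`), and a meromorphic `Q` with `Q(p u) A = B Q(u)` is a Laurent polynomial
in `u` (`exists_laurent_of_qDifference`): in both cases the dynamics would shrink a Taylor remainder
faster than constant matrices can compensate. Hence a morphism of systems, read in fundamental
solutions, is a morphism of connections.

*Gluing.* A meromorphic function of `u = log z` that is a function of `z` for `Re u < 0` and for
`Re u > 0`, meromorphic at `0` and at `∞`, is `2πi`-periodic by the identity theorem, hence descends to
a meromorphic function on `ℙ¹`, which is rational (`exists_ratFunc_of_glue`). This recovers the
morphisms of systems and the systems themselves from the connections.

A `Link` between a system and a connection is a choice of fundamental solutions. Along links,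
morphisms of systems and of connections determine each other (`Link.exists_right`,
`Link.exists_left`), every regular singular system is linked to a connection (`exists_link_right`) and
conversely (`exists_link_left`); the functor `connectionFunctor` is therefore fully faithful and
essentially surjective. Functions around `∞` are written throughout in the coordinate `w = 1 / z`.
-/

noncomputable section

namespace Mahler

/-! ### Matrices of meromorphic and of analytic functions -/

section MatrixFunctions

variable {l m n : ℕ} {a : ℂ}

/-- The entries of the matrix-valued function `M` are meromorphic at `a`. -/
def MatMeroAt (M : ℂ → Matrix (Fin m) (Fin n) ℂ) (a : ℂ) : Prop :=
  ∀ i j, MeromorphicAt (fun z => M z i j) a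

/-- The entries of the matrix-valued function `M` are analytic at `a`. -/
def MatAnalyticAt (M : ℂ → Matrix (Fin m) (Fin n) ℂ) (a : ℂ) : Prop :=
  ∀ i j, AnalyticAt ℂ (fun z => M z i j) a

theorem MatMeroAt.const (C : Matrix (Fin m) (Fin n) ℂ) : MatMeroAt (fun _ => C) a :=
  fun _ _ => MeromorphicAt.const _ _

theorem MatMeroAt.mul {M : ℂ → Matrix (Fin l) (Fin m) ℂ} {N : ℂ → Matrix (Fin m) (Fin n) ℂ}
    (hM : MatMeroAt M a) (hN : MatMeroAt N a) : MatMeroAt (fun z => M z * N z) a := by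
  intro i j
  simp only [Matrix.mul_apply]
  exact MeromorphicAt.fun_sum fun k _ => (hM i k).mul (hN k j)

theorem MatMeroAt.congr {M N : ℂ → Matrix (Fin m) (Fin n) ℂ} (hM : MatMeroAt M a)
    (h : ∀ᶠ z in 𝓝[≠] a, M z = N z) : MatMeroAt N a :=
  fun i j => (hM i j).congr (h.mono fun z hz => by simp [hz])

theorem MatMeroAt.comp {M : ℂ → Matrix (Fin m) (Fin n) ℂ} {h : ℂ → ℂ} (hM : MatMeroAt M (h a))
    (hh : AnalyticAt ℂ h a) : MatMeroAt (fun z => M (h z)) a :=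
  fun i j => (hM i j).comp_analyticAt hh

theorem MatMeroAt.det {M : ℂ → Matrix (Fin n) (Fin n) ℂ} (hM : MatMeroAt M a) :
    MeromorphicAt (fun z => (M z).det) a := by
  simp only [Matrix.det_apply']
  exact MeromorphicAt.fun_sum fun σ _ => (MeromorphicAt.const _ _).mul
    (MeromorphicAt.fun_prod fun i _ => hM _ _)

theorem MatMeroAt.inv {M : ℂ → Matrix (Fin n) (Fin n) ℂ} (hM : MatMeroAt M a) :
    MatMeroAt (fun z => (M z)⁻¹) a := by
  intro i j
  simp only [Matrix.inv_def, Ring.inverse_eq_inv', Matrix.smul_apply, smul_eq_mul,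
    Matrix.adjugate_apply]
  refine hM.det.inv.mul (MatMeroAt.det (M := fun z => (M z).updateRow j (Pi.single i 1)) ?_)
  intro r c
  by_cases h : r = j
  · subst h
    simp
  · simpa [Matrix.updateRow_ne h] using hM r c

theorem MatAnalyticAt.const (C : Matrix (Fin m) (Fin n) ℂ) : MatAnalyticAt (fun _ => C) a :=
  fun _ _ => analyticAt_const

theorem MatAnalyticAt.matMeroAt {M : ℂ → Matrix (Fin m) (Fin n) ℂ} (hM : MatAnalyticAt M a) :
    MatMeroAt M a := fun i j => (hM i j).meromorphicAt

theorem MatAnalyticAt.mul {M : ℂ → Matrix (Fin l) (Fin m) ℂ} {N : ℂ → Matrix (Fin m) (Fin n) ℂ}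
    (hM : MatAnalyticAt M a) (hN : MatAnalyticAt N a) : MatAnalyticAt (fun z => M z * N z) a := by
  intro i j
  simp only [Matrix.mul_apply]
  exact Finset.analyticAt_fun_sum _ fun k _ => (hM i k).mul (hN k j)

theorem MatAnalyticAt.add {M N : ℂ → Matrix (Fin m) (Fin n) ℂ}
    (hM : MatAnalyticAt M a) (hN : MatAnalyticAt N a) : MatAnalyticAt (fun z => M z + N z) a :=
  fun i j => (hM i j).add (hN i j)

theorem MatAnalyticAt.smul {M : ℂ → Matrix (Fin m) (Fin n) ℂ} {f : ℂ → ℂ}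
    (hf : AnalyticAt ℂ f a) (hM : MatAnalyticAt M a) : MatAnalyticAt (fun z => f z • M z) a :=
  fun i j => hf.mul (hM i j)

theorem MatAnalyticAt.congr {M N : ℂ → Matrix (Fin m) (Fin n) ℂ} (hM : MatAnalyticAt M a)
    (h : ∀ᶠ z in 𝓝 a, M z = N z) : MatAnalyticAt N a :=
  fun i j => (hM i j).congr (h.mono fun z hz => by simp [hz])

theorem MatAnalyticAt.comp {M : ℂ → Matrix (Fin m) (Fin n) ℂ} {h : ℂ → ℂ}
    (hM : MatAnalyticAt M (h a)) (hh : AnalyticAt ℂ h a) : MatAnalyticAt (fun z => M (h z)) a :=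
  fun i j => AnalyticAt.fun_comp (hM i j) hh

theorem MatAnalyticAt.det {M : ℂ → Matrix (Fin n) (Fin n) ℂ} (hM : MatAnalyticAt M a) :
    AnalyticAt ℂ (fun z => (M z).det) a := by
  simp only [Matrix.det_apply']
  exact Finset.analyticAt_fun_sum _ fun σ _ => analyticAt_const.mul
    (Finset.analyticAt_fun_prod _ fun i _ => hM _ _)

theorem MatAnalyticAt.inv {M : ℂ → Matrix (Fin n) (Fin n) ℂ} (hM : MatAnalyticAt M a)
    (h0 : IsUnit (M a)) : MatAnalyticAt (fun z => (M z)⁻¹) a := by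
  intro i j
  simp only [Matrix.inv_def, Ring.inverse_eq_inv', Matrix.smul_apply, smul_eq_mul,
    Matrix.adjugate_apply]
  refine (hM.det.inv ((Matrix.isUnit_iff_isUnit_det _).1 h0).ne_zero).mul
    (MatAnalyticAt.det (M := fun z => (M z).updateRow j (Pi.single i 1)) ?_)
  intro r c
  by_cases h : r = j
  · subst h
    simpa using analyticAt_const
  · simpa [Matrix.updateRow_ne h] using hM r c

theorem MatAnalyticAt.eventually_isUnit {M : ℂ → Matrix (Fin n) (Fin n) ℂ}
    (hM : MatAnalyticAt M a) (h0 : IsUnit (M a)) : ∀ᶠ z in 𝓝 a, IsUnit (M z) := by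
  simp only [Matrix.isUnit_iff_isUnit_det, isUnit_iff_ne_zero] at h0 ⊢
  exact hM.det.continuousAt.eventually_ne h0

/-- An analytic matrix-valued function that vanishes at `0` is divisible by `z`. -/
theorem MatAnalyticAt.exists_eq_smul {M : ℂ → Matrix (Fin m) (Fin n) ℂ}
    (hM : MatAnalyticAt M 0) (h0 : M 0 = 0) :
    ∃ N : ℂ → Matrix (Fin m) (Fin n) ℂ, MatAnalyticAt N 0 ∧ ∀ z, M z = z • N z := by
  refine ⟨fun z => Matrix.of fun i j => dslope (fun w => M w i j) 0 z, fun i j => ?_, fun z => ?_⟩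
  · obtain ⟨s, hs⟩ := hM i j
    exact ⟨_, hs.has_fpower_series_dslope_fslope⟩
  · ext i j
    have h := sub_smul_dslope (fun w => M w i j) 0 z
    simp only [sub_zero, smul_eq_mul] at h
    simp [h, h0]

end MatrixFunctions

/-! ### The identity theorem -/

section IdentityTheorem

theorem eventually_codiscreteWithin_iff {X : Type*} [TopologicalSpace X] {U : Set X}
    (hU : IsOpen U) {P : X → Prop} :
    (∀ᶠ x in codiscreteWithin U, P x) ↔ ∀ x ∈ U, ∀ᶠ y in 𝓝[≠] x, P y := by
  simp only [Filter.Eventually, mem_codiscreteWithin_iff_forall_mem_nhdsNE]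
  refine forall₂_congr fun x hx => ⟨fun h => ?_, fun h => mem_of_superset h subset_union_left⟩
  filter_upwards [h, nhdsWithin_le_nhds (hU.mem_nhds hx)] with y hy hyU
  exact hy.resolve_right fun h => h hyU

theorem MeromorphicOn.eventually_eq_zero {U : Set ℂ} (hU : IsOpen U) (hc : IsPreconnected U)
    {f : ℂ → ℂ} (hf : MeromorphicOn f U) {a : ℂ} (ha : a ∈ U)
    (h : ∃ᶠ z in 𝓝[≠] a, f z = 0) : ∀ᶠ z in codiscreteWithin U, f z = 0 := by
  rw [eventually_codiscreteWithin_iff hU]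
  intro x hx
  rw [← meromorphicOrderAt_eq_top_iff]
  by_contra hne
  have h1 := hf.meromorphicOrderAt_ne_top_of_isPreconnected hc hx ha hne
  rw [meromorphicOrderAt_ne_top_iff_eventually_ne_zero (hf a ha)] at h1
  exact h (h1.mono fun z hz => hz)

/-- The identity theorem for matrices of meromorphic functions. -/
theorem eventually_eq_of_frequently_eq {m n : ℕ} {U : Set ℂ} (hU : IsOpen U)
    (hc : IsPreconnected U) {M N : ℂ → Matrix (Fin m) (Fin n) ℂ} (hM : ∀ z ∈ U, MatMeroAt M z)
    (hN : ∀ z ∈ U, MatMeroAt N z) {a : ℂ} (ha : a ∈ U) (h : ∃ᶠ z in 𝓝[≠] a, M z = N z) :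
    ∀ᶠ z in codiscreteWithin U, M z = N z := by
  have key : ∀ i j, ∀ᶠ z in codiscreteWithin U, M z i j - N z i j = 0 := fun i j =>
    MeromorphicOn.eventually_eq_zero hU hc (fun z hz => (hM z hz i j).sub (hN z hz i j)) ha
      (h.mono fun z hz => by simp [hz])
  have := eventually_all.2 fun i => eventually_all.2 fun j => key i j
  filter_upwards [this] with z hz
  ext i j
  exact sub_eq_zero.1 (hz i j)

/-- A matrix of meromorphic functions that is invertible near one point is invertible outside a
discrete set. -/
theorem eventually_isUnit_of_frequently {n : ℕ} {U : Set ℂ} (hU : IsOpen U)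
    (hc : IsPreconnected U) {M : ℂ → Matrix (Fin n) (Fin n) ℂ} (hM : ∀ z ∈ U, MatMeroAt M z)
    {a : ℂ} (ha : a ∈ U) (h : ∃ᶠ z in 𝓝[≠] a, IsUnit (M z)) :
    ∀ᶠ z in codiscreteWithin U, IsUnit (M z) := by
  simp only [Matrix.isUnit_iff_isUnit_det, isUnit_iff_ne_zero] at h ⊢
  have hf : MeromorphicOn (fun z => (M z).det) U := fun z hz => (hM z hz).det
  rw [eventually_codiscreteWithin_iff hU]
  intro x hx
  rw [← meromorphicOrderAt_ne_top_iff_eventually_ne_zero (hf x hx)]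
  refine hf.meromorphicOrderAt_ne_top_of_isPreconnected hc ha hx ?_
  intro htop
  rw [meromorphicOrderAt_eq_top_iff] at htop
  exact h (htop.mono fun z hz => not_not.2 hz)

end IdentityTheorem

/-! ### Solutions by convergent products -/

section Product

attribute [local instance] Matrix.linftyOpNormedRing Matrix.linftyOpNormedAlgebra

variable {n : ℕ}

theorem norm_entry_le (M : Matrix (Fin n) (Fin n) ℂ) (i j : Fin n) : ‖M i j‖ ≤ ‖M‖ := by
  rw [Matrix.linfty_opNorm_def]
  have h1 : ‖M i j‖₊ ≤ ∑ j, ‖M i j‖₊ :=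
    Finset.single_le_sum (f := fun j => ‖M i j‖₊) (fun _ _ => zero_le) (Finset.mem_univ j)
  have h2 := Finset.le_sup (f := fun i => ∑ j, ‖M i j‖₊) (Finset.mem_univ i)
  exact_mod_cast h1.trans h2

theorem MatAnalyticAt.continuousAt {m : ℕ} {M : ℂ → Matrix (Fin m) (Fin n) ℂ} {a : ℂ}
    (hM : MatAnalyticAt M a) : ContinuousAt M a :=
  continuousAt_pi.2 fun i => continuousAt_pi.2 fun j => (hM i j).continuousAt

/-- The partial products `E(z) E(σ z) ⋯ E(σ^{k-1} z)`. -/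
def orbitProd (E : ℂ → Matrix (Fin n) (Fin n) ℂ) (σ : ℂ → ℂ) : ℕ → ℂ → Matrix (Fin n) (Fin n) ℂ
  | 0, _ => 1
  | k + 1, z => E z * orbitProd E σ k (σ z)

variable {E : ℂ → Matrix (Fin n) (Fin n) ℂ} {σ : ℂ → ℂ}

theorem orbitProd_succ' (k : ℕ) (z : ℂ) :
    orbitProd E σ (k + 1) z = orbitProd E σ k z * E (σ^[k] z) := by
  induction k generalizing z with
  | zero => simp [orbitProd]
  | succ k ih => rw [orbitProd, ih, orbitProd, Matrix.mul_assoc, Function.iterate_succ_apply]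

theorem norm_orbitProd_le {S : Set ℂ} (hσ : MapsTo σ S S) {b : ℝ} (hb : ∀ z ∈ S, ‖E z‖ ≤ b)
    (k : ℕ) : ∀ z ∈ S, ‖orbitProd E σ k z‖ ≤ ‖(1 : Matrix (Fin n) (Fin n) ℂ)‖ * b ^ k := by
  induction k with
  | zero => intro z _; simp [orbitProd]
  | succ k ih =>
    intro z hz
    have hb0 : 0 ≤ b := (norm_nonneg _).trans (hb z hz)
    calc ‖orbitProd E σ (k + 1) z‖ ≤ ‖E z‖ * ‖orbitProd E σ k (σ z)‖ := norm_mul_le _ _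
      _ ≤ b * (‖(1 : Matrix (Fin n) (Fin n) ℂ)‖ * b ^ k) :=
        mul_le_mul (hb z hz) (ih _ (hσ hz)) (norm_nonneg _) hb0
      _ = _ := by ring

/-- If `E(σ^k z) D` tends to `1` fast enough, the products `E(z) E(σ z) ⋯ E(σ^{k-1} z) D^k` converge
to a solution `T` of `T(z) = E(z) T(σ z) D`. -/
theorem exists_analytic_solution {U : Set ℂ} (hU : IsOpen U) (hU0 : (0 : ℂ) ∈ U)
    (hσ : MapsTo σ U U) (hσa : ∀ z ∈ U, AnalyticAt ℂ σ z) (hσ0 : σ 0 = 0)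
    (hE : ∀ z ∈ U, MatAnalyticAt E z) {D : Matrix (Fin n) (Fin n) ℂ} (hD : E 0 * D = 1)
    {b θ K : ℝ} (hb : ∀ z ∈ U, ‖E z‖ ≤ b) (hθ : 0 ≤ θ)
    (hK : ∀ k, ∀ z ∈ U, ‖E (σ^[k] z) * D - 1‖ ≤ K * θ ^ k) (hlt : b * ‖D‖ * θ < 1) :
    ∃ T : ℂ → Matrix (Fin n) (Fin n) ℂ, (∀ z ∈ U, MatAnalyticAt T z) ∧ T 0 = 1 ∧
      ∀ z ∈ U, T z = E z * T (σ z) * D := by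
  set d : ℕ → ℂ → Matrix (Fin n) (Fin n) ℂ := fun k z =>
    orbitProd E σ k z * (E (σ^[k] z) * D - 1) * D ^ k with hd
  have hb0 : 0 ≤ b := (norm_nonneg _).trans (hb 0 hU0)
  have hK0 : 0 ≤ K := by simpa using (norm_nonneg _).trans (hK 0 0 hU0)
  set e : ℝ := ‖(1 : Matrix (Fin n) (Fin n) ℂ)‖ with he
  have hDk : ∀ k : ℕ, ‖D ^ k‖ ≤ e * ‖D‖ ^ k := by
    intro k
    induction k with
    | zero => simp [he]
    | succ k ih =>
      rw [pow_succ, pow_succ, ← mul_assoc]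
      exact (norm_mul_le _ _).trans (mul_le_mul_of_nonneg_right ih (norm_nonneg _))
  have hbound : ∀ k, ∀ z ∈ U, ‖d k z‖ ≤ e * e * K * (b * ‖D‖ * θ) ^ k := by
    intro k z hz
    have he0 : 0 ≤ e := norm_nonneg _
    calc ‖d k z‖ ≤ ‖orbitProd E σ k z‖ * ‖E (σ^[k] z) * D - 1‖ * ‖D ^ k‖ :=
          (norm_mul_le _ _).trans (mul_le_mul_of_nonneg_right (norm_mul_le _ _) (norm_nonneg _))
      _ ≤ (e * b ^ k) * (K * θ ^ k) * (e * ‖D‖ ^ k) := by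
          have h1 := norm_orbitProd_le hσ hb k z hz
          have h2 := hK k z hz
          have h3 := hDk k
          gcongr
      _ = _ := by ring
  have hsum : Summable fun k : ℕ => e * e * K * (b * ‖D‖ * θ) ^ k :=
    (summable_geometric_of_lt_one (by positivity) hlt).mul_left _
  have hiter : ∀ k, MapsTo (σ^[k]) U U := fun k => hσ.iterate k
  have hPa : ∀ k, ∀ z ∈ U, MatAnalyticAt (orbitProd E σ k) z := by
    intro k
    induction k with
    | zero => exact fun z _ => MatAnalyticAt.const 1
    | succ k ih => exact fun z hz => (hE z hz).mul ((ih _ (hσ hz)).comp (hσa z hz))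
  have hiter' : ∀ k, ∀ z ∈ U, AnalyticAt ℂ (σ^[k]) z := by
    intro k
    induction k with
    | zero => exact fun z _ => analyticAt_id
    | succ k ih =>
      intro z hz
      rw [Function.iterate_succ]
      exact AnalyticAt.comp (ih _ (hσ hz)) (hσa z hz)
  have hda : ∀ k, ∀ z ∈ U, MatAnalyticAt (d k) z := by
    intro k z hz
    refine ((hPa k z hz).mul (((((hE _ (hiter k hz)).comp (hiter' k z hz)).mul
      (MatAnalyticAt.const D))).add (MatAnalyticAt.const (-1)))).mul (MatAnalyticAt.const (D ^ k))
      |>.congr (Eventually.of_forall fun w => ?_)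
    simp only [hd, sub_eq_add_neg]
  have hsz : ∀ z ∈ U, Summable fun k => d k z := fun z hz =>
    Summable.of_norm_bounded hsum fun k => hbound k z hz
  have hent : ∀ z ∈ U, ∀ i j, (∑' k, d k z) i j = ∑' k, d k z i j := by
    intro z hz i j
    have h1 := (hsz z hz).hasSum
    exact ((Pi.hasSum.1 (Pi.hasSum.1 h1 i) j).tsum_eq).symm
  refine ⟨fun z => 1 + ∑' k, d k z, fun z hz => ?_, ?_, fun z hz => ?_⟩
  · refine (MatAnalyticAt.const 1).add fun i j => ?_
    have h1 : DifferentiableOn ℂ (fun z => ∑' k, d k z i j) U := by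
      refine Complex.differentiableOn_tsum_of_summable_norm hsum (fun k w hw => ?_) hU
        fun k w hw => (norm_entry_le _ i j).trans (hbound k w hw)
      exact (hda k w hw i j).differentiableAt.differentiableWithinAt
    refine (h1.analyticAt (hU.mem_nhds hz)).congr ?_
    filter_upwards [hU.mem_nhds hz] with w hw
    exact (hent w hw i j).symm
  · have h1 : ∀ k, d k 0 = 0 := by
      intro k
      have h2 : σ^[k] 0 = 0 := Function.iterate_fixed hσ0 k
      simp [hd, h2, hD]
    simp [h1]
  · have h1 : ∀ k, d (k + 1) z = E z * d k (σ z) * D := by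
      intro k
      simp only [hd, orbitProd, Function.iterate_succ_apply, pow_succ, Matrix.mul_assoc]
    have h2 : d 0 z = E z * D - 1 := by simp [hd, orbitProd]
    have h3 := (hsz z hz).tsum_eq_zero_add
    have h4 : ∑' k, d (k + 1) z = E z * (∑' k, d k (σ z)) * D := by
      simp only [h1]
      rw [← (hsz _ (hσ hz)).tsum_mul_left, ← ((hsz _ (hσ hz)).mul_left _).tsum_mul_right]
    simp only
    rw [h3, h2, h4, mul_add, add_mul, mul_one]
    abel

end Product

/-! ### Eigenvalues and Sylvester equations -/

section Eigenvalues

variable {n : ℕ}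

/-- Every eigenvalue of the complex matrix `M` satisfies `P`. -/
def EigenvaluesSatisfy (M : Matrix (Fin n) (Fin n) ℂ) (P : ℂ → Prop) : Prop :=
  ∀ (μ : ℂ) (x : Fin n → ℂ), x ≠ 0 → M.mulVec x = μ • x → P μ

theorem EigenvaluesSatisfy.of_mem_spectrum {M : Matrix (Fin n) (Fin n) ℂ} {P : ℂ → Prop}
    (h : EigenvaluesSatisfy M P) {μ : ℂ} (hμ : μ ∈ spectrum ℂ M) : P μ := by
  rw [spectrum.mem_iff, Matrix.isUnit_iff_isUnit_det, isUnit_iff_ne_zero, not_not,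
    ← Matrix.exists_mulVec_eq_zero_iff] at hμ
  obtain ⟨x, hx, h0⟩ := hμ
  refine h μ x hx ?_
  rw [Matrix.sub_mulVec, sub_eq_zero, Algebra.algebraMap_eq_smul_one, Matrix.smul_mulVec,
    Matrix.one_mulVec] at h0
  exact h0.symm

theorem norm_det_le_of_eigenvalues {M : Matrix (Fin n) (Fin n) ℂ} {R : ℝ}
    (h : EigenvaluesSatisfy M fun μ => ‖μ‖ ≤ R) : ‖M.det‖ ≤ R ^ n := by
  have hcard : M.charpoly.roots.card = n := by
    rw [IsAlgClosed.card_roots_eq_natDegree, Matrix.charpoly_natDegree_eq_dim, Fintype.card_fin]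
  have key : ∀ s : Multiset ℂ, (∀ μ ∈ s, ‖μ‖ ≤ R) → ‖s.prod‖ ≤ R ^ s.card := by
    intro s
    induction s using Multiset.induction_on with
    | empty => simp
    | cons a s ih =>
      intro hs
      have ha := hs a (Multiset.mem_cons_self a s)
      rw [Multiset.prod_cons, norm_mul, Multiset.card_cons, pow_succ']
      exact mul_le_mul ha (ih fun μ hμ => hs μ (Multiset.mem_cons_of_mem hμ)) (norm_nonneg _)
        ((norm_nonneg _).trans ha)
  rw [Matrix.det_eq_prod_roots_charpoly]
  refine (key _ fun μ hμ => ?_).trans_eq (by rw [hcard])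
  exact h.of_mem_spectrum
    (Matrix.mem_spectrum_iff_isRoot_charpoly.2 (Polynomial.isRoot_of_mem_roots hμ))

/-- The Sylvester equation `q X C - C X = G` is solvable when no two eigenvalues `λ`, `μ` of `C`
satisfy `q λ = μ`. -/
theorem exists_sylvester_solution {C : Matrix (Fin n) (Fin n) ℂ} {q : ℂ} (hq : q ≠ 0)
    (h : ∀ a ∈ spectrum ℂ C, ∀ b ∈ spectrum ℂ C, q * a ≠ b) (G : Matrix (Fin n) (Fin n) ℂ) :
    ∃ X : Matrix (Fin n) (Fin n) ℂ, q • (X * C) - C * X = G := by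
  rcases Nat.eq_zero_or_pos n with rfl | hn
  · exact ⟨0, Subsingleton.elim _ _⟩
  let L : Matrix (Fin n) (Fin n) ℂ →ₗ[ℂ] Matrix (Fin n) (Fin n) ℂ :=
    q • LinearMap.mulRight ℂ C - LinearMap.mulLeft ℂ C
  have hL : ∀ X, L X = q • (X * C) - C * X := fun X => rfl
  suffices hinj : Function.Injective L by
    obtain ⟨X, hX⟩ := LinearMap.surjective_of_injective hinj G
    exact ⟨X, hX⟩
  rw [injective_iff_map_eq_zero]
  intro X hX
  rw [hL, sub_eq_zero] at hX
  -- `X f(qC) = f(C) X` for every polynomial `f`, in particular for the characteristic one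
  have hpoly : ∀ f : Polynomial ℂ, X * Polynomial.aeval (q • C) f = Polynomial.aeval C f * X := by
    intro f
    induction f using Polynomial.induction_on' with
    | add f g hf hg => simp only [map_add, mul_add, add_mul, hf, hg]
    | monomial k a =>
      have hk : ∀ k : ℕ, X * (q • C) ^ k = C ^ k * X := by
        intro k
        induction k with
        | zero => simp
        | succ k ih =>
          rw [pow_succ, ← mul_assoc, ih, mul_assoc, Matrix.mul_smul, hX, pow_succ, mul_assoc]
      simp only [Polynomial.aeval_monomial, Algebra.algebraMap_eq_smul_one, Matrix.smul_mul,
        Matrix.mul_smul, one_mul, hk]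
  have h1 := hpoly C.charpoly
  rw [Matrix.aeval_self_charpoly, zero_mul] at h1
  have hdeg : 0 < C.charpoly.degree := by
    rw [Matrix.charpoly_degree_eq_dim, Fintype.card_fin]
    exact_mod_cast hn
  have hu : IsUnit (Polynomial.aeval (q • C) C.charpoly) := by
    rw [← spectrum.zero_notMem_iff ℂ, spectrum.map_polynomial_aeval_of_degree_pos _ _ hdeg]
    rintro ⟨μ, hμ, h0⟩
    have h2 : μ ∈ spectrum ℂ C := Matrix.mem_spectrum_iff_isRoot_charpoly.2 h0
    have h3 : q⁻¹ * μ ∈ spectrum ℂ C := by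
      have h4 := spectrum.smul_mem_smul_iff (a := C) (s := q⁻¹ * μ) (r := Units.mk0 q hq)
      rw [← h4]
      simpa [Units.smul_def, hq] using hμ
    exact h _ h3 _ h2 (by field_simp)
  exact (hu.mul_left_eq_zero).1 h1

end Eigenvalues

/-! ### The local theory of systems `Y(qu) = B(u) Y(u)` at `u = 0` -/

section QDifference

variable {n : ℕ}

/-- `B` and `B'` are equivalent: a meromorphic invertible change of unknown `T` near `0` carries
the system `Y(qu) = B(u) Y(u)` into `Y(qu) = B'(u) Y(u)`. -/
def QEquiv (q : ℂ) (B B' : ℂ → Matrix (Fin n) (Fin n) ℂ) : Prop :=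
  ∃ T : ℂ → Matrix (Fin n) (Fin n) ℂ, MatMeroAt T 0 ∧ (∀ᶠ u in 𝓝[≠] 0, IsUnit (T u)) ∧
    ∀ᶠ u in 𝓝[≠] 0, T (q * u) * B' u = B u * T u

theorem tendsto_const_mul_nhdsNE {q : ℂ} (hq : q ≠ 0) :
    Tendsto (fun u : ℂ => q * u) (𝓝[≠] 0) (𝓝[≠] 0) := by
  refine tendsto_nhdsWithin_iff.2 ⟨?_, ?_⟩
  · have h : Continuous fun u : ℂ => q * u := by fun_prop
    simpa using (h.tendsto 0).mono_left nhdsWithin_le_nhds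
  · filter_upwards [self_mem_nhdsWithin] with u hu
    exact mul_ne_zero hq hu

theorem QEquiv.refl (q : ℂ) (B : ℂ → Matrix (Fin n) (Fin n) ℂ) : QEquiv q B B :=
  ⟨fun _ => 1, MatMeroAt.const 1, Eventually.of_forall fun _ => isUnit_one,
    Eventually.of_forall fun _ => by simp⟩

theorem QEquiv.trans {q : ℂ} {B B' B'' : ℂ → Matrix (Fin n) (Fin n) ℂ}
    (h : QEquiv q B B') (h' : QEquiv q B' B'') : QEquiv q B B'' := by
  obtain ⟨T, hT, hTu, hTe⟩ := h
  obtain ⟨T', hT', hTu', hTe'⟩ := h'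
  refine ⟨fun u => T u * T' u, hT.mul hT', ?_, ?_⟩
  · filter_upwards [hTu, hTu'] with u h1 h2 using h1.mul h2
  · filter_upwards [hTe, hTe'] with u h1 h2
    rw [Matrix.mul_assoc, h2, ← Matrix.mul_assoc, h1, Matrix.mul_assoc]

/-- The shearing step: with the column of an eigenvector for the eigenvalue `a` of `B(0)` scaled by
`1 / u`, this eigenvalue is replaced by `q a` and no other eigenvalue is created. -/
theorem exists_shearing {q : ℂ} (hq : q ≠ 0) {B : ℂ → Matrix (Fin n) (Fin n) ℂ}
    (hB : MatAnalyticAt B 0) {a : ℂ} {v : Fin n → ℂ} (hv : v ≠ 0)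
    (hBv : (B 0).mulVec v = a • v) {P : ℂ → Prop} (hP : EigenvaluesSatisfy (B 0) P)
    (hPa : P (q * a)) :
    ∃ B' : ℂ → Matrix (Fin n) (Fin n) ℂ, MatAnalyticAt B' 0 ∧ (B' 0).det = q * (B 0).det ∧
      EigenvaluesSatisfy (B' 0) P ∧ QEquiv q B B' := by
  classical
  obtain ⟨c, hc⟩ : ∃ c, v c ≠ 0 := Function.ne_iff.1 hv
  -- a base change whose column `c` is the eigenvector
  set Q : Matrix (Fin n) (Fin n) ℂ := (1 : Matrix (Fin n) (Fin n) ℂ).updateCol c v with hQ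
  have hQdet : Q.det = v c := by
    rw [hQ, ← Matrix.cramer_apply, Matrix.cramer_one]
    rfl
  have hQu : IsUnit Q.det := by
    rw [hQdet]
    exact hc.isUnit
  have hQc : Q.mulVec (Pi.single c 1) = v := by
    rw [Matrix.mulVec_single_one]
    ext i
    simp [hQ]
  set B₁ : ℂ → Matrix (Fin n) (Fin n) ℂ := fun u => Q⁻¹ * B u * Q with hB₁
  have hB₁a : MatAnalyticAt B₁ 0 := ((MatAnalyticAt.const Q⁻¹).mul hB).mul (MatAnalyticAt.const Q)
  have hB₁c : (B₁ 0).mulVec (Pi.single c 1) = a • Pi.single c 1 := by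
    have h1 : Q⁻¹.mulVec v = Pi.single c 1 := by
      rw [← hQc, Matrix.mulVec_mulVec, Matrix.nonsing_inv_mul _ hQu, Matrix.one_mulVec]
    rw [hB₁]
    simp only [← Matrix.mulVec_mulVec]
    rw [hQc, hBv, Matrix.mulVec_smul, h1]
  have hP₁ : EigenvaluesSatisfy (B₁ 0) P := by
    intro μ x hx hμ
    refine hP μ (Q.mulVec x) ?_ ?_
    · intro h0
      apply hx
      have := congrArg Q⁻¹.mulVec h0
      rwa [Matrix.mulVec_mulVec, Matrix.nonsing_inv_mul _ hQu, Matrix.one_mulVec,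
        Matrix.mulVec_zero] at this
    · have := congrArg Q.mulVec hμ
      rw [hB₁] at this
      simp only [Matrix.mulVec_mulVec, ← Matrix.mul_assoc] at this
      rwa [Matrix.mul_nonsing_inv _ hQu, Matrix.one_mul, Matrix.mulVec_smul,
        ← Matrix.mulVec_mulVec] at this
  have hcol : ∀ i, B₁ 0 i c = if i = c then a else 0 := by
    intro i
    have := congrFun hB₁c i
    rw [Matrix.mulVec_single_one] at this
    simpa [Pi.single_apply] using this
  set N : ℂ → Fin n → ℂ := fun u i => dslope (fun w => B₁ w i c) 0 u with hN
  have hNa : ∀ i, AnalyticAt ℂ (fun u => N u i) 0 := by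
    intro i
    obtain ⟨s, hs⟩ := hB₁a i c
    exact ⟨_, hs.has_fpower_series_dslope_fslope⟩
  have hNe : ∀ i, i ≠ c → ∀ u, B₁ u i c = u * N u i := by
    intro i hi u
    have h := sub_smul_dslope (fun w => B₁ w i c) 0 u
    simp only [sub_zero, smul_eq_mul, hcol, if_neg hi] at h
    exact h.symm
  -- `B₁` transformed by the shearing `d`; row `c` of `B₂ 0` is `q a` on the diagonal, `0` elsewhere
  set B₂ : ℂ → Matrix (Fin n) (Fin n) ℂ := fun u => Matrix.of fun i j =>
    if i = c then (if j = c then q * B₁ u c c else q * u * B₁ u c j)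
    else (if j = c then N u i else B₁ u i j) with hB₂
  have hB₂a : MatAnalyticAt B₂ 0 := by
    intro i j
    simp only [hB₂, Matrix.of_apply]
    by_cases hi : i = c <;> by_cases hj : j = c <;> simp only [hi, hj, if_true, if_false]
    · exact analyticAt_const.mul (hB₁a c c)
    · exact (analyticAt_const.mul analyticAt_id).mul (hB₁a c j)
    · exact hNa i
    · exact hB₁a i j
  set d : ℂ → Fin n → ℂ := fun u i => if i = c then u⁻¹ else 1 with hd
  have hdu : ∀ u, u ≠ 0 → IsUnit (Matrix.diagonal (d u)) := by
    intro u hu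
    rw [Matrix.isUnit_diagonal, Pi.isUnit_iff]
    intro i
    by_cases hi : i = c <;> simp [hd, hi, hu]
  have hconj : ∀ u, u ≠ 0 →
      Matrix.diagonal (d (q * u)) * B₂ u = B₁ u * Matrix.diagonal (d u) := by
    intro u hu
    ext i j
    rw [Matrix.diagonal_mul, Matrix.mul_diagonal]
    simp only [hB₂, hd, Matrix.of_apply]
    by_cases hi : i = c <;> by_cases hj : j = c <;> simp only [hi, hj, if_true, if_false]
    · field_simp
    · field_simp
    · rw [hNe i hi u]
      field_simp
    · ring
  have hdet : ∀ u, u ≠ 0 → (B₂ u).det = q * (B u).det := by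
    intro u hu
    have h1 := congrArg Matrix.det (hconj u hu)
    have h2 : ∀ w, (Matrix.diagonal (d w)).det = w⁻¹ := by
      intro w
      rw [Matrix.det_diagonal]
      simp [hd]
    have h3 : (B₁ u).det = (B u).det := by
      rw [hB₁]
      simp only
      rw [Matrix.det_mul, Matrix.det_mul, Matrix.det_nonsing_inv, mul_right_comm,
        Ring.inverse_mul_cancel _ hQu, one_mul]
    rw [Matrix.det_mul, Matrix.det_mul, h2, h2, h3] at h1
    field_simp at h1
    linear_combination h1
  refine ⟨B₂, hB₂a, ?_, ?_, ?_⟩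
  · have h1 : Tendsto (fun u => (B₂ u).det) (𝓝[≠] 0) (𝓝 (B₂ 0).det) :=
      hB₂a.det.continuousAt.tendsto.mono_left nhdsWithin_le_nhds
    have h2 : Tendsto (fun u => q * (B u).det) (𝓝[≠] 0) (𝓝 (q * (B 0).det)) :=
      (hB.det.continuousAt.tendsto.const_mul q).mono_left nhdsWithin_le_nhds
    refine tendsto_nhds_unique (h1.congr' ?_) h2
    filter_upwards [self_mem_nhdsWithin] with u hu using hdet u hu
  · intro μ x hx hμ
    have hrow := congrFun hμ c
    have hrow' : q * a * x c = μ * x c := by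
      simpa [Matrix.mulVec, dotProduct, hB₂, hcol] using hrow
    by_cases hqa : q * a = μ
    · exact hqa ▸ hPa
    have hxc : x c = 0 := by
      rcases mul_eq_mul_right_iff.1 hrow' with h | h
      · exact absurd h hqa
      · exact h
    by_cases haμ : μ = a
    · refine hP₁ μ (Pi.single c 1) ?_ (haμ ▸ hB₁c)
      simp
    -- correct `x` by a multiple of the eigenvector for `a`
    set s : ℂ := ((B₁ 0).mulVec x) c with hs
    have hrest : (B₁ 0).mulVec x = μ • x + s • Pi.single c 1 := by
      ext i
      by_cases hi : i = c
      · subst hi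
        simp [hs, hxc]
      · have h1 := congrFun hμ i
        have h2 : (B₂ 0).mulVec x i = (B₁ 0).mulVec x i := by
          simp only [Matrix.mulVec, dotProduct]
          refine Finset.sum_congr rfl fun j _ => ?_
          by_cases hj : j = c
          · simp [hj, hxc]
          · simp [hB₂, hi, hj]
        rw [← h2, h1]
        simp [hi]
    have hμa : μ - a ≠ 0 := sub_ne_zero.2 haμ
    refine hP₁ μ (x + (s / (μ - a)) • Pi.single c 1) ?_ ?_
    · intro h0
      apply hx
      ext i
      by_cases hi : i = c
      · rw [hi, hxc]
        rfl
      · have := congrFun h0 i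
        simpa [Pi.single_apply, hi] using this
    · rw [Matrix.mulVec_add, Matrix.mulVec_smul, hB₁c, hrest, smul_add, add_assoc, smul_smul,
        smul_smul, ← add_smul]
      congr 2
      field_simp
      ring
  · refine ⟨fun u => Q * Matrix.diagonal (d u), ?_, ?_, ?_⟩
    · refine (MatMeroAt.const Q).mul fun i j => ?_
      by_cases hij : i = j
      · subst hij
        simp only [Matrix.diagonal_apply_eq, hd]
        by_cases hi : i = c
        · simp only [hi, if_true]
          exact (MeromorphicAt.id 0).inv
        · simp only [hi, if_false]
          exact MeromorphicAt.const _ _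
      · simp only [Matrix.diagonal_apply_ne _ hij]
        exact MeromorphicAt.const _ _
    · filter_upwards [self_mem_nhdsWithin] with u hu
      exact ((Matrix.isUnit_iff_isUnit_det _).2 hQu).mul (hdu u hu)
    · filter_upwards [self_mem_nhdsWithin] with u hu
      rw [Matrix.mul_assoc, hconj u hu, hB₁]
      simp only [← Matrix.mul_assoc]
      rw [Matrix.mul_nonsing_inv _ hQu, Matrix.one_mul]

/-- After finitely many shearings all eigenvalues of the constant term lie in an annulus
`s ≤ |μ| < p s`: every shearing of an eigenvalue with `|a| < s` multiplies `|det B(0)|` by `p`,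
while this determinant stays bounded by `(p s)^n`. The number `k` bounds the number of shearings. -/
theorem exists_annulus {p : ℕ} (hp : 2 ≤ p) {s : ℝ} (k : ℕ) :
    ∀ {B : ℂ → Matrix (Fin n) (Fin n) ℂ}, MatAnalyticAt B 0 → (B 0).det ≠ 0 →
      EigenvaluesSatisfy (B 0) (fun μ => ‖μ‖ < p * s) → (p * s) ^ n < ‖(B 0).det‖ * p ^ k →
      ∃ B' : ℂ → Matrix (Fin n) (Fin n) ℂ, MatAnalyticAt B' 0 ∧ (B' 0).det ≠ 0 ∧
        EigenvaluesSatisfy (B' 0) (fun μ => s ≤ ‖μ‖ ∧ ‖μ‖ < p * s) ∧ QEquiv (p : ℂ) B B' := by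
  have hp0 : (p : ℂ) ≠ 0 := by
    have : p ≠ 0 := by omega
    exact_mod_cast this
  have hp1 : (0 : ℝ) < p := by exact_mod_cast (by omega : 0 < p)
  induction k with
  | zero =>
    intro B _ _ hP hk
    have := norm_det_le_of_eigenvalues (R := p * s) fun μ x hx h => (hP μ x hx h).le
    rw [pow_zero, mul_one] at hk
    exact absurd hk (not_lt.2 this)
  | succ k ih =>
    intro B hB hdet hP hk
    by_cases hall : EigenvaluesSatisfy (B 0) (fun μ => s ≤ ‖μ‖)
    · exact ⟨B, hB, hdet, fun μ x hx h => ⟨hall μ x hx h, hP μ x hx h⟩, QEquiv.refl _ B⟩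
    · simp only [EigenvaluesSatisfy, not_forall, not_le] at hall
      obtain ⟨a, v, hv, hBv, ha⟩ := hall
      obtain ⟨B', hB', hdet', hP', hE⟩ := exists_shearing hp0 hB hv hBv hP (by
        rw [norm_mul, Complex.norm_natCast]
        exact mul_lt_mul_of_pos_left ha hp1)
      obtain ⟨B'', h1, h2, h3, h4⟩ := ih hB' (by rw [hdet']; exact mul_ne_zero hp0 hdet) hP' (by
        rw [hdet', norm_mul, Complex.norm_natCast]
        calc _ < _ := hk
          _ = _ := by ring)
      exact ⟨B'', h1, h2, h3, hE.trans h4⟩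

/-- One coefficient of `B` beyond the constant term is removed by the change of unknown
`1 + u^k X`, where `X` solves a Sylvester equation. -/
theorem exists_remove_coeff {p : ℕ} (hp : 2 ≤ p) {C : Matrix (Fin n) (Fin n) ℂ} {s : ℝ}
    (hC : EigenvaluesSatisfy C fun μ => s ≤ ‖μ‖ ∧ ‖μ‖ < p * s) {k : ℕ} (hk : k ≠ 0)
    {G : ℂ → Matrix (Fin n) (Fin n) ℂ} (hG : MatAnalyticAt G 0) :
    ∃ G' : ℂ → Matrix (Fin n) (Fin n) ℂ, MatAnalyticAt G' 0 ∧
      QEquiv (p : ℂ) (fun u => C + u ^ k • G u) (fun u => C + u ^ (k + 1) • G' u) := by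
  have hp0 : (p : ℂ) ≠ 0 := by
    have : p ≠ 0 := by omega
    exact_mod_cast this
  have hp1 : (1 : ℝ) ≤ p := by exact_mod_cast (by omega : 1 ≤ p)
  have hq : (p : ℂ) ^ k ≠ 0 := pow_ne_zero _ hp0
  obtain ⟨X, hX⟩ := exists_sylvester_solution hq (C := C) (fun a ha b hb h => by
    have h1 := hC.of_mem_spectrum ha
    have h2 := hC.of_mem_spectrum hb
    have h3 : (p : ℝ) ≤ (p : ℝ) ^ k := le_self_pow₀ hp1 hk
    have h4 : ‖b‖ = (p : ℝ) ^ k * ‖a‖ := by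
      rw [← h, norm_mul, norm_pow, Complex.norm_natCast]
    have h5 : (p : ℝ) * s ≤ p * ‖a‖ := mul_le_mul_of_nonneg_left h1.1 (by positivity)
    have h6 : (p : ℝ) * ‖a‖ ≤ (p : ℝ) ^ k * ‖a‖ := mul_le_mul_of_nonneg_right h3 (norm_nonneg _)
    linarith [h2.2]) (G 0)
  have hpow : ∀ j : ℕ, AnalyticAt ℂ (fun u : ℂ => u ^ j) 0 := fun j => analyticAt_id.pow j
  obtain ⟨H, hH, hHe⟩ := MatAnalyticAt.exists_eq_smul
    (M := fun u => (G u + (-G 0)) + u ^ k • (G u * X))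
    ((hG.add (MatAnalyticAt.const _)).add (MatAnalyticAt.smul (hpow k) (hG.mul
      (MatAnalyticAt.const X)))) (by simp [hk])
  set T : ℂ → Matrix (Fin n) (Fin n) ℂ := fun u => 1 + u ^ k • X with hT
  have hTa : MatAnalyticAt T 0 :=
    (MatAnalyticAt.const 1).add (MatAnalyticAt.smul (hpow k) (MatAnalyticAt.const X))
  have hT0 : T 0 = 1 := by simp [hT, hk]
  have hlin : AnalyticAt ℂ (fun u : ℂ => (p : ℂ) * u) 0 := by fun_prop
  have hTpa : MatAnalyticAt (fun u => T (p * u)) 0 := by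
    have : MatAnalyticAt T ((p : ℂ) * 0) := by simpa using hTa
    exact this.comp hlin
  have hTp0 : IsUnit (T (p * 0)) := by simp [hT0]
  refine ⟨fun u => (T (p * u))⁻¹ * H u, (hTpa.inv hTp0).mul hH, T, hTa.matMeroAt, ?_, ?_⟩
  · exact nhdsWithin_le_nhds (hTa.eventually_isUnit (by simp [hT0]))
  · filter_upwards [nhdsWithin_le_nhds (hTpa.eventually_isUnit hTp0)] with u hu
    have h1 : T (p * u) * (T (p * u))⁻¹ = 1 :=
      Matrix.mul_nonsing_inv _ ((Matrix.isUnit_iff_isUnit_det _).1 hu)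
    have h2 : T (p * u) * (C + u ^ (k + 1) • ((T (p * u))⁻¹ * H u)) =
        T (p * u) * C + u ^ k • (u • H u) := by
      rw [Matrix.mul_add, Matrix.mul_smul, ← Matrix.mul_assoc, h1, Matrix.one_mul, smul_smul,
        pow_succ]
    rw [h2, ← hHe, ← hX]
    simp only [hT, Matrix.add_mul, Matrix.mul_add, Matrix.one_mul, Matrix.mul_one, smul_add,
      smul_sub, Matrix.smul_mul, Matrix.mul_smul, smul_smul, mul_pow, neg_sub]
    rw [mul_comm (u ^ k) ((p : ℂ) ^ k)]
    abel

/-- When the eigenvalues of the constant term lie in an annulus `s ≤ |μ| < p s`, the coefficients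
of `u, …, u^k` can be removed one after the other. -/
theorem exists_high_contact {p : ℕ} (hp : 2 ≤ p) {C : Matrix (Fin n) (Fin n) ℂ} {s : ℝ}
    (hC : EigenvaluesSatisfy C fun μ => s ≤ ‖μ‖ ∧ ‖μ‖ < p * s)
    {B : ℂ → Matrix (Fin n) (Fin n) ℂ} (hB : MatAnalyticAt B 0) (h0 : B 0 = C) (k : ℕ) :
    ∃ G : ℂ → Matrix (Fin n) (Fin n) ℂ, MatAnalyticAt G 0 ∧
      QEquiv (p : ℂ) B (fun u => C + u ^ (k + 1) • G u) := by
  induction k with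
  | zero =>
    obtain ⟨G, hG, hGe⟩ := MatAnalyticAt.exists_eq_smul (M := fun u => B u + (-C))
      (hB.add (MatAnalyticAt.const _)) (by simp [h0])
    refine ⟨G, hG, ?_⟩
    convert QEquiv.refl (p : ℂ) B using 2 with u
    rw [zero_add, pow_one, ← hGe]
    abel
  | succ k ih =>
    obtain ⟨G, hG, hE⟩ := ih
    obtain ⟨G', hG', hE'⟩ := exists_remove_coeff hp hC k.succ_ne_zero hG
    exact ⟨G', hG', hE.trans hE'⟩

section

attribute [local instance] Matrix.linftyOpNormedRing Matrix.linftyOpNormedAlgebra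

/-- A system that agrees with a constant one to high order is equivalent to it. -/
theorem qEquiv_const_of_high_contact {p : ℕ} (hp : 2 ≤ p) {C : Matrix (Fin n) (Fin n) ℂ}
    (hC : C.det ≠ 0) {N : ℕ} (hN : (‖C‖ + 1) * ‖C⁻¹‖ < (p : ℝ) ^ N) (hN0 : N ≠ 0)
    {G : ℂ → Matrix (Fin n) (Fin n) ℂ} (hG : MatAnalyticAt G 0) :
    QEquiv (p : ℂ) (fun u => C + u ^ N • G u) (fun _ => C) := by
  have hp0 : (p : ℂ) ≠ 0 := by
    have : p ≠ 0 := by omega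
    exact_mod_cast this
  have hp1 : (1 : ℝ) ≤ p := by exact_mod_cast (by omega : 1 ≤ p)
  have hpp : (0 : ℝ) < p := by linarith
  set B : ℂ → Matrix (Fin n) (Fin n) ℂ := fun u => C + u ^ N • G u with hB
  have hBa : MatAnalyticAt B 0 := (MatAnalyticAt.const C).add
    (MatAnalyticAt.smul (analyticAt_id.pow N) hG)
  have hB0 : B 0 = C := by simp [hB, hN0]
  -- a disk on which everything is analytic and bounded
  have hev : ∀ᶠ u in 𝓝 (0 : ℂ), MatAnalyticAt B u ∧ ‖B u‖ < ‖C‖ + 1 ∧ ‖G u‖ < ‖G 0‖ + 1 := by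
    refine (eventually_all.2 fun i => eventually_all.2 fun j =>
      (hBa i j).eventually_analyticAt).and (Eventually.and ?_ ?_)
    · have h1 := hBa.continuousAt.norm
      refine h1.eventually (gt_mem_nhds ?_)
      simp [hB0]
    · exact hG.continuousAt.norm.eventually (gt_mem_nhds (by simp))
  obtain ⟨r, hr, hball⟩ := Metric.eventually_nhds_iff_ball.1 hev
  set R : ℝ := min r 1 with hR
  have hRpos : 0 < R := lt_min hr one_pos
  have hball' : ∀ u ∈ Metric.ball (0 : ℂ) R, u ∈ Metric.ball (0 : ℂ) r := fun u hu =>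
    Metric.ball_subset_ball (min_le_left _ _) hu
  set σ : ℂ → ℂ := fun u => (p : ℂ)⁻¹ * u with hσ
  have hσn : ∀ k u, σ^[k] u = ((p : ℂ)⁻¹) ^ k * u := by
    intro k
    induction k with
    | zero => intro u; simp
    | succ k ih => intro u; rw [Function.iterate_succ_apply, ih, hσ]; ring
  have hpinv : ((p : ℝ)⁻¹) ≤ 1 := inv_le_one_of_one_le₀ hp1
  have hσU : MapsTo σ (Metric.ball (0 : ℂ) R) (Metric.ball (0 : ℂ) R) := by
    intro u hu
    rw [mem_ball_zero_iff] at hu ⊢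
    rw [hσ]
    simp only [norm_mul, norm_inv, Complex.norm_natCast]
    exact (mul_le_of_le_one_left (norm_nonneg _) hpinv).trans_lt hu
  have hCu : C * C⁻¹ = 1 := Matrix.mul_nonsing_inv _ hC.isUnit
  have hCu' : C⁻¹ * C = 1 := Matrix.nonsing_inv_mul _ hC.isUnit
  obtain ⟨T, hTa, hT0, hTe⟩ := exists_analytic_solution (E := fun u => B (σ u)) (σ := σ)
    (D := C⁻¹) (b := ‖C‖ + 1) (θ := ((p : ℝ) ^ N)⁻¹) (K := (‖G 0‖ + 1) * ‖C⁻¹‖)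
    Metric.isOpen_ball (Metric.mem_ball_self hRpos) hσU
    (fun z _ => by rw [hσ]; fun_prop) (by simp [hσ])
    (fun z hz => (hball _ (hball' _ (hσU hz))).1.comp (by rw [hσ]; fun_prop))
    (by simp [hσ, hB0, hCu])
    (fun z hz => (hball _ (hball' _ (hσU hz))).2.1.le) (by positivity)
    (fun k z hz => by
      have hmem : σ (σ^[k] z) ∈ Metric.ball (0 : ℂ) R := hσU (hσU.iterate k hz)
      have h1 : B (σ (σ^[k] z)) * C⁻¹ - 1 =
          (σ (σ^[k] z)) ^ N • (G (σ (σ^[k] z)) * C⁻¹) := by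
        simp only [hB, Matrix.add_mul, hCu, Matrix.smul_mul]
        abel
      have h2 : ‖σ (σ^[k] z)‖ ≤ ((p : ℝ)⁻¹) ^ k := by
        rw [← Function.iterate_succ_apply' σ, hσn, norm_mul, norm_pow, norm_inv,
          Complex.norm_natCast, pow_succ]
        have hz1 : ‖z‖ ≤ 1 := (mem_ball_zero_iff.1 hz).le.trans (min_le_right _ _)
        have h3 : (0 : ℝ) ≤ ((p : ℝ)⁻¹) ^ k := by positivity
        have h4 : (0 : ℝ) ≤ (p : ℝ)⁻¹ := by positivity
        calc ((p : ℝ)⁻¹) ^ k * (p : ℝ)⁻¹ * ‖z‖ ≤ ((p : ℝ)⁻¹) ^ k * 1 * 1 := by gcongr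
          _ = _ := by ring
      have h5 := (hball _ (hball' _ hmem)).2.2.le
      rw [h1, norm_smul, norm_pow]
      calc ‖σ (σ^[k] z)‖ ^ N * ‖G (σ (σ^[k] z)) * C⁻¹‖
          ≤ (((p : ℝ)⁻¹) ^ k) ^ N * ((‖G 0‖ + 1) * ‖C⁻¹‖) := by
            refine mul_le_mul (pow_le_pow_left₀ (norm_nonneg _) h2 N) ?_ (norm_nonneg _)
              (by positivity)
            exact (norm_mul_le _ _).trans (mul_le_mul_of_nonneg_right h5 (norm_nonneg _))
        _ = _ := by
            rw [← pow_mul, ← inv_pow, ← pow_mul, mul_comm k N, mul_comm])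
    (by
      rw [← div_eq_mul_inv, div_lt_one (by positivity)]
      exact hN)
  have hTa0 := hTa 0 (Metric.mem_ball_self hRpos)
  refine ⟨T, hTa0.matMeroAt, nhdsWithin_le_nhds (hTa0.eventually_isUnit (by simp [hT0])), ?_⟩
  have hlin : Tendsto (fun u : ℂ => (p : ℂ) * u) (𝓝 0) (𝓝 0) := by
    have h : Continuous fun u : ℂ => (p : ℂ) * u := by fun_prop
    simpa using h.tendsto 0
  have hmem := hlin.eventually (Metric.ball_mem_nhds (0 : ℂ) hRpos)
  filter_upwards [nhdsWithin_le_nhds hmem] with u hu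
  have h1 := hTe _ hu
  have h2 : σ (p * u) = u := by
    rw [hσ]
    field_simp
  simp only [h2] at h1
  rw [h1, Matrix.mul_assoc, hCu', Matrix.mul_one]

end

/-- A system `Y(pu) = B(u) Y(u)` with `B` regular at `0` is equivalent to one with a constant
matrix. -/
theorem exists_qEquiv_const {p : ℕ} (hp : 2 ≤ p) {B : ℂ → Matrix (Fin n) (Fin n) ℂ}
    (hB : MatAnalyticAt B 0) (h0 : IsUnit (B 0)) :
    ∃ C : GL (Fin n) ℂ, QEquiv (p : ℂ) B (fun _ => C.1) := by
  let _ := Matrix.linftyOpNormedRing (n := Fin n) (α := ℂ)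
  have hp1 : (1 : ℝ) < p := by exact_mod_cast (by omega : 1 < p)
  have hdet : (B 0).det ≠ 0 := ((Matrix.isUnit_iff_isUnit_det _).1 h0).ne_zero
  obtain ⟨s, hs⟩ : ∃ s : ℝ, EigenvaluesSatisfy (B 0) fun μ => ‖μ‖ < p * s := by
    obtain ⟨s, hs⟩ := ((B 0).finite_spectrum (R := ℂ)).isCompact.isBounded.exists_norm_le
    refine ⟨|s| + 1, fun μ x hx hμ => ?_⟩
    have h1 : μ ∈ spectrum ℂ (B 0) := by
      rw [spectrum.mem_iff, Matrix.isUnit_iff_isUnit_det, isUnit_iff_ne_zero, not_not,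
        ← Matrix.exists_mulVec_eq_zero_iff]
      refine ⟨x, hx, ?_⟩
      rw [Matrix.sub_mulVec, Algebra.algebraMap_eq_smul_one, Matrix.smul_mulVec,
        Matrix.one_mulVec, hμ, sub_self]
    have h2 : ‖μ‖ ≤ |s| := (hs μ h1).trans (le_abs_self s)
    nlinarith [abs_nonneg s]
  obtain ⟨k, hk⟩ := pow_unbounded_of_one_lt ((p * s) ^ n / ‖(B 0).det‖) hp1
  obtain ⟨B', hB', hdet', hP, hE⟩ := exists_annulus hp k hB hdet hs (by
    rw [div_lt_iff₀ (norm_pos_iff.2 hdet)] at hk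
    exact hk.trans_eq (mul_comm _ _))
  obtain ⟨N, hN⟩ := pow_unbounded_of_one_lt ((‖B' 0‖ + 1) * ‖(B' 0)⁻¹‖) hp1
  obtain ⟨G, hG, hE'⟩ := exists_high_contact hp hP hB' rfl N
  refine ⟨Matrix.GeneralLinearGroup.mkOfDetNeZero (B' 0) hdet', (hE.trans hE').trans ?_⟩
  refine qEquiv_const_of_high_contact hp hdet' (hN.trans_le ?_) N.succ_ne_zero hG
  exact pow_le_pow_right₀ hp1.le N.le_succ

end QDifference

/-! ### The local theory of systems `Y(z^p) = B(z) Y(z)` at `z = 0` -/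

section MahlerLocal

variable {n : ℕ}

attribute [local instance] Matrix.linftyOpNormedRing Matrix.linftyOpNormedAlgebra

theorem iterate_pow_apply (p k : ℕ) (z : ℂ) : (fun z : ℂ => z ^ p)^[k] z = z ^ p ^ k := by
  induction k generalizing z with
  | zero => simp
  | succ k ih => rw [Function.iterate_succ_apply, ih, ← pow_mul, pow_succ']

theorem mapsTo_pow_ball {p : ℕ} (hp : p ≠ 0) {R : ℝ} (hR1 : R ≤ 1) :
    MapsTo (fun z : ℂ => z ^ p) (Metric.ball 0 R) (Metric.ball 0 R) := by
  intro z hz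
  rw [mem_ball_zero_iff] at hz ⊢
  rw [norm_pow]
  exact (pow_le_of_le_one (norm_nonneg _) (hz.le.trans hR1) hp).trans_lt hz

theorem tendsto_pow_nhdsNE {p : ℕ} (hp : p ≠ 0) :
    Tendsto (fun z : ℂ => z ^ p) (𝓝[≠] 0) (𝓝[≠] 0) := by
  refine tendsto_nhdsWithin_iff.2 ⟨?_, ?_⟩
  · have h : Continuous fun z : ℂ => z ^ p := by fun_prop
    simpa [hp] using (h.tendsto 0).mono_left nhdsWithin_le_nhds
  · filter_upwards [self_mem_nhdsWithin] with z hz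
    exact pow_ne_zero p hz

/-- A system `Y(z^p) = B(z) Y(z)` with `B` regular at `0` is equivalent, by an analytic change of
unknown, to the constant system with matrix `B(0)`. -/
theorem exists_mahler_const {p : ℕ} (hp : 2 ≤ p) {B : ℂ → Matrix (Fin n) (Fin n) ℂ}
    (hB : MatAnalyticAt B 0) (h0 : IsUnit (B 0)) :
    ∃ G : ℂ → Matrix (Fin n) (Fin n) ℂ, MatAnalyticAt G 0 ∧ G 0 = 1 ∧
      ∀ᶠ z in 𝓝 (0 : ℂ), G (z ^ p) * B 0 = B z * G z := by
  have hp0 : p ≠ 0 := by omega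
  have hEa : MatAnalyticAt (fun z => (B z)⁻¹) 0 := hB.inv h0
  have hinv : (B 0)⁻¹ * B 0 = 1 :=
    Matrix.nonsing_inv_mul _ ((Matrix.isUnit_iff_isUnit_det _).1 h0)
  obtain ⟨H, hH, hHe⟩ := MatAnalyticAt.exists_eq_smul (M := fun z => (B z)⁻¹ * B 0 + (-1))
    ((hEa.mul (MatAnalyticAt.const (B 0))).add (MatAnalyticAt.const (-1))) (by simp [hinv])
  set b : ℝ := ‖(B 0)⁻¹‖ + 1 with hb
  have hb0 : 0 < b := by positivity
  have hev : ∀ᶠ z in 𝓝 (0 : ℂ), MatAnalyticAt (fun z => (B z)⁻¹) z ∧ ‖(B z)⁻¹‖ < b ∧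
      ‖H z‖ < ‖H 0‖ + 1 ∧ IsUnit (B z) := by
    refine (eventually_all.2 fun i => eventually_all.2 fun j =>
      (hEa i j).eventually_analyticAt).and (Eventually.and ?_ (Eventually.and ?_ ?_))
    · exact hEa.continuousAt.norm.eventually (gt_mem_nhds (by simp [hb]))
    · exact hH.continuousAt.norm.eventually (gt_mem_nhds (by simp))
    · exact hB.eventually_isUnit h0
  obtain ⟨r, hr, hball⟩ := Metric.eventually_nhds_iff_ball.1 hev
  -- on the disk of radius `R` the iterates `z^(p^k)` are bounded by `R^k`
  set R : ℝ := min r (min 1 (b * ‖B 0‖ + 1)⁻¹) with hR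
  have hRpos : 0 < R := lt_min hr (lt_min one_pos (by positivity))
  have hR1 : R ≤ 1 := (min_le_right _ _).trans (min_le_left _ _)
  have hR2 : R ≤ (b * ‖B 0‖ + 1)⁻¹ := (min_le_right _ _).trans (min_le_right _ _)
  have hball' : ∀ u ∈ Metric.ball (0 : ℂ) R, u ∈ Metric.ball (0 : ℂ) r := fun u hu =>
    Metric.ball_subset_ball (min_le_left _ _) hu
  have hσU := mapsTo_pow_ball hp0 hR1
  obtain ⟨T, hTa, hT0, hTe⟩ := exists_analytic_solution (E := fun z => (B z)⁻¹)
    (σ := fun z => z ^ p) (D := B 0) (b := b) (θ := R) (K := ‖H 0‖ + 1)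
    Metric.isOpen_ball (Metric.mem_ball_self hRpos) hσU (fun z _ => by fun_prop) (by simp [hp0])
    (fun z hz => (hball _ (hball' _ hz)).1) hinv (fun z hz => (hball _ (hball' _ hz)).2.1.le)
    hRpos.le
    (fun k z hz => by
      have hmem := hσU.iterate k hz
      rw [sub_eq_add_neg, hHe, norm_smul]
      have h1 := (hball _ (hball' _ hmem)).2.2.1.le
      have h2 : ‖(fun z : ℂ => z ^ p)^[k] z‖ ≤ R ^ k := by
        rw [iterate_pow_apply, norm_pow]
        have h3 : ‖z‖ ≤ R := (mem_ball_zero_iff.1 hz).le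
        calc ‖z‖ ^ p ^ k ≤ R ^ p ^ k := pow_le_pow_left₀ (norm_nonneg _) h3 _
          _ ≤ R ^ k := pow_le_pow_of_le_one hRpos.le hR1 (Nat.lt_pow_self (by omega)).le
      rw [mul_comm]
      exact mul_le_mul h1 h2 (norm_nonneg _) (by positivity))
    (by
      have hpos : 0 < b * ‖B 0‖ + 1 := by positivity
      calc b * ‖B 0‖ * R ≤ b * ‖B 0‖ * (b * ‖B 0‖ + 1)⁻¹ := by gcongr
        _ < 1 := by
          rw [← div_eq_mul_inv, div_lt_one hpos]
          linarith)
  refine ⟨T, hTa 0 (Metric.mem_ball_self hRpos), hT0, ?_⟩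
  filter_upwards [Metric.ball_mem_nhds (0 : ℂ) hRpos] with z hz
  have h1 := hTe z hz
  have h2 := Matrix.mul_nonsing_inv _
    ((Matrix.isUnit_iff_isUnit_det _).1 (hball _ (hball' _ hz)).2.2.2)
  rw [h1, Matrix.mul_assoc, ← Matrix.mul_assoc, h2, Matrix.one_mul]

end MahlerLocal

/-! ### Extension of local solutions -/

section Extension

variable {n : ℕ}

theorem MatMeroAt.eventually {m : ℕ} {M : ℂ → Matrix (Fin m) (Fin n) ℂ} {a : ℂ}
    (hM : MatMeroAt M a) : ∀ᶠ z in 𝓝 a, MatMeroAt M z := by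
  refine eventually_all.2 fun i => eventually_all.2 fun j => ?_
  have h := eventually_nhdsWithin_iff.1 (hM i j).eventually_analyticAt
  filter_upwards [h] with z hz
  by_cases hza : z = a
  · exact hza ▸ hM i j
  · exact (hz hza).meromorphicAt

/-- A meromorphic solution of `f(z) = E(z) f(σ z) D` on a small open set `V` extends to every
point some iterate of which lies in `V`. -/
theorem exists_meromorphic_extension {U V : Set ℂ} (hV : IsOpen V) {σ : ℂ → ℂ}
    (hσa : ∀ z ∈ U, AnalyticAt ℂ σ z) (hσU : MapsTo σ U U) (hσV : MapsTo σ V V)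
    (hσ0 : ∀ z, z ≠ 0 → σ z ≠ 0) (hit : ∀ z ∈ U, ∃ k, σ^[k] z ∈ V)
    {E f : ℂ → Matrix (Fin n) (Fin n) ℂ} {D : Matrix (Fin n) (Fin n) ℂ}
    (hE : ∀ z ∈ U, MatMeroAt E z) (hf : ∀ z ∈ V, MatMeroAt f z)
    (hfe : ∀ z ∈ V, z ≠ 0 → f z = E z * f (σ z) * D) :
    ∃ F : ℂ → Matrix (Fin n) (Fin n) ℂ, (∀ z ∈ U, MatMeroAt F z) ∧
      (∀ z ∈ V, z ≠ 0 → F z = f z) ∧ ∀ z ∈ U, z ≠ 0 → F z = E z * F (σ z) * D := by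
  classical
  set X : ℕ → ℂ → Matrix (Fin n) (Fin n) ℂ := fun k z =>
    orbitProd E σ k z * f (σ^[k] z) * D ^ k with hX
  have hne : ∀ k z, z ≠ 0 → σ^[k] z ≠ 0 := by
    intro k
    induction k with
    | zero => exact fun z hz => hz
    | succ k ih => exact fun z hz => ih _ (hσ0 z hz)
  have hstep : ∀ k z, z ≠ 0 → σ^[k] z ∈ V → X (k + 1) z = X k z := by
    intro k z hz hk
    simp only [hX]
    rw [orbitProd_succ', hfe _ hk (hne k z hz), Function.iterate_succ_apply', pow_succ']
    simp only [Matrix.mul_assoc]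
  have hmono : ∀ k m z, z ≠ 0 → σ^[k] z ∈ V → X (k + m) z = X k z := by
    intro k m z hz hk
    induction m with
    | zero => rfl
    | succ m ih =>
      rw [← add_assoc, hstep _ z hz, ih]
      rw [add_comm, Function.iterate_add_apply]
      exact hσV.iterate m hk
  have huniq : ∀ k m z, z ≠ 0 → σ^[k] z ∈ V → σ^[m] z ∈ V → X k z = X m z := by
    intro k m z hz hk hm
    rw [← hmono k m z hz hk, ← hmono m k z hz hm, add_comm]
  set F : ℂ → Matrix (Fin n) (Fin n) ℂ := fun z =>
    if h : ∃ k, σ^[k] z ∈ V then X h.choose z else 0 with hF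
  have hFX : ∀ k z, z ≠ 0 → σ^[k] z ∈ V → F z = X k z := by
    intro k z hz hk
    have h : ∃ k, σ^[k] z ∈ V := ⟨k, hk⟩
    rw [hF]
    simp only [dif_pos h]
    exact huniq _ _ z hz h.choose_spec hk
  have hPm : ∀ k, ∀ z ∈ U, MatMeroAt (orbitProd E σ k) z := by
    intro k
    induction k with
    | zero => exact fun z _ => MatMeroAt.const 1
    | succ k ih => exact fun z hz => (hE z hz).mul ((ih _ (hσU hz)).comp (hσa z hz))
  have hiter : ∀ k, ∀ z ∈ U, AnalyticAt ℂ (σ^[k]) z := by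
    intro k
    induction k with
    | zero => exact fun z _ => analyticAt_id
    | succ k ih =>
      intro z hz
      rw [Function.iterate_succ]
      exact AnalyticAt.comp (ih _ (hσU hz)) (hσa z hz)
  refine ⟨F, fun z hz => ?_, fun z hz hz0 => ?_, fun z hz hz0 => ?_⟩
  · obtain ⟨k, hk⟩ := hit z hz
    have h1 : MatMeroAt (X k) z :=
      ((hPm k z hz).mul ((hf _ hk).comp (hiter k z hz))).mul (MatMeroAt.const (D ^ k))
    refine h1.congr ?_
    have h2 : ∀ᶠ w in 𝓝 z, σ^[k] w ∈ V :=
      (hiter k z hz).continuousAt.eventually (hV.mem_nhds hk)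
    have h3 : ∀ᶠ w in 𝓝[≠] z, w ≠ 0 := by
      by_cases hz0 : z = 0
      · subst hz0
        exact self_mem_nhdsWithin
      · exact nhdsWithin_le_nhds (isOpen_ne.mem_nhds hz0)
    filter_upwards [nhdsWithin_le_nhds h2, h3] with w hw hw0
    exact (hFX k w hw0 hw).symm
  · rw [hFX 0 z hz0 hz]
    simp [hX, orbitProd]
  · obtain ⟨k, hk⟩ := hit z hz
    have hk' : σ^[k] (σ z) ∈ V := by
      rw [← Function.iterate_succ_apply, Function.iterate_succ_apply']
      exact hσV hk
    rw [hFX k _ (hσ0 z hz0) hk', hFX (k + 1) z hz0 hk']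
    simp only [hX, orbitProd, Function.iterate_succ_apply, pow_succ, Matrix.mul_assoc]

end Extension

/-! ### Fundamental solutions at the fixed points -/

section Fundamental

variable {n : ℕ} {p : ℕ} [Fact (2 ≤ p)]

theorem isPreconnected_unitBall : IsPreconnected (Metric.ball (0 : ℂ) 1) :=
  (convex_ball 0 1).isPreconnected

/-- A system that is regular singular at `0` has a meromorphic fundamental solution on the unit
disk, up to a constant matrix. -/
theorem exists_fundamental_zero {a : ℂ → Matrix (Fin n) (Fin n) ℂ}
    (ha : ∀ z ∈ Metric.ball (0 : ℂ) 1, MatMeroAt a z) (h : RegularSingularAt p 0 a) :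
    ∃ (F : ℂ → Matrix (Fin n) (Fin n) ℂ) (C : GL (Fin n) ℂ),
      (∀ z ∈ Metric.ball (0 : ℂ) 1, MatMeroAt F z) ∧
      (∀ᶠ z in codiscreteWithin (Metric.ball (0 : ℂ) 1), IsUnit (F z)) ∧
      ∀ᶠ z in codiscreteWithin (Metric.ball (0 : ℂ) 1), F (z ^ p) * C.1 = a z * F z := by
  have hp : 2 ≤ p := Fact.out
  have hp0 : p ≠ 0 := by omega
  obtain ⟨T, B, ⟨hT, hTu⟩, ⟨hB, hB0⟩, hTB⟩ := h
  change MatAnalyticAt B 0 at hB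
  change MatMeroAt T 0 at hT
  obtain ⟨G, hG, hG0, hGe⟩ := exists_mahler_const hp hB hB0
  have hBu := hB.eventually_isUnit hB0
  have hGu := hG.eventually_isUnit (by simp [hG0])
  have hTu' := (tendsto_pow_nhdsNE hp0).eventually hTu
  have hfm : MatMeroAt (fun z => T z * G z) 0 := hT.mul hG.matMeroAt
  have hau : ∀ᶠ z in 𝓝[≠] (0 : ℂ), IsUnit (a z) ∧
      T (z ^ p) * G (z ^ p) * B 0 = a z * (T z * G z) ∧ IsUnit (T z * G z) := by
    filter_upwards [hTu, hTu', hTB, nhdsWithin_le_nhds hGe, nhdsWithin_le_nhds hBu,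
      nhdsWithin_le_nhds hGu] with z h1 h2 h3 h4 h5 h6
    have h7 : T (z ^ p) * B z = a z * T z := by
      rw [h3, ← Matrix.mul_assoc, ← Matrix.mul_assoc,
        Matrix.mul_nonsing_inv _ ((Matrix.isUnit_iff_isUnit_det _).1 h2), Matrix.one_mul]
    refine ⟨?_, ?_, h1.mul h6⟩
    · have h8 : IsUnit (a z * T z) := h7 ▸ h2.mul h5
      exact (IsUnit.mul_right_iff h1).1 h8
    · rw [Matrix.mul_assoc, h4, ← Matrix.mul_assoc, h7, Matrix.mul_assoc]
  have hev := (eventually_nhdsWithin_iff.1 hau).and hfm.eventually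
  obtain ⟨r, hr, hball⟩ := Metric.eventually_nhds_iff_ball.1 hev
  set R : ℝ := min r 1 with hR
  have hRpos : 0 < R := lt_min hr one_pos
  have hball' : ∀ u ∈ Metric.ball (0 : ℂ) R, u ∈ Metric.ball (0 : ℂ) r := fun u hu =>
    Metric.ball_subset_ball (min_le_left _ _) hu
  obtain ⟨F, hFm, hFf, hFe⟩ := exists_meromorphic_extension (U := Metric.ball (0 : ℂ) 1)
    (V := Metric.ball (0 : ℂ) R) (σ := fun z => z ^ p) (E := fun z => (a z)⁻¹)
    (f := fun z => T z * G z) (D := B 0) Metric.isOpen_ball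
    (fun z _ => by fun_prop) (mapsTo_pow_ball hp0 le_rfl) (mapsTo_pow_ball hp0 (min_le_right _ _))
    (fun z hz => pow_ne_zero p hz)
    (fun z hz => by
      rw [mem_ball_zero_iff] at hz
      obtain ⟨k, hk⟩ := exists_pow_lt_of_lt_one hRpos hz
      refine ⟨k, ?_⟩
      rw [iterate_pow_apply, mem_ball_zero_iff, norm_pow]
      exact (pow_le_pow_of_le_one (norm_nonneg _) hz.le
        (Nat.lt_pow_self (by omega)).le).trans_lt hk)
    (fun z hz => (ha z hz).inv) (fun z hz => (hball _ (hball' _ hz)).2)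
    (fun z hz hz0 => by
      obtain ⟨h1, h2, -⟩ := (hball _ (hball' _ hz)).1 hz0
      rw [Matrix.mul_assoc, h2, ← Matrix.mul_assoc,
        Matrix.nonsing_inv_mul _ ((Matrix.isUnit_iff_isUnit_det _).1 h1), Matrix.one_mul])
  have h0mem : (0 : ℂ) ∈ Metric.ball (0 : ℂ) 1 := Metric.mem_ball_self one_pos
  have hau' : ∀ᶠ z in codiscreteWithin (Metric.ball (0 : ℂ) 1), IsUnit (a z) :=
    eventually_isUnit_of_frequently Metric.isOpen_ball isPreconnected_unitBall ha h0mem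
      (hau.mono fun z hz => hz.1).frequently
  refine ⟨F, Matrix.GeneralLinearGroup.mkOfDetNeZero (B 0)
    ((Matrix.isUnit_iff_isUnit_det _).1 hB0).ne_zero, hFm, ?_, ?_⟩
  · refine eventually_isUnit_of_frequently Metric.isOpen_ball isPreconnected_unitBall hFm h0mem
      (Eventually.frequently ?_)
    filter_upwards [hau, nhdsWithin_le_nhds (Metric.ball_mem_nhds (0 : ℂ) hRpos),
      self_mem_nhdsWithin] with z h1 h2 h3
    rw [hFf z h2 h3]
    exact h1.2.2
  · filter_upwards [hau', self_mem_codiscreteWithin _,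
      compl_singleton_mem_codiscreteWithin (0 : ℂ)] with z h1 h2 h3
    have h4 := hFe z h2 h3
    change F (z ^ p) * B 0 = _
    rw [h4, ← Matrix.mul_assoc, ← Matrix.mul_assoc,
      Matrix.mul_nonsing_inv _ ((Matrix.isUnit_iff_isUnit_det _).1 h1), Matrix.one_mul]

theorem tendsto_exp_nhdsNE (u : ℂ) : Tendsto Complex.exp (𝓝[≠] u) (𝓝[≠] (Complex.exp u)) := by
  refine tendsto_nhdsWithin_iff.2 ⟨Complex.continuous_exp.continuousAt.mono_left
    nhdsWithin_le_nhds, ?_⟩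
  exact (Complex.hasDerivAt_exp u).eventually_ne (Complex.exp_ne_zero _)

/-- A system that is regular singular at `1` has, in the coordinate `u = log z`, a meromorphic
fundamental solution on the whole plane, up to a constant matrix. -/
theorem exists_fundamental_one {a : ℂ → Matrix (Fin n) (Fin n) ℂ}
    (ha : ∀ z, MatMeroAt a z) (h : RegularSingularAt p 1 a) :
    ∃ (F : ℂ → Matrix (Fin n) (Fin n) ℂ) (C : GL (Fin n) ℂ), (∀ u, MatMeroAt F u) ∧
      (∀ᶠ u in codiscreteWithin univ, IsUnit (F u)) ∧
      ∀ᶠ u in codiscreteWithin univ, F (p * u) * C.1 = a (Complex.exp u) * F u := by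
  have hp : 2 ≤ p := Fact.out
  have hp0 : (p : ℂ) ≠ 0 := by exact_mod_cast p_ne_zero p
  have hp1 : (1 : ℝ) < p := by exact_mod_cast (by omega : 1 < p)
  obtain ⟨T, B, ⟨hT, hTu⟩, ⟨hB, hB0⟩, hTB⟩ := h
  change MatAnalyticAt B 1 at hB
  change MatMeroAt T 1 at hT
  have hexp : AnalyticAt ℂ Complex.exp 0 := by fun_prop
  have hexp1 : Tendsto Complex.exp (𝓝[≠] 0) (𝓝[≠] 1) := by
    simpa only [Complex.exp_zero] using tendsto_exp_nhdsNE 0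
  have hBe : MatAnalyticAt (fun u => B (Complex.exp u)) 0 := by
    have : MatAnalyticAt B (Complex.exp 0) := by simpa using hB
    exact this.comp hexp
  have hTe : MatMeroAt (fun u => T (Complex.exp u)) 0 := by
    have : MatMeroAt T (Complex.exp 0) := by simpa using hT
    exact this.comp hexp
  have hTu1 := hexp1.eventually hTu
  have hE : QEquiv (p : ℂ) (fun u => a (Complex.exp u)) (fun u => B (Complex.exp u)) := by
    refine ⟨fun u => T (Complex.exp u), hTe, hTu1, ?_⟩
    filter_upwards [(tendsto_const_mul_nhdsNE hp0).eventually hTu1,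
      hexp1.eventually hTB] with u h1 h2
    rw [h2, ← Complex.exp_nat_mul, ← Matrix.mul_assoc, ← Matrix.mul_assoc,
      Matrix.mul_nonsing_inv _ ((Matrix.isUnit_iff_isUnit_det _).1 h1), Matrix.one_mul]
  obtain ⟨C, hC⟩ := exists_qEquiv_const hp hBe (by simpa using hB0)
  obtain ⟨S, hS, hSu, hSe⟩ := hE.trans hC
  have hev := (eventually_nhdsWithin_iff.1 hSe).and hS.eventually
  obtain ⟨r, hr, hball⟩ := Metric.eventually_nhds_iff_ball.1 hev
  set σ : ℂ → ℂ := fun u => (p : ℂ)⁻¹ * u with hσ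
  have hσn : ∀ k u, σ^[k] u = ((p : ℂ)⁻¹) ^ k * u := by
    intro k
    induction k with
    | zero => intro u; simp
    | succ k ih => intro u; rw [Function.iterate_succ_apply, ih, hσ]; ring
  have hσp : ∀ u, (p : ℂ) * σ u = u := fun u => by
    rw [hσ]
    field_simp
  have hσV : MapsTo σ (Metric.ball 0 r) (Metric.ball 0 r) := by
    intro u hu
    rw [mem_ball_zero_iff] at hu ⊢
    rw [hσ]
    simp only [norm_mul, norm_inv, Complex.norm_natCast]
    exact (mul_le_of_le_one_left (norm_nonneg _) (inv_le_one_of_one_le₀ hp1.le)).trans_lt hu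
  have hσ0 : ∀ u, u ≠ 0 → σ u ≠ 0 := fun u hu => mul_ne_zero (inv_ne_zero hp0) hu
  obtain ⟨F, hFm, hFf, hFe⟩ := exists_meromorphic_extension (U := univ)
    (V := Metric.ball (0 : ℂ) r) (σ := σ) (E := fun u => a (Complex.exp (σ u)))
    (f := S) (D := (C⁻¹).1) Metric.isOpen_ball
    (fun z _ => by rw [hσ]; fun_prop) (mapsTo_univ _ _) hσV hσ0
    (fun z _ => by
      have h1 : Tendsto (fun k : ℕ => ((p : ℂ)⁻¹) ^ k * z) atTop (𝓝 (0 * z)) := by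
        refine (tendsto_pow_atTop_nhds_zero_of_norm_lt_one ?_).mul_const z
        rw [norm_inv, Complex.norm_natCast]
        exact inv_lt_one_of_one_lt₀ hp1
      rw [zero_mul] at h1
      obtain ⟨k, hk⟩ := (h1.eventually (Metric.ball_mem_nhds (0 : ℂ) hr)).exists
      exact ⟨k, by rwa [hσn]⟩)
    (fun z _ => (ha _).comp (by rw [hσ]; fun_prop)) (fun z hz => (hball _ hz).2)
    (fun z hz hz0 => by
      have h1 := (hball _ (hσV hz)).1 (hσ0 z hz0)
      rw [hσp] at h1
      rw [← h1, Matrix.mul_assoc, Units.mul_inv, Matrix.mul_one])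
  refine ⟨F, C, fun u => hFm u (mem_univ u), ?_, ?_⟩
  · refine eventually_isUnit_of_frequently isOpen_univ isPreconnected_univ hFm (mem_univ 0)
      (Eventually.frequently ?_)
    filter_upwards [hSu, nhdsWithin_le_nhds (Metric.ball_mem_nhds (0 : ℂ) hr),
      self_mem_nhdsWithin] with z h1 h2 h3
    rw [hFf z h2 h3]
    exact h1
  · filter_upwards [compl_singleton_mem_codiscreteWithin (0 : ℂ)] with u hu
    have h1 := hFe (p * u) (mem_univ _) (mul_ne_zero hp0 hu)
    have h2 : σ (p * u) = u := by
      rw [hσ]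
      field_simp
    rw [h2] at h1
    rw [h1, Matrix.mul_assoc, Units.inv_mul, Matrix.mul_one]

end Fundamental

/-! ### Morphisms between constant systems -/

section Rigidity

attribute [local instance] Matrix.linftyOpNormedAddCommGroup Matrix.linftyOpNormedSpace

variable {m n : ℕ}

/-- A function vanishes if it decays along the orbits of `σ` faster than the inequality
`‖f‖ ≤ c ‖f ∘ σ‖` allows. -/
theorem eqOn_zero_of_norm_le {E : Type*} [NormedAddCommGroup E] {S : Set ℂ} {σ : ℂ → ℂ}
    (hσ : MapsTo σ S S) {f : ℂ → E} {c θ M : ℝ} (hc : 0 ≤ c) (hθ : 0 ≤ θ) (hlt : c * θ < 1)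
    (hf : ∀ z ∈ S, ‖f z‖ ≤ c * ‖f (σ z)‖) (hM : ∀ k, ∀ z ∈ S, ‖f (σ^[k] z)‖ ≤ M * θ ^ k) :
    ∀ z ∈ S, f z = 0 := by
  intro z hz
  have h1 : ∀ k, ‖f z‖ ≤ c ^ k * ‖f (σ^[k] z)‖ := by
    intro k
    induction k with
    | zero => simp
    | succ k ih =>
      refine ih.trans ?_
      rw [pow_succ, mul_assoc, Function.iterate_succ_apply']
      exact mul_le_mul_of_nonneg_left (hf _ (hσ.iterate k hz)) (pow_nonneg hc k)
  have h2 : ∀ k, ‖f z‖ ≤ M * (c * θ) ^ k := by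
    intro k
    refine (h1 k).trans ?_
    calc c ^ k * ‖f (σ^[k] z)‖ ≤ c ^ k * (M * θ ^ k) :=
          mul_le_mul_of_nonneg_left (hM k z hz) (pow_nonneg hc k)
      _ = _ := by ring
  have h3 : Tendsto (fun k : ℕ => M * (c * θ) ^ k) atTop (𝓝 (M * 0)) :=
    (tendsto_pow_atTop_nhds_zero_of_lt_one (mul_nonneg hc hθ) hlt).const_mul M
  rw [mul_zero] at h3
  exact norm_le_zero_iff.1 (ge_of_tendsto' h3 h2)

theorem MatMeroAt.exists_eq_inv_pow_smul {M : ℂ → Matrix (Fin m) (Fin n) ℂ}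
    (hM : MatMeroAt M 0) :
    ∃ (N : ℕ) (H : ℂ → Matrix (Fin m) (Fin n) ℂ), MatAnalyticAt H 0 ∧
      ∀ z, z ≠ 0 → M z = (z ^ N)⁻¹ • H z := by
  choose k hk using hM
  set N : ℕ := Finset.univ.sup fun i => Finset.univ.sup fun j => k i j with hN
  have hle : ∀ i j, k i j ≤ N := fun i j =>
    (Finset.le_sup (f := fun j => k i j) (Finset.mem_univ j)).trans
      (Finset.le_sup (f := fun i => Finset.univ.sup fun j => k i j) (Finset.mem_univ i))
  refine ⟨N, fun z => z ^ N • M z, fun i j => ?_, fun z hz => ?_⟩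
  · have h1 : AnalyticAt ℂ (fun z : ℂ => z ^ (N - k i j)) 0 := analyticAt_id.pow _
    refine (h1.mul (hk i j)).congr (Eventually.of_forall fun z => ?_)
    simp only [Pi.mul_apply, sub_zero, smul_eq_mul, Matrix.smul_apply, ← mul_assoc, ← pow_add,
      Nat.sub_add_cancel (hle i j)]
  · rw [smul_smul, inv_mul_cancel₀ (pow_ne_zero N hz), one_smul]

variable {A : GL (Fin n) ℂ} {B : GL (Fin m) ℂ}

theorem eq_at_zero_of_eventually {f g : ℂ → Matrix (Fin m) (Fin n) ℂ} (hf : MatAnalyticAt f 0)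
    (hg : MatAnalyticAt g 0) (h : ∀ᶠ z in 𝓝[≠] 0, f z = g z) : f 0 = g 0 := by
  have h1 := hf.continuousAt.tendsto.mono_left (nhdsWithin_le_nhds (s := {0}ᶜ))
  have h2 := hg.continuousAt.tendsto.mono_left (nhdsWithin_le_nhds (s := {0}ᶜ))
  exact tendsto_nhds_unique (h1.congr' h) h2

theorem exists_ball_mapsTo_bounded {f : ℂ → Matrix (Fin m) (Fin n) ℂ} (hf : MatAnalyticAt f 0)
    {P : ℂ → Prop} (hP : ∀ᶠ z in 𝓝 (0 : ℂ), P z) {δ : ℝ} (hδ : 0 < δ) :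
    ∃ r, 0 < r ∧ r ≤ δ ∧ ∀ z ∈ Metric.ball (0 : ℂ) r, P z ∧ ‖f z‖ ≤ ‖f 0‖ + 1 := by
  have h1 : ∀ᶠ z in 𝓝 (0 : ℂ), ‖f z‖ < ‖f 0‖ + 1 :=
    hf.continuousAt.norm.eventually (gt_mem_nhds (by simp))
  obtain ⟨r, hr, hb⟩ := Metric.eventually_nhds_iff_ball.1 (hP.and h1)
  refine ⟨min r δ, lt_min hr hδ, min_le_right _ _, fun z hz => ?_⟩
  have := hb z (Metric.ball_subset_ball (min_le_left _ _) hz)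
  exact ⟨this.1, this.2.le⟩

/-- Meromorphic morphisms `R(z^p) A = B R(z)` between constant systems at `0` are constant. -/
theorem eventually_const_of_mahler {p : ℕ} (hp : 2 ≤ p) {R : ℂ → Matrix (Fin m) (Fin n) ℂ}
    (hR : MatMeroAt R 0) (h : ∀ᶠ z in 𝓝[≠] 0, R (z ^ p) * A.1 = B.1 * R z) :
    ∃ S : Matrix (Fin m) (Fin n) ℂ, ∀ᶠ z in 𝓝[≠] 0, R z = S := by
  have hp0 : p ≠ 0 := by omega
  have hpow : ∀ j : ℕ, AnalyticAt ℂ (fun u : ℂ => u ^ j) 0 := fun j => analyticAt_id.pow j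
  have hcomp : ∀ {H : ℂ → Matrix (Fin m) (Fin n) ℂ}, MatAnalyticAt H 0 →
      MatAnalyticAt (fun z => H (z ^ p)) 0 := by
    intro H hH
    have : MatAnalyticAt H ((0 : ℂ) ^ p) := by simpa [hp0] using hH
    exact this.comp (hpow p)
  -- a pole of order `N > 0` would be turned into a pole of order `p N`
  have hreg : ∀ (N : ℕ) (H : ℂ → Matrix (Fin m) (Fin n) ℂ), MatAnalyticAt H 0 →
      (∀ z, z ≠ 0 → R z = (z ^ N)⁻¹ • H z) →
      ∃ H : ℂ → Matrix (Fin m) (Fin n) ℂ, MatAnalyticAt H 0 ∧ ∀ z, z ≠ 0 → R z = H z := by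
    intro N
    induction N with
    | zero => exact fun H hH hRH => ⟨H, hH, fun z hz => by simpa using hRH z hz⟩
    | succ N ih =>
      intro H hH hRH
      have h1 : ∀ᶠ z in 𝓝[≠] (0 : ℂ), H (z ^ p) * A.1 =
          z ^ ((p - 1) * (N + 1)) • (B.1 * H z) := by
        filter_upwards [h, self_mem_nhdsWithin] with z hz hz0
        have hz0' : z ≠ 0 := hz0
        rw [hRH z hz0, hRH _ (pow_ne_zero p hz0), Matrix.smul_mul, Matrix.mul_smul] at hz
        have h3 := congrArg (fun X => (z ^ p) ^ (N + 1) • X) hz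
        simp only [smul_smul] at h3
        rw [mul_inv_cancel₀ (pow_ne_zero _ (pow_ne_zero p hz0')), one_smul] at h3
        rw [h3]
        congr 1
        rw [← div_eq_mul_inv, div_eq_iff (pow_ne_zero _ hz0'), ← pow_mul, ← pow_add]
        congr 1
        obtain ⟨q, rfl⟩ : ∃ q, p = q + 1 := ⟨p - 1, by omega⟩
        simp only [Nat.add_sub_cancel]
        ring
      have h2 := eq_at_zero_of_eventually ((hcomp hH).mul (MatAnalyticAt.const A.1))
        (MatAnalyticAt.smul (hpow ((p - 1) * (N + 1))) ((MatAnalyticAt.const B.1).mul hH)) h1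
      have hexp : (p - 1) * (N + 1) ≠ 0 := Nat.mul_ne_zero (by omega) (by omega)
      simp only [zero_pow hp0, zero_pow hexp, zero_smul] at h2
      have h3 : H 0 = 0 := by
        have := congrArg (· * A⁻¹.1) h2
        simpa only [Matrix.mul_assoc, Units.mul_inv, Matrix.mul_one, Matrix.zero_mul] using this
      obtain ⟨H', hH', hHe⟩ := hH.exists_eq_smul h3
      refine ih H' hH' fun z hz => ?_
      rw [hRH z hz, hHe, smul_smul, pow_succ, mul_inv, mul_assoc, inv_mul_cancel₀ hz, mul_one]
  obtain ⟨N, H₀, hH₀, hRH₀⟩ := hR.exists_eq_inv_pow_smul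
  obtain ⟨H, hH, hRH⟩ := hreg N H₀ hH₀ hRH₀
  have h1 : ∀ᶠ z in 𝓝[≠] (0 : ℂ), H (z ^ p) * A.1 = B.1 * H z := by
    filter_upwards [h, self_mem_nhdsWithin] with z hz hz0
    rwa [← hRH z hz0, ← hRH _ (pow_ne_zero p hz0)]
  have h2 := eq_at_zero_of_eventually ((hcomp hH).mul (MatAnalyticAt.const A.1))
    ((MatAnalyticAt.const B.1).mul hH) h1
  simp only [zero_pow hp0] at h2
  obtain ⟨K, hK, hKe⟩ := MatAnalyticAt.exists_eq_smul (M := fun z => H z + (-H 0))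
    (hH.add (MatAnalyticAt.const _)) (by simp)
  set D : ℂ → Matrix (Fin m) (Fin n) ℂ := fun z => H z + (-H 0) with hD
  have h3 : ∀ᶠ z in 𝓝 (0 : ℂ), z ≠ 0 → D z = B⁻¹.1 * D (z ^ p) * A.1 := by
    refine eventually_nhdsWithin_iff (s := {0}ᶜ).1 ?_
    filter_upwards [h1] with z hz
    simp only [hD, Matrix.mul_add, Matrix.add_mul, Matrix.mul_assoc, hz, Matrix.neg_mul,
      Matrix.mul_neg, h2]
    simp only [← Matrix.mul_assoc, Units.inv_mul, Matrix.one_mul]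
  set c : ℝ := ‖B⁻¹.1‖ * ‖A.1‖ with hc
  have hc0 : 0 ≤ c := by positivity
  obtain ⟨r, hr, hrδ, hball⟩ := exists_ball_mapsTo_bounded hK h3
    (δ := min 1 (c + 1)⁻¹) (lt_min one_pos (by positivity))
  have hr1 : r ≤ 1 := hrδ.trans (min_le_left _ _)
  have hr2 : r ≤ (c + 1)⁻¹ := hrδ.trans (min_le_right _ _)
  have hzero := eqOn_zero_of_norm_le (S := Metric.ball (0 : ℂ) r) (σ := fun z => z ^ p) (f := D)
    (c := c) (θ := r) (M := ‖K 0‖ + 1) (mapsTo_pow_ball hp0 hr1) hc0 hr.le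
    (by
      have hpos : 0 < c + 1 := by positivity
      calc c * r ≤ c * (c + 1)⁻¹ := by gcongr
        _ < 1 := by
          rw [← div_eq_mul_inv, div_lt_one hpos]
          linarith)
    (fun z hz => by
      by_cases hz0 : z = 0
      · have : D 0 = 0 := by simp [hD]
        rw [hz0, this, norm_zero]
        positivity
      · calc ‖D z‖ = ‖B⁻¹.1 * D (z ^ p) * A.1‖ := by rw [← (hball z hz).1 hz0]
          _ ≤ ‖B⁻¹.1‖ * ‖D (z ^ p)‖ * ‖A.1‖ := (Matrix.linfty_opNorm_mul _ _).trans
            (mul_le_mul_of_nonneg_right (Matrix.linfty_opNorm_mul _ _) (norm_nonneg _))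
          _ = _ := by rw [hc]; ring)
    (fun k z hz => by
      have hmem := (mapsTo_pow_ball hp0 hr1).iterate k hz
      rw [show D _ = _ from hKe _, norm_smul, mul_comm]
      refine mul_le_mul (hball _ hmem).2 ?_ (norm_nonneg _) (by positivity)
      rw [iterate_pow_apply, norm_pow]
      calc ‖z‖ ^ p ^ k ≤ r ^ p ^ k :=
            pow_le_pow_left₀ (norm_nonneg _) (mem_ball_zero_iff.1 hz).le _
        _ ≤ r ^ k := pow_le_pow_of_le_one hr.le hr1 (Nat.lt_pow_self (by omega)).le)
  refine ⟨H 0, ?_⟩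
  filter_upwards [self_mem_nhdsWithin, nhdsWithin_le_nhds (Metric.ball_mem_nhds (0 : ℂ) hr)]
    with z hz hzr
  rw [hRH z hz]
  have := hzero z hzr
  rwa [hD, add_neg_eq_zero] at this

/-- Analytic solutions of `p^k H(pu) A = B H(u)` are polynomials of degree less than `d` when
`p^(k+d)` is large. Passing from `H(u)` to `(H(u) - H(0)) / u` replaces `k` by `k + 1` and `d` by
`d - 1`, and for `d = 0` contraction along `u ↦ u / p` forces `H = 0`. -/
theorem exists_polynomial_of_qDifference {p : ℕ} (hp : 2 ≤ p) (d : ℕ) :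
    ∀ (k : ℤ) (H : ℂ → Matrix (Fin m) (Fin n) ℂ), MatAnalyticAt H 0 →
      ‖B.1‖ * ‖A⁻¹.1‖ < (p : ℝ) ^ (k + d) →
      (∀ᶠ u in 𝓝[≠] 0, (p : ℂ) ^ k • (H (p * u) * A.1) = B.1 * H u) →
      ∃ c : ℕ → Matrix (Fin m) (Fin n) ℂ, ∀ᶠ u in 𝓝 0, H u = ∑ i ∈ Finset.range d, u ^ i • c i := by
  have hp0 : (p : ℂ) ≠ 0 := by
    have : p ≠ 0 := by omega
    exact_mod_cast this
  have hp1 : (1 : ℝ) ≤ p := by exact_mod_cast (by omega : 1 ≤ p)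
  have hpr : (0 : ℝ) < p := by linarith
  have hcomp : ∀ {H : ℂ → Matrix (Fin m) (Fin n) ℂ}, MatAnalyticAt H 0 →
      MatAnalyticAt (fun u => H (p * u)) 0 := by
    intro H hH
    have : MatAnalyticAt H ((p : ℂ) * 0) := by simpa using hH
    exact this.comp (by fun_prop)
  induction d with
  | zero =>
    intro k H hH hk he
    have he0 := eq_at_zero_of_eventually
      (MatAnalyticAt.smul (analyticAt_const (v := (p : ℂ) ^ k)) ((hcomp hH).mul
        (MatAnalyticAt.const A.1))) ((MatAnalyticAt.const B.1).mul hH) he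
    have h1 : ∀ᶠ u in 𝓝 (0 : ℂ), (p : ℂ) ^ k • (H (p * u) * A.1) = B.1 * H u := by
      filter_upwards [eventually_nhdsWithin_iff.1 he] with u hu
      by_cases hu0 : u = 0
      · rw [hu0]
        exact he0
      · exact hu hu0
    obtain ⟨r, hr, -, hball⟩ := exists_ball_mapsTo_bounded hH h1 one_pos
    set c : ℝ := ((p : ℝ) ^ k)⁻¹ * (‖B.1‖ * ‖A⁻¹.1‖) with hc
    have hpk : (0 : ℝ) < (p : ℝ) ^ k := zpow_pos hpr k
    have hmaps : MapsTo (fun u : ℂ => (p : ℂ)⁻¹ * u) (Metric.ball 0 r) (Metric.ball 0 r) := by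
      intro u hu
      rw [mem_ball_zero_iff] at hu ⊢
      simp only [norm_mul, norm_inv, Complex.norm_natCast]
      exact (mul_le_of_le_one_left (norm_nonneg _) (inv_le_one_of_one_le₀ hp1)).trans_lt hu
    have hzero := eqOn_zero_of_norm_le (S := Metric.ball (0 : ℂ) r)
      (σ := fun u => (p : ℂ)⁻¹ * u) (f := H) (c := c) (θ := 1) (M := ‖H 0‖ + 1) hmaps
      (by positivity) zero_le_one
      (by
        rw [mul_one, hc, inv_mul_lt_iff₀ hpk, mul_one]
        simpa using hk)
      (fun u hu => by
        have h2 := (hball _ (hmaps hu)).1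
        rw [mul_inv_cancel_left₀ hp0] at h2
        have h3 : H u = ((p : ℂ) ^ k)⁻¹ • (B.1 * H ((p : ℂ)⁻¹ * u) * A⁻¹.1) := by
          rw [← h2, Matrix.smul_mul, smul_smul, inv_mul_cancel₀ (zpow_ne_zero k hp0), one_smul,
            Matrix.mul_assoc, Units.mul_inv, Matrix.mul_one]
        calc ‖H u‖ = ((p : ℝ) ^ k)⁻¹ * ‖B.1 * H ((p : ℂ)⁻¹ * u) * A⁻¹.1‖ := by
              conv_lhs => rw [h3]
              rw [norm_smul, norm_inv, norm_zpow, Complex.norm_natCast]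
          _ ≤ ((p : ℝ) ^ k)⁻¹ * (‖B.1‖ * ‖H ((p : ℂ)⁻¹ * u)‖ * ‖A⁻¹.1‖) := by
              refine mul_le_mul_of_nonneg_left ?_ (inv_nonneg.2 hpk.le)
              exact (Matrix.linfty_opNorm_mul _ _).trans
                (mul_le_mul_of_nonneg_right (Matrix.linfty_opNorm_mul _ _) (norm_nonneg _))
          _ = _ := by rw [hc]; ring)
      (fun j u hu => by
        rw [one_pow, mul_one]
        exact (hball _ (hmaps.iterate j hu)).2)
    refine ⟨fun _ => 0, ?_⟩
    filter_upwards [Metric.ball_mem_nhds (0 : ℂ) hr] with u hu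
    simpa using hzero u hu
  | succ d ih =>
    intro k H hH hk he
    have he0 := eq_at_zero_of_eventually
      (MatAnalyticAt.smul (analyticAt_const (v := (p : ℂ) ^ k)) ((hcomp hH).mul
        (MatAnalyticAt.const A.1))) ((MatAnalyticAt.const B.1).mul hH) he
    simp only [mul_zero] at he0
    obtain ⟨K, hK, hKe⟩ := MatAnalyticAt.exists_eq_smul (M := fun z => H z + (-H 0))
      (hH.add (MatAnalyticAt.const _)) (by simp)
    have hKH : ∀ u, H u = u • K u + H 0 := by
      intro u
      rw [← hKe]
      abel
    obtain ⟨c, hc⟩ := ih (k + 1) K hK (by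
      have : k + 1 + (d : ℤ) = k + ((d + 1 : ℕ) : ℤ) := by push_cast; ring
      rwa [this]) (by
      filter_upwards [he, self_mem_nhdsWithin] with u hu hu0
      have hu0' : u ≠ 0 := hu0
      rw [hKH u, hKH (p * u), Matrix.add_mul, smul_add, he0, Matrix.mul_add,
        add_left_inj, Matrix.smul_mul, Matrix.mul_smul, smul_smul] at hu
      have h3 := congrArg (fun X => u⁻¹ • X) hu
      simp only [smul_smul] at h3
      rw [inv_mul_cancel₀ hu0', one_smul] at h3
      rw [← h3, zpow_add_one₀ hp0]
      congr 1
      field_simp)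
    refine ⟨fun i => if i = 0 then H 0 else c (i - 1), ?_⟩
    filter_upwards [hc] with u hu
    rw [Finset.sum_range_succ', hKH u, hu, Finset.smul_sum]
    simp [smul_smul, pow_succ']

/-- Meromorphic morphisms `R(pu) A = B R(u)` between constant systems at `u = 0` are Laurent
polynomials. -/
theorem exists_laurent_of_qDifference {p : ℕ} (hp : 2 ≤ p) {R : ℂ → Matrix (Fin m) (Fin n) ℂ}
    (hR : MatMeroAt R 0) (h : ∀ᶠ u in 𝓝[≠] 0, R (p * u) * A.1 = B.1 * R u) :
    ∃ (N d : ℕ) (c : ℕ → Matrix (Fin m) (Fin n) ℂ),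
      ∀ᶠ u in 𝓝[≠] 0, R u = (u⁻¹) ^ N • ∑ i ∈ Finset.range d, u ^ i • c i := by
  have hp0 : (p : ℂ) ≠ 0 := by
    have : p ≠ 0 := by omega
    exact_mod_cast this
  have hp1 : (1 : ℝ) < p := by exact_mod_cast (by omega : 1 < p)
  obtain ⟨N, H, hH, hRH⟩ := hR.exists_eq_inv_pow_smul
  obtain ⟨e, he⟩ := pow_unbounded_of_one_lt (‖B.1‖ * ‖A⁻¹.1‖) hp1
  obtain ⟨c, hc⟩ := exists_polynomial_of_qDifference (A := A) (B := B) hp (N + e) (-(N : ℤ)) H hH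
    (by
      have : -(N : ℤ) + ((N + e : ℕ) : ℤ) = (e : ℤ) := by push_cast; ring
      rw [this, zpow_natCast]
      exact he)
    (by
      filter_upwards [h, self_mem_nhdsWithin] with u hu hu0
      have hu0' : u ≠ 0 := hu0
      rw [hRH u hu0, hRH _ (mul_ne_zero hp0 hu0), Matrix.smul_mul, Matrix.mul_smul] at hu
      have h3 := congrArg (fun X => u ^ N • X) hu
      simp only [smul_smul] at h3
      rw [mul_inv_cancel₀ (pow_ne_zero N hu0'), one_smul] at h3
      rw [← h3, zpow_neg, zpow_natCast]
      congr 1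
      rw [mul_pow]
      field_simp)
  refine ⟨N, N + e, c, ?_⟩
  filter_upwards [nhdsWithin_le_nhds hc, self_mem_nhdsWithin] with u hu hu0
  rw [hRH u hu0, hu, inv_pow]

end Rigidity

/-! ### Meromorphic functions on the projective line are rational -/

section Rational

/-- An entire function of polynomial growth is a polynomial, by Liouville's theorem applied to
iterated difference quotients. -/
theorem exists_polynomial_of_growth (N : ℕ) :
    ∀ G : ℂ → ℂ, Differentiable ℂ G →
      (∃ C : ℝ, ∀ᶠ z in Bornology.cobounded ℂ, ‖G z‖ ≤ C * ‖z‖ ^ N) →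
      ∃ P : Polynomial ℂ, ∀ z, G z = P.eval z := by
  induction N with
  | zero =>
    rintro G hG ⟨C, hC⟩
    have hb : Bornology.IsBounded (range G) := by
      simp only [pow_zero, mul_one] at hC
      rw [Metric.cobounded_eq_cocompact] at hC
      obtain ⟨K, hK, hKC⟩ := mem_cocompact.1 hC
      obtain ⟨M, hM⟩ := (hK.image hG.continuous).isBounded.exists_norm_le
      refine isBounded_iff_forall_norm_le.2 ⟨max M C, ?_⟩
      rintro _ ⟨z, rfl⟩
      by_cases hz : z ∈ K
      · exact (hM _ (mem_image_of_mem G hz)).trans (le_max_left _ _)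
      · exact le_trans (hKC hz) (le_max_right _ _)
    refine ⟨Polynomial.C (G 0), fun z => ?_⟩
    rw [Polynomial.eval_C]
    exact hG.apply_eq_apply_of_bounded hb z 0
  | succ N ih =>
    rintro G hG ⟨C, hC⟩
    have hd : Differentiable ℂ (dslope G 0) := by
      rw [← differentiableOn_univ, Complex.differentiableOn_dslope univ_mem]
      exact hG.differentiableOn
    have hsl : ∀ z, z * dslope G 0 z = G z - G 0 := by
      intro z
      simpa using sub_smul_dslope G 0 z
    obtain ⟨P, hP⟩ := ih (dslope G 0) hd ⟨C + ‖G 0‖, by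
      filter_upwards [hC, eventually_cobounded_le_norm (1 : ℝ)] with z hz hz1
      have hz0 : 0 < ‖z‖ := by linarith
      have h1 : ‖z‖ * ‖dslope G 0 z‖ ≤ C * ‖z‖ ^ (N + 1) + ‖G 0‖ := by
        rw [← norm_mul, hsl]
        exact (norm_sub_le _ _).trans (add_le_add_left hz _)
      have h2 : ‖G 0‖ ≤ ‖G 0‖ * ‖z‖ ^ (N + 1) :=
        le_mul_of_one_le_right (norm_nonneg _) (one_le_pow₀ hz1)
      refine le_of_mul_le_mul_left ?_ hz0
      calc _ ≤ _ := h1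
        _ ≤ C * ‖z‖ ^ (N + 1) + ‖G 0‖ * ‖z‖ ^ (N + 1) := by linarith
        _ = _ := by ring⟩
    refine ⟨Polynomial.X * P + Polynomial.C (G 0), fun z => ?_⟩
    have := hsl z
    rw [hP] at this
    simp [this]

theorem exists_polynomial_of_meromorphicAt_inv {G : ℂ → ℂ} (hG : Differentiable ℂ G)
    (h : MeromorphicAt (fun w => G w⁻¹) 0) : ∃ P : Polynomial ℂ, ∀ z, G z = P.eval z := by
  obtain ⟨N, hN⟩ := h
  simp only [sub_zero, smul_eq_mul] at hN
  obtain ⟨C, hC⟩ : ∃ C : ℝ, ∀ᶠ w in 𝓝 (0 : ℂ), ‖w ^ N * G w⁻¹‖ ≤ C :=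
    ⟨_, (hN.continuousAt.norm.eventually (gt_mem_nhds (lt_add_one _))).mono fun w hw => hw.le⟩
  refine exists_polynomial_of_growth N G hG ⟨C, ?_⟩
  have h1 : Tendsto (fun z : ℂ => z⁻¹) (Bornology.cobounded ℂ) (𝓝 0) := tendsto_inv₀_cobounded
  filter_upwards [h1.eventually hC, eventually_cobounded_le_norm (1 : ℝ)] with z hz hz1
  have hz0 : 0 < ‖z‖ ^ N := pow_pos (by linarith) N
  rw [inv_inv, norm_mul, norm_pow, norm_inv, inv_pow, inv_mul_le_iff₀ hz0] at hz
  rwa [mul_comm]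

/-- The value of a rational function at `z` (irrelevant at the poles). -/
abbrev ratEval (r : RatFunc ℂ) (z : ℂ) : ℂ := r.eval (RingHom.id ℂ) z

theorem meromorphicAt_eval_comp (P : Polynomial ℂ) {h : ℂ → ℂ} {a : ℂ} (hh : MeromorphicAt h a) :
    MeromorphicAt (fun z => P.eval (h z)) a := by
  induction P using Polynomial.induction_on' with
  | add f g hf hg =>
    simp only [Polynomial.eval_add]
    exact hf.add hg
  | monomial k c =>
    simp only [Polynomial.eval_monomial]
    exact (MeromorphicAt.const c a).mul (hh.pow k)

theorem meromorphicAt_ratEval_comp (r : RatFunc ℂ) {h : ℂ → ℂ} {a : ℂ} (hh : MeromorphicAt h a) :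
    MeromorphicAt (fun z => ratEval r (h z)) a :=
  (meromorphicAt_eval_comp r.num hh).div (meromorphicAt_eval_comp r.denom hh)

theorem eventually_cofinite_eval_ne_zero {P : Polynomial ℂ} (hP : P ≠ 0) :
    ∀ᶠ z in cofinite, P.eval z ≠ 0 := by
  have h : {z | ¬ P.eval z ≠ 0} ⊆ (P.rootSet ℂ) := by
    intro z hz
    simp only [ne_eq, not_not, mem_ofPred_eq] at hz
    rw [Polynomial.mem_rootSet]
    exact ⟨hP, by simpa using hz⟩
  exact (P.rootSet_finite ℂ).subset h

/-- A function meromorphic on `ℂ` and at `∞` is rational. -/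
theorem exists_ratFunc_of_meromorphic {F : ℂ → ℂ} (hF : ∀ z, MeromorphicAt F z)
    (hinf : MeromorphicAt (fun w => F w⁻¹) 0) :
    ∃ r : RatFunc ℂ, ∀ᶠ z in cofinite, F z = ratEval r z := by
  classical
  -- the poles stay in a bounded set, hence there are finitely many of them
  obtain ⟨R, hR⟩ : ∃ R : ℝ, ∀ z : ℂ, R < ‖z‖ → AnalyticAt ℂ F z := by
    have h1 := eventually_nhdsWithin_iff.1 hinf.eventually_analyticAt
    obtain ⟨r, hr, hb⟩ := Metric.eventually_nhds_iff_ball.1 h1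
    refine ⟨r⁻¹, fun z hz => ?_⟩
    have hz0' : 0 < ‖z‖ := (inv_pos.2 hr).trans hz
    have hz0 : z ≠ 0 := norm_pos_iff.1 hz0'
    have h2 := hb z⁻¹ (by
      rw [mem_ball_zero_iff, norm_inv]
      exact inv_lt_of_inv_lt₀ hr hz) (inv_ne_zero hz0)
    have h3 : AnalyticAt ℂ (fun z : ℂ => z⁻¹) z := analyticAt_inv hz0
    have h4 := AnalyticAt.comp h2 h3
    simpa [Function.comp_def] using h4
  have hfin : {z | ¬ AnalyticAt ℂ F z}.Finite := by
    have h1 : MeromorphicOn F (Metric.closedBall 0 R) := fun z _ => hF z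
    refine (IsCompact.finite_sdiff_of_mem_codiscreteWithin (isCompact_closedBall 0 R)
      h1.analyticAt_mem_codiscreteWithin).subset fun z hz => ⟨?_, hz⟩
    rw [mem_closedBall_zero_iff]
    by_contra hlt
    exact hz (hR z (not_le.1 hlt))
  choose N hN using hF
  set S := hfin.toFinset with hS
  set Q : Polynomial ℂ := ∏ x ∈ S, (Polynomial.X - Polynomial.C x) ^ N x with hQ
  have hQ0 : Q ≠ 0 := Finset.prod_ne_zero_iff.2 fun x _ =>
    pow_ne_zero _ (Polynomial.X_sub_C_ne_zero x)
  have hPa : ∀ (P : Polynomial ℂ) z, AnalyticAt ℂ (fun z => P.eval z) z := fun P z =>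
    P.differentiable.analyticAt z
  have hG : Differentiable ℂ fun z => Q.eval z * F z := by
    intro z
    apply AnalyticAt.differentiableAt
    by_cases hz : AnalyticAt ℂ F z
    · exact (hPa Q z).mul hz
    · have hzS : z ∈ S := by simpa [hS] using hz
      have h1 := (hPa (∏ x ∈ S.erase z, (Polynomial.X - Polynomial.C x) ^ N x) z).mul (hN z)
      refine h1.congr (Eventually.of_forall fun w => ?_)
      rw [hQ, ← Finset.mul_prod_erase S _ hzS]
      simp only [Pi.mul_apply, Polynomial.eval_mul, Polynomial.eval_pow, Polynomial.eval_sub,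
        Polynomial.eval_X, Polynomial.eval_C, smul_eq_mul]
      ring
  obtain ⟨P, hP⟩ := exists_polynomial_of_meromorphicAt_inv hG (by
    exact (meromorphicAt_eval_comp Q (MeromorphicAt.id 0).inv).mul hinf)
  set r : RatFunc ℂ := algebraMap _ _ P / algebraMap _ _ Q with hr
  refine ⟨r, ?_⟩
  filter_upwards [eventually_cofinite_eval_ne_zero hQ0,
    eventually_cofinite_eval_ne_zero r.denom_ne_zero] with z hz hz'
  have h1 : r * algebraMap _ _ Q = algebraMap _ _ P :=
    div_mul_cancel₀ _ (RatFunc.algebraMap_ne_zero hQ0)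
  have h2 := congrArg (fun x : RatFunc ℂ => x.eval (RingHom.id ℂ) z) h1
  rw [RatFunc.eval_mul (RingHom.id ℂ) z (x := r) (y := algebraMap _ _ Q)
      (by simpa [Polynomial.eval₂_id] using hz') (by simp),
    RatFunc.eval_algebraMap, RatFunc.eval_algebraMap] at h2
  simp only [Algebra.algebraMap_self, RingHom.id_apply, Polynomial.eval₂_id] at h2
  have h3 := hP z
  rw [← h2] at h3
  refine mul_left_cancel₀ hz ?_
  rw [h3, mul_comm]

end Rational

/-! ### Descent along the exponential -/

section Descent

theorem isOpen_re_neg : IsOpen {u : ℂ | u.re < 0} := isOpen_lt Complex.continuous_re continuous_const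

theorem isOpen_re_pos : IsOpen {u : ℂ | 0 < u.re} := isOpen_lt continuous_const Complex.continuous_re

theorem eventually_codiscreteWithin_eq {U : Set ℂ} (hU : IsOpen U) (hc : IsPreconnected U)
    {f g : ℂ → ℂ} (hf : ∀ z ∈ U, MeromorphicAt f z) (hg : ∀ z ∈ U, MeromorphicAt g z) {a : ℂ} (ha : a ∈ U)
    (h : ∀ᶠ z in 𝓝[≠] a, f z = g z) : ∀ᶠ z in codiscreteWithin U, f z = g z := by
  have := MeromorphicOn.eventually_eq_zero hU hc (f := fun z => f z - g z)
    (fun z hz => (hf z hz).sub (hg z hz)) ha (h.mono fun z hz => sub_eq_zero.2 hz).frequently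
  filter_upwards [this] with z hz using sub_eq_zero.1 hz

/-- Gluing: a meromorphic function `f` of `u = log z` that comes from meromorphic functions of `z`
near `0` and of `1 / z` near `∞` comes from a rational function. -/
theorem exists_ratFunc_of_glue {f g h : ℂ → ℂ} (hf : ∀ u, MeromorphicAt f u)
    (hg : ∀ z ∈ Metric.ball (0 : ℂ) 1, MeromorphicAt g z)
    (hh : ∀ z ∈ Metric.ball (0 : ℂ) 1, MeromorphicAt h z)
    (hfg : ∀ᶠ u in codiscreteWithin {u : ℂ | u.re < 0}, f u = g (Complex.exp u))
    (hfh : ∀ᶠ u in codiscreteWithin {u : ℂ | 0 < u.re}, f u = h (Complex.exp u)⁻¹) :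
    ∃ r : RatFunc ℂ, (∀ᶠ u in codiscreteWithin univ, f u = ratEval r (Complex.exp u)) ∧
      (∀ᶠ z in codiscreteWithin (Metric.ball (0 : ℂ) 1), g z = ratEval r z) ∧
      ∀ᶠ w in codiscreteWithin (Metric.ball (0 : ℂ) 1), h w = ratEval r w⁻¹ := by
  rw [eventually_codiscreteWithin_iff isOpen_re_neg] at hfg
  rw [eventually_codiscreteWithin_iff isOpen_re_pos] at hfh
  -- `f` is invariant under the deck transformations
  have hper : ∀ (k : ℤ) (u₀ : ℂ), ∀ᶠ u in 𝓝[≠] u₀, f (u + k * (2 * Real.pi * Complex.I)) = f u := by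
    intro k u₀
    have hadd : ∀ u : ℂ, AnalyticAt ℂ (fun u : ℂ => u + k * (2 * Real.pi * Complex.I)) u :=
      fun u => by fun_prop
    have h1 := eventually_codiscreteWithin_eq isOpen_univ isPreconnected_univ
      (f := fun u => f (u + k * (2 * Real.pi * Complex.I))) (g := f) (a := (-1 : ℂ))
      (fun u _ => (hf _).comp_analyticAt (hadd u)) (fun u _ => hf u) (mem_univ _) (by
        have hre : ∀ u : ℂ, (u + k * (2 * Real.pi * Complex.I)).re = u.re := by
          intro u
          simp [Complex.mul_re]
        have h2 := hfg (-1) (by simp)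
        have h3 := hfg (-1 + k * (2 * Real.pi * Complex.I)) (by
          change (_ : ℂ).re < 0
          rw [hre]
          simp)
        have h4 : Tendsto (fun u : ℂ => u + k * (2 * Real.pi * Complex.I)) (𝓝[≠] (-1))
            (𝓝[≠] (-1 + k * (2 * Real.pi * Complex.I))) := by
          refine tendsto_nhdsWithin_iff.2 ⟨(hadd (-1)).continuousAt.mono_left nhdsWithin_le_nhds, ?_⟩
          filter_upwards [self_mem_nhdsWithin] with u hu hu'
          exact hu (add_right_cancel hu')
        filter_upwards [h2, h4.eventually h3] with u h5 h6
        rw [h5, h6, Complex.exp_add, Complex.exp_int_mul_two_pi_mul_I, mul_one])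
    exact (eventually_codiscreteWithin_iff isOpen_univ).1 h1 u₀ (mem_univ _)
  -- `f ∘ log` is meromorphic across the cut of `log` by periodicity; `g` and `h` supply the values
  -- near `0` and `∞`
  set F : ℂ → ℂ := fun z =>
    if ‖z‖ < 1 / 2 then g z else if 2 < ‖z‖ then h z⁻¹ else f (Complex.log z) with hF
  have hfF : ∀ u₀ : ℂ, ∀ᶠ u in 𝓝[≠] u₀, f u = F (Complex.exp u) := by
    intro u₀
    have h1 : ∀ᶠ u in 𝓝[≠] u₀, ‖Complex.exp u‖ < 1 / 2 → f u = g (Complex.exp u) := by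
      by_cases hu : u₀.re < 0
      · exact (hfg u₀ hu).mono fun u hu _ => hu
      · have h2 : 1 / 2 < ‖Complex.exp u₀‖ := by
          rw [Complex.norm_exp]
          have := Real.one_le_exp (not_lt.1 hu)
          linarith
        have h3 := (Complex.continuous_exp.norm.continuousAt (x := u₀)).eventually (lt_mem_nhds h2)
        filter_upwards [nhdsWithin_le_nhds h3] with u hu hu'
        exact absurd hu' (not_lt.2 (le_of_lt hu))
    have h2 : ∀ᶠ u in 𝓝[≠] u₀, 2 < ‖Complex.exp u‖ → f u = h (Complex.exp u)⁻¹ := by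
      by_cases hu : 0 < u₀.re
      · exact (hfh u₀ hu).mono fun u hu _ => hu
      · have h2 : ‖Complex.exp u₀‖ < 2 := by
          rw [Complex.norm_exp]
          have := Real.exp_le_one_iff.2 (not_lt.1 hu)
          linarith
        have h3 := (Complex.continuous_exp.norm.continuousAt (x := u₀)).eventually (gt_mem_nhds h2)
        filter_upwards [nhdsWithin_le_nhds h3] with u hu hu'
        exact absurd hu' (not_lt.2 (le_of_lt hu))
    have h3 : ∀ᶠ u in 𝓝[≠] u₀, f (Complex.log (Complex.exp u)) = f u := by
      -- near `u₀` the integer `k` with `log (exp u) = u + 2πik` takes finitely many values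
      obtain ⟨m, hm⟩ := exists_nat_gt (|u₀.im| + 1 + Real.pi)
      have h4 : ∀ᶠ u in 𝓝[≠] u₀, ∀ k ∈ Finset.Icc (-(m : ℤ)) m,
          f (u + k * (2 * Real.pi * Complex.I)) = f u := by
        rw [Finset.eventually_all]
        exact fun k _ => hper k u₀
      have h5 : ∀ᶠ u in 𝓝 u₀, |u.im| < |u₀.im| + 1 :=
        (Complex.continuous_im.abs.continuousAt (x := u₀)).eventually (gt_mem_nhds (by simp))
      filter_upwards [h4, nhdsWithin_le_nhds h5] with u h6 h7
      obtain ⟨k, hk⟩ : ∃ k : ℤ, Complex.log (Complex.exp u) = u + k * (2 * Real.pi * Complex.I) := by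
        rw [← Complex.exp_eq_exp_iff_exists_int]
        exact Complex.exp_log (Complex.exp_ne_zero u)
      rw [hk]
      refine h6 k ?_
      have h8 := congrArg Complex.im hk
      have h9 : (u + k * (2 * Real.pi * Complex.I)).im = u.im + k * (2 * Real.pi) := by
        simp [Complex.mul_im]
      rw [h9] at h8
      have h10 := And.intro (Complex.neg_pi_lt_log_im (Complex.exp u))
        (Complex.log_im_le_pi (Complex.exp u))
      rw [h8] at h10
      rw [abs_lt] at h7
      have hpi := Real.pi_gt_three
      have h11 : |(k : ℝ)| < m := by
        have h12 : |(k : ℝ) * (2 * Real.pi)| < m := by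
          rw [abs_lt]
          constructor <;> linarith [h10.1, h10.2, h7.1, h7.2]
        rw [abs_mul, abs_of_pos (by positivity : (0 : ℝ) < 2 * Real.pi)] at h12
        nlinarith [abs_nonneg (k : ℝ)]
      rw [abs_lt] at h11
      rw [Finset.mem_Icc]
      constructor
      · exact_mod_cast h11.1.le
      · exact_mod_cast h11.2.le
    filter_upwards [h1, h2, h3] with u h4 h5 h6
    rw [hF]
    simp only
    split_ifs with hlt hgt
    · exact h4 hlt
    · exact h5 hgt
    · exact h6.symm
  have h0F : ∀ᶠ z in 𝓝 (0 : ℂ), F z = g z := by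
    filter_upwards [Metric.ball_mem_nhds (0 : ℂ) (by norm_num : (0 : ℝ) < 1 / 2)] with z hz
    rw [mem_ball_zero_iff] at hz
    exact if_pos hz
  have hiF : ∀ᶠ w in 𝓝[≠] (0 : ℂ), F w⁻¹ = h w := by
    filter_upwards [self_mem_nhdsWithin, nhdsWithin_le_nhds
      (Metric.ball_mem_nhds (0 : ℂ) (by norm_num : (0 : ℝ) < 1 / 2))] with w hw0 hw
    rw [mem_ball_zero_iff] at hw
    have hw0' : 0 < ‖w‖ := norm_pos_iff.2 hw0
    have h1 : 2 < ‖w⁻¹‖ := by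
      rw [norm_inv, lt_inv_comm₀ (by norm_num) hw0']
      linarith
    have h2 : ¬ ‖w⁻¹‖ < 1 / 2 := by linarith
    rw [hF]
    simp only [if_neg h2, if_pos h1, inv_inv]
  have h0mem : (0 : ℂ) ∈ Metric.ball (0 : ℂ) 1 := Metric.mem_ball_self one_pos
  have hFm : ∀ z, MeromorphicAt F z := by
    intro z
    by_cases hz : z = 0
    · rw [hz]
      exact (hg 0 h0mem).congr (nhdsWithin_le_nhds (h0F.mono fun w hw => hw.symm))
    · have h1 : MeromorphicAt (F ∘ Complex.exp) (Complex.log z) :=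
        (hf _).congr (hfF _)
      have h2 : AnalyticAt ℂ Complex.exp (Complex.log z) := by fun_prop
      rw [meromorphicAt_comp_iff_of_deriv_ne_zero h2 (by
        rw [Complex.deriv_exp]
        exact Complex.exp_ne_zero _), Complex.exp_log hz] at h1
      exact h1
  obtain ⟨r, hr⟩ := exists_ratFunc_of_meromorphic hFm ((hh 0 h0mem).congr
    (hiF.mono fun w hw => hw.symm))
  have hcof : ∀ z : ℂ, 𝓝[≠] z ≤ cofinite := fun z => by
    refine le_trans ?_ (codiscrete_le_cofinite (X := ℂ))
    intro s hs
    have := (mem_codiscreteWithin_iff_forall_mem_nhdsNE.1 hs) z (mem_univ z)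
    simpa using this
  refine ⟨r, ?_, ?_, ?_⟩
  · rw [eventually_codiscreteWithin_iff isOpen_univ]
    intro u _
    filter_upwards [hfF u, (tendsto_exp_nhdsNE u).eventually (hcof _ hr)] with v h1 h2
    rw [h1, h2]
  · refine eventually_codiscreteWithin_eq Metric.isOpen_ball isPreconnected_unitBall hg
      (fun z _ => meromorphicAt_ratEval_comp r (MeromorphicAt.id z)) h0mem ?_
    filter_upwards [nhdsWithin_le_nhds h0F, hcof 0 hr] with z h1 h2
    rw [← h1, h2]
  · have hinv : Tendsto (fun w : ℂ => w⁻¹) cofinite cofinite :=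
      (inv_injective (G := ℂ)).tendsto_cofinite
    refine eventually_codiscreteWithin_eq Metric.isOpen_ball isPreconnected_unitBall hh
      (fun z _ => meromorphicAt_ratEval_comp r (MeromorphicAt.id z).inv) h0mem ?_
    filter_upwards [hiF, hcof 0 (hinv.eventually hr)] with w h1 h2
    rw [← h1, h2]

end Descent

/-! ### Functions representing matrices over `𝓜(E)` -/

section Represents

variable {X Y : Type} [TopologicalSpace X] [ChartedSpace ℂ X] [TopologicalSpace Y]
  [ChartedSpace ℂ Y] {E : Set X} {F : Set Y} {l m n : ℕ}

/-- The function `f` represents the matrix `M` of meromorphic functions. -/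
def Represents (f : X → Matrix (Fin m) (Fin n) ℂ) (M : Matrix (Fin m) (Fin n) (Mero E)) : Prop :=
  ∀ i j, ((fun x => f x i j : X → ℂ) : Germ (codiscreteWithin E) ℂ) = (M i j).1

theorem exists_represents (M : Matrix (Fin m) (Fin n) (Mero E)) :
    ∃ f : X → Matrix (Fin m) (Fin n) ℂ, Represents f M ∧
      ∀ x ∈ E, ∀ i j, IsMeroAt (fun x => f x i j) x := by
  choose f hf hfe using fun i j => (M i j).2
  exact ⟨fun x => Matrix.of fun i j => f i j x, hfe, fun x hx i j => hf i j x hx⟩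

theorem exists_matrix_of_isMeroAt {f : X → Matrix (Fin m) (Fin n) ℂ}
    (hf : ∀ x ∈ E, ∀ i j, IsMeroAt (fun x => f x i j) x) :
    ∃ M : Matrix (Fin m) (Fin n) (Mero E), Represents f M :=
  ⟨Matrix.of fun i j => Mero.mk (fun x => f x i j) fun x hx => hf x hx i j, fun _ _ => rfl⟩

theorem Represents.eventually_eq {f g : X → Matrix (Fin m) (Fin n) ℂ}
    {M : Matrix (Fin m) (Fin n) (Mero E)} (hf : Represents f M) (hg : Represents g M) :
    ∀ᶠ x in codiscreteWithin E, f x = g x := by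
  have : ∀ᶠ x in codiscreteWithin E, ∀ i j, f x i j = g x i j :=
    eventually_all.2 fun i => eventually_all.2 fun j =>
      Germ.coe_eq.1 ((hf i j).trans (hg i j).symm)
  filter_upwards [this] with x hx
  ext i j
  exact hx i j

theorem Represents.congr {f g : X → Matrix (Fin m) (Fin n) ℂ}
    {M : Matrix (Fin m) (Fin n) (Mero E)} (hf : Represents f M)
    (h : ∀ᶠ x in codiscreteWithin E, f x = g x) : Represents g M := fun i j => by
  rw [← hf i j]
  exact Germ.coe_eq.2 (h.mono fun x hx => by simp [hx])

theorem Represents.unique {f : X → Matrix (Fin m) (Fin n) ℂ}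
    {M N : Matrix (Fin m) (Fin n) (Mero E)} (hM : Represents f M) (hN : Represents f N) :
    M = N := by
  ext i j
  exact (hM i j).symm.trans (hN i j)

theorem Represents.mul {f : X → Matrix (Fin l) (Fin m) ℂ} {g : X → Matrix (Fin m) (Fin n) ℂ}
    {M : Matrix (Fin l) (Fin m) (Mero E)} {N : Matrix (Fin m) (Fin n) (Mero E)}
    (hf : Represents f M) (hg : Represents g N) : Represents (fun x => f x * g x) (M * N) := by
  intro i j
  have h1 : ((M * N) i j).1 = ∑ k, (M i k).1 * (N k j).1 := by
    rw [Matrix.mul_apply]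
    exact map_sum (Mero E).subtype _ _
  rw [h1, ← Finset.sum_congr rfl fun k _ => congrArg₂ (· * ·) (hf i k) (hg k j)]
  have h2 := map_sum (Germ.coeRingHom (codiscreteWithin E) (R := ℂ))
    (fun k => (fun x => f x i k) * fun x => g x k j) Finset.univ
  simp only [Germ.coe_coeRingHom] at h2
  refine Eq.trans ?_ h2
  congr 1
  funext x
  simp [Matrix.mul_apply]

theorem represents_const (C : Matrix (Fin m) (Fin n) ℂ) :
    Represents (fun _ => C) (C.map (Mero.const E)) := fun _ _ => rfl

theorem represents_one : Represents (fun _ => 1) (1 : Matrix (Fin n) (Fin n) (Mero E)) := by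
  have := represents_const (E := E) (1 : Matrix (Fin n) (Fin n) ℂ)
  rwa [Matrix.map_one _ (map_zero _) (map_one _)] at this

theorem Represents.pullback {h : X → Y} (hh : IsHoloMap h E F)
    {f : Y → Matrix (Fin m) (Fin n) ℂ} {M : Matrix (Fin m) (Fin n) (Mero F)}
    (hf : Represents f M) : Represents (fun x => f (h x)) (M.map (Mero.pullback h hh)) := by
  intro i j
  change _ = (M i j).1.compTendsto h hh.tendsto
  rw [← hf i j]
  rfl

theorem Represents.eventually_isUnit {f : X → Matrix (Fin n) (Fin n) ℂ} {W : GL (Fin n) (Mero E)}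
    (hf : Represents f W.1) : ∀ᶠ x in codiscreteWithin E, IsUnit (f x) := by
  obtain ⟨g, hg, -⟩ := exists_represents W⁻¹.1
  have h1 := hf.mul hg
  rw [Units.mul_inv] at h1
  filter_upwards [h1.eventually_eq represents_one] with x hx using IsUnit.of_mul_eq_one _ hx

/-- A matrix of meromorphic functions that is invertible outside a discrete set is the class of
an element of `GL_n(𝓜(E))`. -/
theorem exists_GL_of_isMeroAt {f : X → Matrix (Fin n) (Fin n) ℂ}
    (hf : ∀ x ∈ E, ∀ i j, IsMeroAt (fun x => f x i j) x)
    (hu : ∀ᶠ x in codiscreteWithin E, IsUnit (f x)) :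
    ∃ M : GL (Fin n) (Mero E), Represents f M.1 := by
  obtain ⟨M, hM⟩ := exists_matrix_of_isMeroAt hf
  have hinv : ∀ x ∈ E, ∀ i j, IsMeroAt (fun x => (f x)⁻¹ i j) x := by
    intro x hx i j
    have h1 : MatMeroAt (fun w => f ((chartAt ℂ x).symm w)) (chartAt ℂ x x) :=
      fun i j => hf x hx i j
    exact h1.inv i j
  obtain ⟨N, hN⟩ := exists_matrix_of_isMeroAt hinv
  refine ⟨⟨M, N, ?_, ?_⟩, hM⟩
  · refine ((hM.mul hN).congr ?_).unique represents_one
    filter_upwards [hu] with x hx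
    exact Matrix.mul_nonsing_inv _ ((Matrix.isUnit_iff_isUnit_det _).1 hx)
  · refine ((hN.mul hM).congr ?_).unique represents_one
    filter_upwards [hu] with x hx
    exact Matrix.nonsing_inv_mul _ ((Matrix.isUnit_iff_isUnit_det _).1 hx)

theorem Mero.nontrivial [(codiscreteWithin E).NeBot] : Nontrivial (Mero E) := by
  refine ⟨⟨0, 1, fun h => ?_⟩⟩
  have h1 : ((0 : X → ℂ) : Germ (codiscreteWithin E) ℂ) = ((1 : X → ℂ) : Germ _ ℂ) :=
    congrArg Subtype.val h
  obtain ⟨x, hx⟩ := (Germ.coe_eq.1 h1).exists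
  exact zero_ne_one hx

end Represents

/-! ### Rational functions as meromorphic functions -/

section RationalFunctions

variable {X Y : Type} [TopologicalSpace X] [ChartedSpace ℂ X] [TopologicalSpace Y]
  [ChartedSpace ℂ Y] {E : Set X} {F : Set Y}

/-- The ring morphism `ℂ(z) → 𝓜(E)`, `r ↦ r ∘ h`, for a meromorphic function `h` on `E` that takes
every value on a discrete set only. -/
def ratHom (h : X → ℂ) (hm : ∀ x ∈ E, IsMeroAt h x) (ht : Tendsto h (codiscreteWithin E) cofinite) :
    RatFunc ℂ →+* Mero E where
  toFun r := Mero.mk (fun x => ratEval r (h x)) fun x hx => meromorphicAt_ratEval_comp r (hm x hx)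
  map_one' := Subtype.ext (congrArg Germ.ofFun (funext fun _ => RatFunc.eval_one _ _))
  map_zero' := Subtype.ext (congrArg Germ.ofFun (funext fun _ => RatFunc.eval_zero _ _))
  map_mul' r s := by
    refine Subtype.ext (Germ.coe_eq.2 ?_)
    filter_upwards [ht (eventually_cofinite_eval_ne_zero r.denom_ne_zero),
      ht (eventually_cofinite_eval_ne_zero s.denom_ne_zero)] with x h1 h2
    exact RatFunc.eval_mul _ _ h1 h2
  map_add' r s := by
    refine Subtype.ext (Germ.coe_eq.2 ?_)
    filter_upwards [ht (eventually_cofinite_eval_ne_zero r.denom_ne_zero),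
      ht (eventually_cofinite_eval_ne_zero s.denom_ne_zero)] with x h1 h2
    exact RatFunc.eval_add _ _ h1 h2

theorem ratHom_ext {K : Type*} [CommRing K] {f g : RatFunc ℂ →+* K}
    (hC : ∀ c, f (RatFunc.C c) = g (RatFunc.C c)) (hX : f RatFunc.X = g RatFunc.X) : f = g := by
  refine IsLocalization.ringHom_ext (nonZeroDivisors (Polynomial ℂ)) ?_
  refine Polynomial.ringHom_ext (fun c => ?_) ?_
  · simpa [RatFunc.algebraMap_C] using hC c
  · simpa [RatFunc.algebraMap_X] using hX

theorem pullback_comp_ratHom {h : X → ℂ} {hm : ∀ x ∈ E, IsMeroAt h x}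
    {ht : Tendsto h (codiscreteWithin E) cofinite} {h' : Y → ℂ} {hm' : ∀ x ∈ F, IsMeroAt h' x}
    {ht' : Tendsto h' (codiscreteWithin F) cofinite} {k : X → Y} (hk : IsHoloMap k E F)
    (hcomp : ∀ x, h' (k x) = h x) (r : RatFunc ℂ) :
    Mero.pullback k hk (ratHom h' hm' ht' r) = ratHom h hm ht r := by
  refine Subtype.ext (congrArg Germ.ofFun (funext fun x => ?_))
  change ratEval r (h' (k x)) = ratEval r (h x)
  rw [hcomp]

theorem ratHom_ratPhi {p : ℕ} [Fact (2 ≤ p)] {h : X → ℂ} {hm : ∀ x ∈ E, IsMeroAt h x}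
    {ht : Tendsto h (codiscreteWithin E) cofinite} {σ : X → X} (hσ : IsHoloMap σ E E)
    (hcomp : ∀ x, h (σ x) = h x ^ p) (r : RatFunc ℂ) :
    ratHom h hm ht (ratPhi p r) = Mero.pullback σ hσ (ratHom h hm ht r) := by
  have hPm : ∀ q : Polynomial ℂ, ratPhi p (algebraMap _ _ q) =
      algebraMap _ _ (Polynomial.expand ℂ p q) := by
    intro q
    have h1 := RatFunc.map_apply_div (Polynomial.expand ℂ p) (nonZeroDivisors_le_comap_expand p) q 1
    simp only [map_one, div_one] at h1
    exact h1
  have hCm : ∀ c, ratPhi p (RatFunc.C c) = RatFunc.C c := by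
    intro c
    rw [← RatFunc.algebraMap_C, hPm, Polynomial.expand_C]
  have hXm : ratPhi p RatFunc.X = RatFunc.X ^ p := by
    rw [← RatFunc.algebraMap_X, hPm, Polynomial.expand_X, map_pow]
  suffices H : (ratHom h hm ht).comp (ratPhi p) = (Mero.pullback σ hσ).comp (ratHom h hm ht) from
    RingHom.congr_fun H r
  refine ratHom_ext (fun c => ?_) ?_
  · rw [RingHom.comp_apply, hCm]
    refine Subtype.ext (congrArg Germ.ofFun (funext fun x => ?_))
    change ratEval _ _ = ratEval _ _
    simp [ratEval]
  · rw [RingHom.comp_apply, hXm, map_pow]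
    have h1 : ratHom h hm ht RatFunc.X = Mero.mk h hm :=
      Subtype.ext (congrArg Germ.ofFun (funext fun x => RatFunc.eval_X _ _))
    rw [RingHom.comp_apply, h1]
    refine Subtype.ext ?_
    have h2 : ((Mero.mk h hm ^ p : Mero E)).1 = ((h ^ p : X → ℂ) : Germ (codiscreteWithin E) ℂ) :=
      rfl
    rw [h2]
    exact congrArg Germ.ofFun (funext fun x => (hcomp x).symm)

end RationalFunctions

open CStarCover ProjLine

/-! ### Meromorphic functions on the universal cover in the coordinate `log` -/

section Cover

theorem isMeroAt_comp_log {f : ℂ → ℂ} {x : CStarCover} :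
    IsMeroAt (fun x => f (log x)) x ↔ MeromorphicAt f (log x) := by
  have h : (fun x => f (log x)) ∘ (chartAt ℂ x).symm = f := by
    funext u
    simp only [Function.comp_apply, chartAt_symm_apply, log_symm]
  unfold IsMeroAt
  rw [h]
  rfl

theorem isHoloMap_log {E : Set CStarCover} {V : Set ℂ} (h : ∀ x, x ∈ E → log x ∈ V) :
    IsHoloMap log E V := by
  intro x hx
  refine ⟨h x hx, continuous_log.continuousAt, ?_, ?_⟩
  · have h1 : chartAt ℂ (log x) ∘ log ∘ (chartAt ℂ x).symm = id := funext log_symm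
    rw [h1]
    exact analyticAt_id
  · filter_upwards [self_mem_nhdsWithin] with y hy h
    exact hy (logHomeo.injective h)

theorem isHoloMap_logHomeo_symm {E : Set CStarCover} {V : Set ℂ} (h : ∀ x, log x ∈ V → x ∈ E) :
    IsHoloMap logHomeo.symm V E := by
  intro u hu
  refine ⟨h _ (by rwa [log_symm]), logHomeo.symm.continuous.continuousAt, ?_, ?_⟩
  · have h1 : chartAt ℂ (logHomeo.symm u) ∘ logHomeo.symm ∘ (chartAt ℂ u).symm = id :=
      funext log_symm
    rw [h1]
    exact analyticAt_id
  · filter_upwards [self_mem_nhdsWithin] with y hy h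
    exact hy (logHomeo.symm.injective h)

theorem eventually_cover_iff {E : Set CStarCover} {V : Set ℂ} (h : ∀ x, x ∈ E ↔ log x ∈ V)
    {P : ℂ → Prop} :
    (∀ᶠ x in codiscreteWithin E, P (log x)) ↔ ∀ᶠ u in codiscreteWithin V, P u := by
  refine ⟨fun H => ?_, fun H => (isHoloMap_log fun x hx => (h x).1 hx).tendsto.eventually H⟩
  filter_upwards [(isHoloMap_logHomeo_symm fun x hx => (h x).2 hx).tendsto.eventually H] with u hu
  rwa [log_symm] at hu

theorem mem_univ_iff_log (x : CStarCover) : x ∈ (univ : Set CStarCover) ↔ log x ∈ (univ : Set ℂ) :=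
  ⟨fun _ => mem_univ _, fun _ => mem_univ _⟩

theorem mem_Sigma0_iff (x : CStarCover) : x ∈ Sigma0 ↔ log x ∈ {u : ℂ | u.re < 0} := by
  have h : (log x).re = Real.log ‖x.1.1‖ := by simp [log]
  have hpos : 0 < ‖x.1.1‖ := norm_pos_iff.2 x.ne_zero
  simp only [mem_ofPred_eq, h, Real.log_neg_iff hpos, Sigma0]

theorem mem_SigmaInf_iff (x : CStarCover) : x ∈ SigmaInf ↔ log x ∈ {u : ℂ | 0 < u.re} := by
  have h : (log x).re = Real.log ‖x.1.1‖ := by simp [log]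
  have hpos : 0 < ‖x.1.1‖ := norm_pos_iff.2 x.ne_zero
  simp only [mem_ofPred_eq, h, Real.log_pos_iff hpos.le, SigmaInf]

/-- Matrices of meromorphic functions on the universal cover are represented by matrices of
meromorphic functions of `u = log z`. -/
theorem exists_represents_log {m n : ℕ} (M : Matrix (Fin m) (Fin n) (Mero (univ : Set CStarCover))) :
    ∃ f : ℂ → Matrix (Fin m) (Fin n) ℂ, Represents (fun x => f (log x)) M ∧
      ∀ u, MatMeroAt f u := by
  obtain ⟨g, hg, hgm⟩ := exists_represents M
  have h : ∀ x, logHomeo.symm (log x) = x := logHomeo.symm_apply_apply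
  refine ⟨fun u => g (logHomeo.symm u), ?_, fun u i j => ?_⟩
  · simpa only [h] using hg
  · have h1 := hgm (logHomeo.symm u) (mem_univ _) i j
    have h2 : (fun x => g x i j) = fun x => (fun u : ℂ => g (logHomeo.symm u) i j) (log x) :=
      funext fun x => by simp only [h]
    rw [h2] at h1
    have h3 := (isMeroAt_comp_log (f := fun u : ℂ => g (logHomeo.symm u) i j)).1 h1
    rwa [log_symm] at h3

end Cover

/-! ### The maps to the unit disk -/

section Disk

variable {p : ℕ} [Fact (2 ≤ p)]

/-- For maps to `ℂ`, the chart of the target in the definition of `IsHoloMap` is the identity. -/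
theorem isHoloMap_of_complex {X : Type} [TopologicalSpace X] [ChartedSpace ℂ X] {h : X → ℂ}
    {E : Set X} {F : Set ℂ} (H : ∀ x ∈ E, h x ∈ F ∧ ContinuousAt h x ∧
      AnalyticAt ℂ (h ∘ (chartAt ℂ x).symm) (chartAt ℂ x x) ∧ ∀ᶠ y in 𝓝[≠] x, h y ≠ h x) :
    IsHoloMap h E F := fun x hx => H x hx

theorem isHoloMap_pow : IsHoloMap (fun z : ℂ => z ^ p) (Metric.ball 0 1) (Metric.ball 0 1) := by
  have hp := p_ne_zero p
  refine isHoloMap_of_complex fun z hz => ⟨mapsTo_pow_ball hp le_rfl hz, by fun_prop, ?_, ?_⟩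
  · change AnalyticAt ℂ (fun z : ℂ => z ^ p) z
    fun_prop
  · by_cases hz0 : z = 0
    · subst hz0
      filter_upwards [self_mem_nhdsWithin] with w hw
      rw [zero_pow hp]
      exact pow_ne_zero p hw
    · exact (hasDerivAt_pow p z).eventually_ne
        (mul_ne_zero (by exact_mod_cast hp) (pow_ne_zero _ hz0))

/-- The operator `φ_p` on the meromorphic functions on the unit disk. -/
def phiBall (p : ℕ) [Fact (2 ≤ p)] :
    Mero (Metric.ball (0 : ℂ) 1) →+* Mero (Metric.ball (0 : ℂ) 1) :=
  Mero.pullback (fun z => z ^ p) isHoloMap_pow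

theorem isHoloMap_inv_proj :
    IsHoloMap (fun x => (proj x)⁻¹) SigmaInf (Metric.ball (0 : ℂ) 1) := by
  refine isHoloMap_of_complex fun x hx => ⟨?_, ?_, ?_, ?_⟩
  · rw [mem_ball_zero_iff, norm_inv, proj_eq]
    exact inv_lt_one_of_one_lt₀ hx
  · exact (Complex.continuous_exp.comp continuous_log).continuousAt.inv₀ (Complex.exp_ne_zero _)
  · have h : (fun x => (proj x)⁻¹) ∘ (chartAt ℂ x).symm = fun u => (Complex.exp u)⁻¹ := by
      funext u
      simp only [Function.comp_apply, chartAt_symm_apply, proj, log_symm]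
    rw [h]
    have h1 : AnalyticAt ℂ Complex.exp (chartAt ℂ x x) := by fun_prop
    exact h1.inv (Complex.exp_ne_zero _)
  · filter_upwards [eventually_proj_ne x] with y hy h
    exact hy (inv_injective h)

/-- Pullback `𝓜(D(0,1)) → 𝓜(Σ_∞)` along `1 / π`: meromorphic functions outside the closed unit disk
are written in the coordinate `w = 1 / z`. -/
def piInvInf : Mero (Metric.ball (0 : ℂ) 1) →+* Mero SigmaInf :=
  Mero.pullback (fun x => (proj x)⁻¹) isHoloMap_inv_proj

theorem chartFin_coe (z : ℂ) : (chartFin : OnePoint ℂ → ℂ) (z : OnePoint ℂ) = z :=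
  ((OnePoint.isOpenEmbedding_coe (X := ℂ)).toOpenPartialHomeomorph _).left_inv (mem_univ _)

theorem chartInf_coe (z : ℂ) : (chartInf : OnePoint ℂ → ℂ) (z : OnePoint ℂ) = z⁻¹ := rfl

theorem chartInf_symm_apply (w : ℂ) :
    chartInf.symm w = if w = 0 then OnePoint.infty else ((w⁻¹ : ℂ) : OnePoint ℂ) := rfl

theorem exterior_coe {z : ℂ} : (z : OnePoint ℂ) ∈ exterior ↔ 1 < ‖z‖ := by
  simp only [exterior, mem_compl_iff, mem_image, mem_closedBall_zero_iff, not_exists, not_and]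
  constructor
  · intro h
    by_contra hz
    exact h z (not_lt.1 hz) rfl
  · intro h w hw hwz
    rw [OnePoint.coe_injective hwz] at hw
    exact absurd h (not_lt.2 hw)

theorem infty_mem_exterior : (OnePoint.infty : OnePoint ℂ) ∈ exterior := by
  rintro ⟨z, -, hz⟩
  exact OnePoint.coe_ne_infty z hz

theorem isHoloMap_chartInf : IsHoloMap chartInf exterior (Metric.ball (0 : ℂ) 1) := by
  have hsrc : ∀ x ∈ exterior, x ∈ chartInf.source := by
    rintro x hx (rfl : x = _)
    have := exterior_coe.1 hx
    simp at this
    linarith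
  refine isHoloMap_of_complex fun x hx => ⟨?_, chartInf.continuousAt (hsrc x hx), ?_, ?_⟩
  · induction x using OnePoint.rec with
    | infty => exact Metric.mem_ball_self one_pos
    | coe z =>
      rw [chartInf_coe, mem_ball_zero_iff, norm_inv]
      exact inv_lt_one_of_one_lt₀ (exterior_coe.1 hx)
  · induction x using OnePoint.rec with
    | infty =>
      have h : chartInf ∘ (chartAt ℂ (OnePoint.infty : OnePoint ℂ)).symm = id :=
        funext fun w => chartInf.right_inv (mem_univ w)
      rw [h]
      exact analyticAt_id
    | coe z =>
      have h : chartInf ∘ (chartAt ℂ (z : OnePoint ℂ)).symm = fun w : ℂ => w⁻¹ := rfl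
      have h1 : chartAt ℂ (z : OnePoint ℂ) (z : OnePoint ℂ) = z := chartFin_coe z
      rw [h, h1]
      refine analyticAt_inv ?_
      rintro rfl
      have := exterior_coe.1 hx
      simp at this
      linarith
  · have h1 := chartInf.open_source.mem_nhds (hsrc x hx)
    filter_upwards [self_mem_nhdsWithin, nhdsWithin_le_nhds h1] with y hy hys h
    exact hy (chartInf.injOn hys (hsrc x hx) h)

theorem isHoloMap_chartInf_symm : IsHoloMap chartInf.symm (Metric.ball (0 : ℂ) 1) exterior := by
  intro w hw
  refine ⟨?_, chartInf.continuousAt_symm (mem_univ w), ?_, ?_⟩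
  · rw [chartInf_symm_apply]
    split_ifs with h0
    · exact infty_mem_exterior
    · rw [exterior_coe, norm_inv]
      exact (one_lt_inv₀ (norm_pos_iff.2 h0)).2 (mem_ball_zero_iff.1 hw)
  · change AnalyticAt ℂ (chartAt ℂ (chartInf.symm w) ∘ chartInf.symm) w
    by_cases h0 : w = 0
    · have h1 : chartInf.symm w = OnePoint.infty := by rw [chartInf_symm_apply, if_pos h0]
      rw [h1]
      have h : chartAt ℂ (OnePoint.infty : OnePoint ℂ) ∘ chartInf.symm = id :=
        funext fun w => chartInf.right_inv (mem_univ w)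
      rw [h]
      exact analyticAt_id
    · have h1 : chartInf.symm w = ((w⁻¹ : ℂ) : OnePoint ℂ) := by
        rw [chartInf_symm_apply, if_neg h0]
      rw [h1]
      refine (analyticAt_inv h0).congr ?_
      filter_upwards [isOpen_ne.mem_nhds h0] with v hv
      rw [Function.comp_apply, chartInf_symm_apply, if_neg hv]
      exact (chartFin_coe _).symm
  · filter_upwards [self_mem_nhdsWithin] with y hy h
    exact hy (chartInf.symm.injOn (mem_univ y) (mem_univ w) h)

theorem piInf_chartInf (f : Mero (Metric.ball (0 : ℂ) 1)) :
    piInf (Mero.pullback chartInf isHoloMap_chartInf f) = piInvInf f := by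
  obtain ⟨_, f, hf, rfl⟩ := f
  rfl

theorem piInvInf_chartInf_symm (f : Mero exterior) :
    piInvInf (Mero.pullback chartInf.symm isHoloMap_chartInf_symm f) = piInf f := by
  obtain ⟨_, f, hf, rfl⟩ := f
  refine Subtype.ext (congrArg Germ.ofFun (funext fun x => ?_))
  change f (chartInf.symm (proj x)⁻¹) = f (proj x : ℂ)
  have h0 : (proj x)⁻¹ ≠ 0 := inv_ne_zero (Complex.exp_ne_zero _)
  rw [chartInf_symm_apply, if_neg h0, inv_inv]

end Disk

/-! ### Rational functions on the disk and on the universal cover -/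

section RatMaps

theorem codiscreteWithin_le_cofinite {X : Type*} [TopologicalSpace X] [T1Space X] (U : Set X) :
    codiscreteWithin U ≤ cofinite :=
  (codiscreteWithin_mono (subset_univ U)).trans codiscrete_le_cofinite

/-- `ℂ(z) → 𝓜(D(0,1))`, `r ↦ r(z)`. -/
def ratZero : RatFunc ℂ →+* Mero (Metric.ball (0 : ℂ) 1) :=
  ratHom (fun z => z) (fun z _ => MeromorphicAt.id z) (codiscreteWithin_le_cofinite _)

/-- `ℂ(z) → 𝓜(D(0,1))`, `r ↦ r(1 / w)`. -/
def ratInf : RatFunc ℂ →+* Mero (Metric.ball (0 : ℂ) 1) :=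
  ratHom (fun w => w⁻¹) (fun w _ => (MeromorphicAt.id w).inv)
    ((inv_injective.tendsto_cofinite).mono_left (codiscreteWithin_le_cofinite _))

theorem tendsto_proj_cofinite (E : Set CStarCover) :
    Tendsto proj (codiscreteWithin E) cofinite := by
  refine Tendsto.mono_left ?_ (codiscreteWithin_mono (subset_univ E))
  refine le_cofinite_iff_eventually_ne.2 fun c => ?_
  change ∀ᶠ x in codiscreteWithin univ, proj x ≠ c
  rw [eventually_codiscreteWithin_iff isOpen_univ]
  intro x _
  by_cases hx : proj x = c
  · exact hx ▸ eventually_proj_ne x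
  · have h1 : Continuous proj := Complex.continuous_exp.comp continuous_log
    exact nhdsWithin_le_nhds (h1.continuousAt.eventually_ne hx)

theorem isMeroAt_proj (x : CStarCover) : IsMeroAt proj x :=
  isMeroAt_comp_log.2 (by fun_prop : AnalyticAt ℂ Complex.exp (log x)).meromorphicAt

/-- `ℂ(z) → 𝓜(E)`, `r ↦ r ∘ π`, for a subset `E` of the universal cover. -/
def ratCover (E : Set CStarCover) : RatFunc ℂ →+* Mero E :=
  ratHom proj (fun x _ => isMeroAt_proj x) (tendsto_proj_cofinite E)

theorem restr_ratCover (E : Set CStarCover) (r : RatFunc ℂ) :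
    restr E (ratCover univ r) = ratCover E r :=
  pullback_comp_ratHom _ (fun _ => rfl) r

theorem piZero_ratZero (r : RatFunc ℂ) : piZero (ratZero r) = ratCover Sigma0 r :=
  pullback_comp_ratHom _ (fun _ => rfl) r

theorem piInvInf_ratInf (r : RatFunc ℂ) : piInvInf (ratInf r) = ratCover SigmaInf r :=
  pullback_comp_ratHom _ (fun _ => inv_inv _) r

theorem proj_phi (p : ℕ) (x : CStarCover) : proj (phi p x) = proj x ^ p := by
  rw [proj, log_phi, proj, ← Complex.exp_nat_mul]

variable {p : ℕ} [Fact (2 ≤ p)]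

theorem ratZero_ratPhi (r : RatFunc ℂ) : ratZero (ratPhi p r) = phiBall p (ratZero r) :=
  ratHom_ratPhi (h := fun z : ℂ => z) isHoloMap_pow (fun _ => rfl) r

theorem ratInf_ratPhi (r : RatFunc ℂ) : ratInf (ratPhi p r) = phiBall p (ratInf r) :=
  ratHom_ratPhi (h := fun w : ℂ => w⁻¹) isHoloMap_pow (fun w => (inv_pow w p).symm) r

theorem ratCover_ratPhi (r : RatFunc ℂ) :
    ratCover univ (ratPhi p r) = phiCover p (ratCover univ r) :=
  ratHom_ratPhi _ (proj_phi p) r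

theorem phiZero_restr (f : Mero (univ : Set CStarCover)) :
    phiZero p (restr Sigma0 f) = restr Sigma0 (phiCover p f) := by
  obtain ⟨_, f, hf, rfl⟩ := f
  rfl

theorem phiInf_restr (f : Mero (univ : Set CStarCover)) :
    phiInf p (restr SigmaInf f) = restr SigmaInf (phiCover p f) := by
  obtain ⟨_, f, hf, rfl⟩ := f
  rfl

theorem phiZero_piZero (f : Mero (Metric.ball (0 : ℂ) 1)) :
    phiZero p (piZero f) = piZero (phiBall p f) := by
  obtain ⟨_, f, hf, rfl⟩ := f
  refine Subtype.ext (congrArg Germ.ofFun (funext fun x => ?_))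
  exact congrArg f (proj_phi p x)

theorem phiInf_piInvInf (f : Mero (Metric.ball (0 : ℂ) 1)) :
    phiInf p (piInvInf f) = piInvInf (phiBall p f) := by
  obtain ⟨_, f, hf, rfl⟩ := f
  refine Subtype.ext (congrArg Germ.ofFun (funext fun x => ?_))
  change f (proj (phi p x))⁻¹ = f ((proj x)⁻¹ ^ p)
  rw [proj_phi, inv_pow]

/-- Descent: a meromorphic function on the universal cover that comes from the disks around `0`
and `∞` is the pullback of a rational function. -/
theorem exists_ratFunc_of_descent {f : Mero (univ : Set CStarCover)}
    {g h : Mero (Metric.ball (0 : ℂ) 1)} (hfg : restr Sigma0 f = piZero g)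
    (hfh : restr SigmaInf f = piInvInf h) :
    ∃ r : RatFunc ℂ, f = ratCover univ r ∧ g = ratZero r ∧ h = ratInf r := by
  obtain ⟨_, f, hf, rfl⟩ := f
  obtain ⟨_, g, hg, rfl⟩ := g
  obtain ⟨_, h, hh, rfl⟩ := h
  have hlog : ∀ x, logHomeo.symm (log x) = x := logHomeo.symm_apply_apply
  set f' : ℂ → ℂ := fun u => f (logHomeo.symm u) with hf'
  have hff : f = fun x => f' (log x) := by
    funext x
    rw [hf']
    simp only [hlog]
  clear_value f'
  subst hff
  have h1 : ∀ᶠ x in codiscreteWithin Sigma0, f' (log x) = g (Complex.exp (log x)) :=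
    Germ.coe_eq.1 (congrArg Subtype.val hfg)
  have h2 : ∀ᶠ x in codiscreteWithin SigmaInf, f' (log x) = h (Complex.exp (log x))⁻¹ :=
    Germ.coe_eq.1 (congrArg Subtype.val hfh)
  rw [eventually_cover_iff mem_Sigma0_iff (P := fun u => f' u = g (Complex.exp u))] at h1
  rw [eventually_cover_iff mem_SigmaInf_iff (P := fun u => f' u = h (Complex.exp u)⁻¹)] at h2
  obtain ⟨r, hr, hrg, hrh⟩ := exists_ratFunc_of_glue (f := f') (fun u => by
    have := isMeroAt_comp_log.1 (hf (logHomeo.symm u) (mem_univ _))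
    rwa [log_symm] at this) hg hh h1 h2
  refine ⟨r, Subtype.ext (Germ.coe_eq.2 ?_), Subtype.ext (Germ.coe_eq.2 hrg),
    Subtype.ext (Germ.coe_eq.2 hrh)⟩
  exact (eventually_cover_iff mem_univ_iff_log
    (P := fun u => f' u = ratEval r (Complex.exp u))).2 hr

end RatMaps

/-! ### Constants and Laurent polynomials in `log` -/

section Solutions

theorem neBot_codiscreteWithin {U : Set ℂ} (hU : IsOpen U) {a : ℂ} (ha : a ∈ U) :
    (codiscreteWithin U).NeBot := by
  refine ⟨fun h => ?_⟩
  have h1 : ∀ᶠ z in codiscreteWithin U, False := by simp [h]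
  exact absurd ((eventually_codiscreteWithin_iff hU).1 h1 a ha) (by simp [NeBot.ne])

theorem neBot_codiscreteWithin_cover : (codiscreteWithin (univ : Set CStarCover)).NeBot := by
  have h1 := neBot_codiscreteWithin isOpen_univ (mem_univ (0 : ℂ))
  exact (h1.map _).mono (isHoloMap_logHomeo_symm (V := univ) fun x _ => mem_univ x).tendsto

theorem const_ball_injective : Function.Injective (Mero.const (Metric.ball (0 : ℂ) 1)) := by
  have := neBot_codiscreteWithin Metric.isOpen_ball (Metric.mem_ball_self one_pos : (0 : ℂ) ∈ _)
  have := Mero.nontrivial (E := Metric.ball (0 : ℂ) 1)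
  exact (Mero.const (Metric.ball (0 : ℂ) 1)).injective

theorem ratCover_univ_injective : Function.Injective (ratCover univ) := by
  have := neBot_codiscreteWithin_cover
  have := Mero.nontrivial (E := (univ : Set CStarCover))
  exact (ratCover univ).injective

variable {p : ℕ} [Fact (2 ≤ p)] {m n : ℕ}

/-- On the unit disk, a solution of `φ_p(Q) A = B Q` with constant invertible `A` and `B` is
constant. -/
theorem exists_const_of_phiBall {A : GL (Fin n) ℂ} {B : GL (Fin m) ℂ}
    {Q : Matrix (Fin m) (Fin n) (Mero (Metric.ball (0 : ℂ) 1))}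
    (hQ : Q.map (phiBall p) * A.1.map (Mero.const _) = B.1.map (Mero.const _) * Q) :
    ∃ S : Matrix (Fin m) (Fin n) ℂ, Q = S.map (Mero.const _) := by
  obtain ⟨f, hf, hfm⟩ := exists_represents Q
  have h0 : (0 : ℂ) ∈ Metric.ball (0 : ℂ) 1 := Metric.mem_ball_self one_pos
  have h1 := (hf.pullback (isHoloMap_pow (p := p))).mul (represents_const A.1)
  have h2 : Represents (fun z => f (z ^ p) * A.1) (B.1.map (Mero.const _) * Q) := hQ ▸ h1
  have h3 := h2.eventually_eq ((represents_const B.1).mul hf)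
  obtain ⟨S, hS⟩ := eventually_const_of_mahler Fact.out (hfm 0 h0)
    ((eventually_codiscreteWithin_iff Metric.isOpen_ball).1 h3 0 h0)
  have h4 := eventually_eq_of_frequently_eq Metric.isOpen_ball isPreconnected_unitBall hfm
    (fun z _ => MatMeroAt.const S) h0 hS.frequently
  exact ⟨S, (hf.congr h4).unique (represents_const S)⟩

/-- On the universal cover, a solution of `φ_p(Q) A = B Q` with constant invertible `A` and `B` has
its entries in `ℂ[log, log⁻¹]`. -/
theorem exists_laurentLog_of_phiCover {A : GL (Fin n) ℂ} {B : GL (Fin m) ℂ}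
    {Q : Matrix (Fin m) (Fin n) (Mero (univ : Set CStarCover))}
    (hQ : Q.map (phiCover p) * A.1.map (Mero.const _) = B.1.map (Mero.const _) * Q) :
    ∃ S : Matrix (Fin m) (Fin n) laurentLog, Q = S.map laurentLog.subtype := by
  obtain ⟨f, hf, hfm⟩ := exists_represents_log Q
  have h1 := (hf.pullback (isHoloMap_phi (p_ne_zero p) (mapsTo_univ _ _))).mul
    (represents_const A.1)
  have h2 : Represents (fun x => f (log (phi p x)) * A.1) (B.1.map (Mero.const _) * Q) := hQ ▸ h1
  have h3 := h2.eventually_eq ((represents_const B.1).mul hf)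
  simp only [log_phi] at h3
  rw [eventually_cover_iff mem_univ_iff_log (P := fun u => f (p * u) * A.1 = B.1 * f u),
    eventually_codiscreteWithin_iff isOpen_univ] at h3
  obtain ⟨N, d, c, hc⟩ := exists_laurent_of_qDifference Fact.out (hfm 0) (h3 0 (mem_univ _))
  have hg : ∀ u : ℂ, MatMeroAt
      (fun u => (u⁻¹) ^ N • ∑ i ∈ Finset.range d, u ^ i • c i) u := by
    intro u i j
    simp only [Matrix.smul_apply, Matrix.sum_apply, smul_eq_mul]
    exact ((MeromorphicAt.id u).inv.pow N).mul
      (MeromorphicAt.fun_sum fun k _ => ((MeromorphicAt.id u).pow k).mul (MeromorphicAt.const _ _))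
  have h4 := eventually_eq_of_frequently_eq isOpen_univ isPreconnected_univ
    (fun z _ => hfm z) (fun z _ => hg z) (mem_univ 0) hc.frequently
  have h5 := (eventually_cover_iff mem_univ_iff_log (P := fun u => f u = _)).2 h4
  have hC : ∀ c, Mero.const univ c ∈ laurentLog := fun c =>
    Subring.subset_closure (Or.inl (mem_range_self c))
  let ℓ : laurentLog := ⟨logMero, Subring.subset_closure (Or.inr (Or.inl rfl))⟩
  let ℓ' : laurentLog := ⟨logInvMero, Subring.subset_closure (Or.inr (Or.inr rfl))⟩
  refine ⟨Matrix.of fun i j => ℓ' ^ N * ∑ k ∈ Finset.range d, ℓ ^ k * ⟨_, hC (c k i j)⟩,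
    (hf.congr h5).unique fun i j => ?_⟩
  let ψ : laurentLog →+* Germ (codiscreteWithin (univ : Set CStarCover)) ℂ :=
    (Mero univ).subtype.comp laurentLog.subtype
  let χ := Germ.coeRingHom (codiscreteWithin (univ : Set CStarCover)) (R := ℂ)
  have hR : ψ (ℓ' ^ N * ∑ k ∈ Finset.range d, ℓ ^ k * ⟨_, hC (c k i j)⟩) =
      χ (fun x => (log x)⁻¹) ^ N * ∑ k ∈ Finset.range d, χ log ^ k * χ (fun _ => c k i j) := by
    rw [map_mul, map_pow, map_sum]
    simp only [map_mul, map_pow]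
    rfl
  refine Eq.trans ?_ hR.symm
  simp only [← map_pow, ← map_mul, ← map_sum]
  refine congrArg Germ.ofFun (funext fun x => ?_)
  simp [Matrix.sum_apply]

end Solutions

/-! ### Gauge transformations -/

section Gauge

variable {K : Type*} [CommRing K] {φ : K →+* K} {k l m n : ℕ}

/-- `W` is invertible with inverse `V`, and transforms the system with matrix `a` into the system
with matrix `A`: `φ(W) a = A W`. The ranks are allowed to differ syntactically. -/
structure IsGauge (φ : K →+* K) (A : Matrix (Fin m) (Fin m) K) (a : Matrix (Fin k) (Fin k) K)
    (W : Matrix (Fin m) (Fin k) K) (V : Matrix (Fin k) (Fin m) K) : Prop where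
  mul_inv : W * V = 1
  inv_mul : V * W = 1
  eq : W.map φ * a = A * W

variable {A : Matrix (Fin m) (Fin m) K} {a : Matrix (Fin k) (Fin k) K}
  {B : Matrix (Fin n) (Fin n) K} {b : Matrix (Fin l) (Fin l) K}
  {W : Matrix (Fin m) (Fin k) K} {V : Matrix (Fin k) (Fin m) K}
  {W' : Matrix (Fin n) (Fin l) K} {V' : Matrix (Fin l) (Fin n) K}

theorem IsGauge.symm (h : IsGauge φ A a W V) : IsGauge φ a A V W := by
  refine ⟨h.inv_mul, h.mul_inv, ?_⟩
  calc V.map φ * A = V.map φ * (A * W) * V := by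
        rw [Matrix.mul_assoc, Matrix.mul_assoc A, h.mul_inv, Matrix.mul_one]
    _ = (V * W).map φ * a * V := by
        rw [← h.eq, Matrix.map_mul]
        simp only [Matrix.mul_assoc]
    _ = a * V := by
        rw [h.inv_mul, Matrix.map_one _ (map_zero _) (map_one _), Matrix.one_mul]

/-- Gauge transformations carry morphisms of systems to morphisms of systems. -/
theorem IsGauge.conj (h : IsGauge φ A a W V) (h' : IsGauge φ B b W' V')
    {R : Matrix (Fin n) (Fin m) K} (hR : R.map φ * A = B * R) :
    (V' * R * W).map φ * a = b * (V' * R * W) := by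
  calc (V' * R * W).map φ * a = V'.map φ * R.map φ * (W.map φ * a) := by
        rw [Matrix.map_mul, Matrix.map_mul, Matrix.mul_assoc]
    _ = V'.map φ * (R.map φ * A) * W := by
        rw [h.eq]
        simp only [Matrix.mul_assoc]
    _ = (V'.map φ * B) * R * W := by
        rw [hR]
        simp only [Matrix.mul_assoc]
    _ = b * (V' * R * W) := by
        rw [h'.symm.eq]
        simp only [Matrix.mul_assoc]

theorem mul_eq_iff_eq_inv_mul (h : W' * V' = 1) (h' : V' * W' = 1) {Q : Matrix (Fin l) (Fin k) K}
    {P : Matrix (Fin n) (Fin k) K} : W' * Q = P ↔ Q = V' * P := by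
  constructor
  · rintro rfl
    rw [← Matrix.mul_assoc, h', Matrix.one_mul]
  · rintro rfl
    rw [← Matrix.mul_assoc, h, Matrix.one_mul]

theorem IsGauge.of_GL {A : GL (Fin n) K} {a : GL (Fin n) K} {W : GL (Fin n) K}
    (h : W.map φ * a = A * W) : IsGauge φ A.1 a.1 W.1 W⁻¹.1 :=
  ⟨W.mul_inv, W.inv_mul, congrArg Units.val h⟩

theorem IsGauge.cancel (h : IsGauge φ A a W V) {j : ℕ} {P Q : Matrix (Fin k) (Fin j) K}
    (hPQ : W * P = W * Q) : P = Q := by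
  rw [← Matrix.one_mul P, ← h.inv_mul, Matrix.mul_assoc, hPQ, ← Matrix.mul_assoc, h.inv_mul,
    Matrix.one_mul]

theorem matrix_map_injective {K K' : Type*} [CommRing K] [CommRing K'] {f : K →+* K'}
    (hf : Function.Injective f) {P Q : Matrix (Fin m) (Fin n) K} (h : P.map f = Q.map f) : P = Q :=
  Matrix.map_injective hf h

theorem matrix_map_comm {K K' L L' : Type*} [CommRing K] [CommRing K'] [CommRing L] [CommRing L']
    {f : K →+* L} {g : L →+* L'} {f' : K →+* K'} {g' : K' →+* L'} (h : ∀ x, g (f x) = g' (f' x))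
    (M : Matrix (Fin m) (Fin n) K) : (M.map f).map g = (M.map f').map g' := by
  ext i j
  exact h (M i j)

end Gauge

/-! ### The correspondence between Mahler systems and connections -/

section Links

variable {p : ℕ} [Fact (2 ≤ p)]

/-- The Mahler system `A` and the connection `X` correspond to each other: there are fundamental
solutions `W1`, `W0`, `Winf` of `A` on the universal cover and on the disks around `0` and `∞`
(the latter in the coordinate `w = 1 / z`), with the constant matrices of `X` and with the
connection matrices of `X`. The ranks are only required to be equal through the existence of
invertible matrices. -/
structure Link (A : MahlerSystem p) (X : Connection p) where
  W1 : Matrix (Fin A.rank) (Fin X.rank) (Mero (univ : Set CStarCover))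
  V1 : Matrix (Fin X.rank) (Fin A.rank) (Mero (univ : Set CStarCover))
  W0 : Matrix (Fin A.rank) (Fin X.rank) (Mero (Metric.ball (0 : ℂ) 1))
  V0 : Matrix (Fin X.rank) (Fin A.rank) (Mero (Metric.ball (0 : ℂ) 1))
  Winf : Matrix (Fin A.rank) (Fin X.rank) (Mero (Metric.ball (0 : ℂ) 1))
  Vinf : Matrix (Fin X.rank) (Fin A.rank) (Mero (Metric.ball (0 : ℂ) 1))
  gauge1 : IsGauge (phiCover p) (A.mat.1.map (ratCover univ)) (X.A1.1.map (Mero.const _)) W1 V1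
  gauge0 : IsGauge (phiBall p) (A.mat.1.map ratZero) (X.A0.1.map (Mero.const _)) W0 V0
  gaugeInf : IsGauge (phiBall p) (A.mat.1.map ratInf) (X.Ainf.1.map (Mero.const _)) Winf Vinf
  conn0 : W1.map (restr Sigma0) * X.M0.1 = W0.map piZero
  connInf : W1.map (restr SigmaInf) * X.Minf.1 = Winf.map piInvInf

variable {A B C : MahlerSystem p} {X Y Z : Connection p}

/-- The morphisms `R` of Mahler systems and `S` of connections correspond to each other. -/
structure Link.Rel (L : Link A X) (L' : Link B Y) (R : A ⟶ B) (S : X ⟶ Y) : Prop where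
  rel1 : L'.W1 * S.S1.map laurentLog.subtype = R.R.map (ratCover univ) * L.W1
  rel0 : L'.W0 * S.S0.map (Mero.const _) = R.R.map ratZero * L.W0
  relInf : L'.Winf * S.Sinf.map (Mero.const _) = R.R.map ratInf * L.Winf

theorem Link.rel_id (L : Link A X) : L.Rel L (𝟙 A) (𝟙 X) := by
  have hA : (𝟙 A : A ⟶ A).R = 1 := rfl
  have h0 : (𝟙 X : X ⟶ X).S0 = 1 := rfl
  have h1 : (𝟙 X : X ⟶ X).S1 = 1 := rfl
  have hi : (𝟙 X : X ⟶ X).Sinf = 1 := rfl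
  constructor
  · simp [hA, h1]
  · simp only [hA, h0, Matrix.map_one, map_zero, map_one, Matrix.one_mul]
    exact Matrix.mul_one _
  · simp only [hA, hi, Matrix.map_one, map_zero, map_one, Matrix.one_mul]
    exact Matrix.mul_one _

theorem mul_map_comp {K K1 K2 : Type*} [CommRing K] [CommRing K1] [CommRing K2] {f : K1 →+* K}
    {g : K2 →+* K} {a b c a' b' c' : ℕ} {W : Matrix (Fin a) (Fin a') K}
    {W' : Matrix (Fin b) (Fin b') K} {W'' : Matrix (Fin c) (Fin c') K}
    {S : Matrix (Fin b') (Fin a') K1} {S' : Matrix (Fin c') (Fin b') K1}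
    {R : Matrix (Fin b) (Fin a) K2} {R' : Matrix (Fin c) (Fin b) K2}
    (h : W' * S.map f = R.map g * W) (h' : W'' * S'.map f = R'.map g * W') :
    W'' * (S' * S).map f = (R' * R).map g * W := by
  rw [Matrix.map_mul, Matrix.map_mul, ← Matrix.mul_assoc, h', Matrix.mul_assoc, h,
    Matrix.mul_assoc]

theorem Link.Rel.comp {L : Link A X} {L' : Link B Y} {L'' : Link C Z} {R : A ⟶ B} {S : X ⟶ Y}
    {R' : B ⟶ C} {S' : Y ⟶ Z} (h : L.Rel L' R S) (h' : L'.Rel L'' R' S') :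
    L.Rel L'' (R ≫ R') (S ≫ S') :=
  ⟨mul_map_comp h.rel1 h'.rel1, mul_map_comp h.rel0 h'.rel0, mul_map_comp h.relInf h'.relInf⟩

theorem Link.Rel.right_unique {L : Link A X} {L' : Link B Y} {R : A ⟶ B} {S S' : X ⟶ Y}
    (h : L.Rel L' R S) (h' : L.Rel L' R S') : S = S' := by
  refine Connection.Hom.ext ?_ ?_ ?_
  · exact matrix_map_injective const_ball_injective
      (L'.gauge0.cancel (h.rel0.trans h'.rel0.symm))
  · exact matrix_map_injective (Subring.subtype_injective laurentLog)
      (L'.gauge1.cancel (h.rel1.trans h'.rel1.symm))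
  · exact matrix_map_injective const_ball_injective
      (L'.gaugeInf.cancel (h.relInf.trans h'.relInf.symm))

theorem Link.Rel.left_unique {L : Link A X} {L' : Link B Y} {R R' : A ⟶ B} {S : X ⟶ Y}
    (h : L.Rel L' R S) (h' : L.Rel L' R' S) : R = R' := by
  refine MahlerSystem.Hom.ext (matrix_map_injective ratCover_univ_injective ?_)
  have h1 := congrArg (· * L.V1) (h.rel1.symm.trans h'.rel1)
  simpa only [Matrix.mul_assoc, L.gauge1.mul_inv, Matrix.mul_one] using h1

/-- A constant morphism between constant systems over a ring of functions is a morphism over `ℂ`,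
since `φ` fixes the constants. -/
theorem comm_of_map {K : Type*} [CommRing K] {φ : K →+* K} {f : ℂ →+* K}
    (hf : Function.Injective f) (hφ : ∀ c, φ (f c) = f c) {m n : ℕ} {S : Matrix (Fin m) (Fin n) ℂ}
    {a : Matrix (Fin n) (Fin n) ℂ} {b : Matrix (Fin m) (Fin m) ℂ}
    (h : (S.map f).map φ * a.map f = b.map f * S.map f) : S * a = b * S := by
  refine matrix_map_injective hf ?_
  have h1 : (S.map f).map φ = S.map f := by
    ext i j
    exact hφ _
  rw [Matrix.map_mul, Matrix.map_mul, ← h, h1]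

/-- Compatibility of corresponding morphisms with the connection matrices, on either side. -/
theorem conn_of_rel {K K0 K1 : Type*} [CommRing K] [CommRing K0] [CommRing K1] {ρ : K1 →+* K}
    {π : K0 →+* K} {s : RatFunc ℂ →+* K1} {t : RatFunc ℂ →+* K0} (hst : ∀ r, ρ (s r) = π (t r))
    {a b k l : ℕ} {W1 : Matrix (Fin a) (Fin k) K1} {W0 : Matrix (Fin a) (Fin k) K0}
    {W1' : Matrix (Fin b) (Fin l) K1} {V1' : Matrix (Fin l) (Fin b) K1}
    {W0' : Matrix (Fin b) (Fin l) K0} {M : Matrix (Fin k) (Fin k) K} {N : Matrix (Fin l) (Fin l) K}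
    {R : Matrix (Fin b) (Fin a) (RatFunc ℂ)} {S1 : Matrix (Fin l) (Fin k) K1}
    {S0 : Matrix (Fin l) (Fin k) K0} (hV : V1' * W1' = 1)
    (hM : W1.map ρ * M = W0.map π) (hN : W1'.map ρ * N = W0'.map π)
    (h1 : W1' * S1 = R.map s * W1) (h0 : W0' * S0 = R.map t * W0) :
    S1.map ρ * M = N * S0.map π := by
  have key : W1'.map ρ * (S1.map ρ * M) = W1'.map ρ * (N * S0.map π) := by
    calc W1'.map ρ * (S1.map ρ * M) = (W1' * S1).map ρ * M := by
          rw [Matrix.map_mul, Matrix.mul_assoc]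
      _ = (R.map s).map ρ * (W1.map ρ * M) := by rw [h1, Matrix.map_mul, Matrix.mul_assoc]
      _ = (R.map t * W0).map π := by rw [hM, matrix_map_comm hst, Matrix.map_mul]
      _ = W1'.map ρ * (N * S0.map π) := by
          rw [← h0, Matrix.map_mul, ← hN, Matrix.mul_assoc]
  have h2 : V1'.map ρ * W1'.map ρ = 1 := by
    rw [← Matrix.map_mul, hV, Matrix.map_one _ (map_zero _) (map_one _)]
  have h3 := congrArg (V1'.map ρ * ·) key
  simpa only [← Matrix.mul_assoc, h2, Matrix.one_mul] using h3

/-- Conversely, matrices that are compatible with the connection matrices glue. -/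
theorem glue_of_conn {K K0 K1 : Type*} [CommRing K] [CommRing K0] [CommRing K1] {ρ : K1 →+* K}
    {π : K0 →+* K} {a b k l : ℕ} {W1 : Matrix (Fin a) (Fin k) K1} {V1 : Matrix (Fin k) (Fin a) K1}
    {W0 : Matrix (Fin a) (Fin k) K0} {V0 : Matrix (Fin k) (Fin a) K0}
    {W1' : Matrix (Fin b) (Fin l) K1} {W0' : Matrix (Fin b) (Fin l) K0}
    {M : Matrix (Fin k) (Fin k) K} {N : Matrix (Fin l) (Fin l) K}
    {S1 : Matrix (Fin l) (Fin k) K1} {S0 : Matrix (Fin l) (Fin k) K0}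
    (hV1 : V1 * W1 = 1) (hV0 : W0 * V0 = 1)
    (hM : W1.map ρ * M = W0.map π) (hN : W1'.map ρ * N = W0'.map π)
    (hS : S1.map ρ * M = N * S0.map π) :
    (W1' * S1 * V1).map ρ = (W0' * S0 * V0).map π := by
  have h1 : V1.map ρ * W1.map ρ = 1 := by
    rw [← Matrix.map_mul, hV1, Matrix.map_one _ (map_zero _) (map_one _)]
  have h0 : W0.map π * V0.map π = 1 := by
    rw [← Matrix.map_mul, hV0, Matrix.map_one _ (map_zero _) (map_one _)]
  have h2 : V1.map ρ = M * V0.map π := by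
    calc V1.map ρ = V1.map ρ * (W0.map π * V0.map π) := by rw [h0, Matrix.mul_one]
      _ = (V1.map ρ * W1.map ρ) * M * V0.map π := by
          rw [← hM]
          simp only [Matrix.mul_assoc]
      _ = M * V0.map π := by rw [h1, Matrix.one_mul]
  calc (W1' * S1 * V1).map ρ = W1'.map ρ * (S1.map ρ * M) * V0.map π := by
        rw [Matrix.map_mul, Matrix.map_mul, h2]
        simp only [Matrix.mul_assoc]
    _ = (W1'.map ρ * N) * S0.map π * V0.map π := by
        rw [hS]
        simp only [Matrix.mul_assoc]
    _ = (W0' * S0 * V0).map π := by rw [hN, Matrix.map_mul, Matrix.map_mul]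

theorem exists_matrix_ratFunc_of_descent {m n : ℕ}
    {f : Matrix (Fin m) (Fin n) (Mero (univ : Set CStarCover))}
    {g h : Matrix (Fin m) (Fin n) (Mero (Metric.ball (0 : ℂ) 1))}
    (hfg : f.map (restr Sigma0) = g.map piZero) (hfh : f.map (restr SigmaInf) = h.map piInvInf) :
    ∃ R : Matrix (Fin m) (Fin n) (RatFunc ℂ),
      f = R.map (ratCover univ) ∧ g = R.map ratZero ∧ h = R.map ratInf := by
  choose r h1 h2 h3 using fun i j =>
    exists_ratFunc_of_descent (congrFun (congrFun hfg i) j) (congrFun (congrFun hfh i) j)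
  exact ⟨Matrix.of r, Matrix.ext h1, Matrix.ext h2, Matrix.ext h3⟩

theorem map_ratPhi_comm {m n k : ℕ} {K : Type*} [CommRing K] {φ : K →+* K} {s : RatFunc ℂ →+* K}
    (hs : ∀ r, s (ratPhi p r) = φ (s r)) {R : Matrix (Fin m) (Fin n) (RatFunc ℂ)}
    {a : Matrix (Fin n) (Fin k) (RatFunc ℂ)} {b : Matrix (Fin m) (Fin k) (RatFunc ℂ)}
    (h : R.map (ratPhi p) * a = b) : (R.map s).map φ * a.map s = b.map s := by
  rw [← h, Matrix.map_mul, matrix_map_comm (fun r => (hs r).symm)]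

/-- Every morphism of Mahler systems corresponds to a morphism of connections. -/
theorem Link.exists_right (L : Link A X) (L' : Link B Y) (R : A ⟶ B) :
    ∃ S : X ⟶ Y, L.Rel L' R S := by
  have hR : R.R.map (ratPhi p) * A.mat.1 = B.mat.1 * R.R := R.comm
  have e1 := L.gauge1.conj L'.gauge1
    ((map_ratPhi_comm ratCover_ratPhi hR).trans (Matrix.map_mul ..))
  have e0 := L.gauge0.conj L'.gauge0
    ((map_ratPhi_comm ratZero_ratPhi hR).trans (Matrix.map_mul ..))
  have ei := L.gaugeInf.conj L'.gaugeInf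
    ((map_ratPhi_comm ratInf_ratPhi hR).trans (Matrix.map_mul ..))
  obtain ⟨S1, h1⟩ := exists_laurentLog_of_phiCover e1
  obtain ⟨S0, h0⟩ := exists_const_of_phiBall e0
  obtain ⟨Si, hi⟩ := exists_const_of_phiBall ei
  rw [h1] at e1
  rw [h0] at e0
  rw [hi] at ei
  rw [Matrix.mul_assoc, eq_comm, ← mul_eq_iff_eq_inv_mul L'.gauge1.mul_inv L'.gauge1.inv_mul] at h1
  rw [Matrix.mul_assoc, eq_comm, ← mul_eq_iff_eq_inv_mul L'.gauge0.mul_inv L'.gauge0.inv_mul] at h0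
  rw [Matrix.mul_assoc, eq_comm, ← mul_eq_iff_eq_inv_mul L'.gaugeInf.mul_inv L'.gaugeInf.inv_mul]
    at hi
  refine ⟨⟨S0, S1, Si, comm_of_map const_ball_injective (fun _ => rfl) e0, e1,
    comm_of_map const_ball_injective (fun _ => rfl) ei, ?_, ?_⟩, h1, h0, hi⟩
  · exact conn_of_rel (fun r => (restr_ratCover _ r).trans (piZero_ratZero r).symm)
      L'.gauge1.inv_mul L.conn0 L'.conn0 h1 h0
  · exact conn_of_rel (fun r => (restr_ratCover _ r).trans (piInvInf_ratInf r).symm)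
      L'.gauge1.inv_mul L.connInf L'.connInf h1 hi

/-- Every morphism of connections corresponds to a morphism of Mahler systems. -/
theorem Link.exists_left (L : Link A X) (L' : Link B Y) (S : X ⟶ Y) :
    ∃ R : A ⟶ B, L.Rel L' R S := by
  obtain ⟨R, h1, h0, hi⟩ := exists_matrix_ratFunc_of_descent
    (glue_of_conn (S0 := S.S0.map (Mero.const _)) L.gauge1.inv_mul L.gauge0.mul_inv L.conn0
      L'.conn0 S.conn0)
    (glue_of_conn (S0 := S.Sinf.map (Mero.const _)) L.gauge1.inv_mul L.gaugeInf.mul_inv L.connInf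
      L'.connInf S.connInf)
  have hR : R.map (ratPhi p) * A.mat.1 = B.mat.1 * R := by
    have e1 := L.gauge1.symm.conj L'.gauge1.symm S.comm1
    rw [h1] at e1
    refine matrix_map_injective ratCover_univ_injective ?_
    rw [Matrix.map_mul, Matrix.map_mul, ← e1, matrix_map_comm ratCover_ratPhi]
  refine ⟨⟨R, hR⟩, ?_, ?_, ?_⟩
  · rw [← h1, Matrix.mul_assoc _ L.V1, L.gauge1.inv_mul, Matrix.mul_one]
  · rw [← h0, Matrix.mul_assoc _ L.V0, L.gauge0.inv_mul, Matrix.mul_one]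
    rfl
  · rw [← hi, Matrix.mul_assoc _ L.Vinf, L.gaugeInf.inv_mul, Matrix.mul_one]
    rfl

end Links

/-! ### The connection of a regular singular system -/

section Existence

variable {p : ℕ} [Fact (2 ≤ p)] {n : ℕ}

theorem GL_map_map_comm {K K' L L' : Type*} [CommRing K] [CommRing K'] [CommRing L] [CommRing L']
    {f : K →+* L} {g : L →+* L'} {f' : K →+* K'} {g' : K' →+* L'} (h : ∀ x, g (f x) = g' (f' x))
    (M : GL (Fin n) K) : (M.map f).map g = (M.map f').map g' :=
  Units.ext (matrix_map_comm h M.1)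

theorem represents_ratCover (A : Matrix (Fin n) (Fin n) (RatFunc ℂ)) :
    Represents (fun x => evalMat A (Complex.exp (log x))) (A.map (ratCover univ)) :=
  fun _ _ => rfl

theorem represents_ratZero (A : Matrix (Fin n) (Fin n) (RatFunc ℂ)) :
    Represents (fun z => evalMat A z) (A.map ratZero) := fun _ _ => rfl

theorem represents_ratInf (A : Matrix (Fin n) (Fin n) (RatFunc ℂ)) :
    Represents (fun w => evalMat A w⁻¹) (A.map ratInf) := fun _ _ => rfl

theorem matMeroAt_evalMat_comp (A : Matrix (Fin n) (Fin n) (RatFunc ℂ)) {h : ℂ → ℂ} {a : ℂ}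
    (hh : MeromorphicAt h a) : MatMeroAt (fun z => evalMat A (h z)) a :=
  fun i j => meromorphicAt_ratEval_comp (A i j) hh

/-- A fundamental solution on the disk gives a gauge transformation to a constant system. -/
theorem exists_GL_phiBall {a : ℂ → Matrix (Fin n) (Fin n) ℂ}
    {A : GL (Fin n) (Mero (Metric.ball (0 : ℂ) 1))} (hA : Represents a A.1)
    (ha : ∀ z ∈ Metric.ball (0 : ℂ) 1, MatMeroAt a z) (h : RegularSingularAt p 0 a) :
    ∃ (W : GL (Fin n) (Mero (Metric.ball (0 : ℂ) 1))) (C : GL (Fin n) ℂ),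
      W.map (phiBall p) * C.map (Mero.const _) = A * W := by
  obtain ⟨F, C, hF, hu, he⟩ := exists_fundamental_zero ha h
  obtain ⟨W, hW⟩ := exists_GL_of_isMeroAt hF hu
  refine ⟨W, C, Units.ext ?_⟩
  exact (((hW.pullback (isHoloMap_pow (p := p))).mul (represents_const C.1)).congr he).unique
    (hA.mul hW)

/-- A fundamental solution at `1` gives a gauge transformation to a constant system on the cover. -/
theorem exists_GL_phiCover {A : GL (Fin n) (RatFunc ℂ)}
    (h : RegularSingularAt p 1 (evalMat A.1)) :
    ∃ (W : GL (Fin n) (Mero (univ : Set CStarCover))) (C : GL (Fin n) ℂ),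
      W.map (phiCover p) * C.map (Mero.const _) = A.map (ratCover univ) * W := by
  obtain ⟨F, C, hF, hu, he⟩ := exists_fundamental_one
    (fun z => matMeroAt_evalMat_comp A.1 (MeromorphicAt.id z)) h
  obtain ⟨W, hW⟩ := exists_GL_of_isMeroAt (E := (univ : Set CStarCover)) (f := fun x => F (log x))
    (fun x _ i j => (isMeroAt_comp_log (f := fun u => F u i j)).2 (hF _ i j))
    ((eventually_cover_iff mem_univ_iff_log (P := fun u => IsUnit (F u))).2 hu)
  refine ⟨W, C, Units.ext ?_⟩
  have h1 := (hW.pullback (isHoloMap_phi (p_ne_zero p) (mapsTo_univ _ _))).mul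
    (represents_const C.1)
  simp only [log_phi] at h1
  exact (h1.congr ((eventually_cover_iff mem_univ_iff_log
    (P := fun u => F (p * u) * C.1 = evalMat A.1 (Complex.exp u) * F u)).2 he)).unique
    ((represents_ratCover A.1).mul hW)

/-- The functional equation of the connection matrix of two fundamental solutions. -/
theorem phi_connection {G : Type*} [Group G] {φM W0 φW0 W1 φW1 A A0 A1 : G}
    (h1 : φW1 * A1 = A * W1) (h0 : φW0 * A0 = A * W0) (hM : φM = φW1⁻¹ * φW0) :
    φM = A1 * (W1⁻¹ * W0) * A0⁻¹ := by
  have e1 : φW1 = A * W1 * A1⁻¹ := by rw [← h1, mul_inv_cancel_right]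
  have e0 : φW0 = A * W0 * A0⁻¹ := by rw [← h0, mul_inv_cancel_right]
  rw [hM, e1, e0]
  group

/-- A regular singular system has a connection. -/
theorem exists_link_right (A : MahlerSystem p) (hA : isRegularSingular p A) :
    ∃ X : Connection p, Nonempty (Link A X) := by
  obtain ⟨hA0, hA1, hAi⟩ := hA
  obtain ⟨W0, C0, e0⟩ := exists_GL_phiBall (A := A.mat.map ratZero) (represents_ratZero A.mat.1)
    (fun z _ => matMeroAt_evalMat_comp A.mat.1 (MeromorphicAt.id z)) hA0
  obtain ⟨Wi, Ci, ei⟩ := exists_GL_phiBall (A := A.mat.map ratInf) (represents_ratInf A.mat.1)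
    (fun z _ => matMeroAt_evalMat_comp A.mat.1 (MeromorphicAt.id z).inv) hAi
  obtain ⟨W1, C1, e1⟩ := exists_GL_phiCover hA1
  -- the functional equations of the two connection matrices, in one computation
  have hphi : ∀ (E : Set CStarCover) (φ : Mero E →+* Mero E) (t : RatFunc ℂ →+* Mero _)
      (π : Mero (Metric.ball (0 : ℂ) 1) →+* Mero E) (W : GL (Fin A.rank) _) (C : GL (Fin A.rank) ℂ),
      (∀ f, φ (restr E f) = restr E (phiCover p f)) → (∀ f, φ (π f) = π (phiBall p f)) →
      (∀ r, restr E (ratCover univ r) = π (t r)) → (∀ c, π (Mero.const _ c) = Mero.const E c) →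
      W.map (phiBall p) * C.map (Mero.const _) = A.mat.map t * W →
      ((W1.map (restr E))⁻¹ * W.map π).map φ =
        C1.map (Mero.const E) * ((W1.map (restr E))⁻¹ * W.map π) * (C.map (Mero.const E))⁻¹ := by
    intro E φ t π W C h1 h2 h3 h4 h5
    refine phi_connection (φW1 := (W1.map (restr E)).map φ) (φW0 := (W.map π).map φ)
      (A := (A.mat.map (ratCover univ)).map (restr E)) ?_ ?_ ?_
    · rw [GL_map_map_comm h1, ← map_mul, ← e1, map_mul]
      rfl
    · rw [GL_map_map_comm h2, GL_map_map_comm h3, ← map_mul, ← h5, map_mul]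
      congr 1
      exact Units.ext (Matrix.ext fun i j => (h4 _).symm)
    · rw [map_mul, map_inv]
  refine ⟨⟨A.rank, C0, C1, Ci, (W1.map (restr Sigma0))⁻¹ * W0.map piZero,
    (W1.map (restr SigmaInf))⁻¹ * Wi.map piInvInf, ?_, ?_,
    W1, W0, Wi.map (Mero.pullback chartInf isHoloMap_chartInf), ?_, ?_⟩, ⟨⟨W1.1, W1⁻¹.1, W0.1,
    W0⁻¹.1, Wi.1, Wi⁻¹.1, .of_GL e1, .of_GL e0, .of_GL ei, ?_, ?_⟩⟩⟩
  · exact hphi _ _ ratZero _ _ _ phiZero_restr phiZero_piZero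
      (fun r => (restr_ratCover _ r).trans (piZero_ratZero r).symm) (fun _ => rfl) e0
  · exact hphi _ _ ratInf _ _ _ phiInf_restr phiInf_piInvInf
      (fun r => (restr_ratCover _ r).trans (piInvInf_ratInf r).symm) (fun _ => rfl) ei
  · rw [mul_inv_cancel_left]
  · rw [mul_inv_cancel_left]
    exact Units.ext (Matrix.ext fun i j => (piInf_chartInf _).symm)
  · exact congrArg Units.val (mul_inv_cancel_left (W1.map (restr Sigma0)) (W0.map piZero))
  · exact congrArg Units.val (mul_inv_cancel_left (W1.map (restr SigmaInf)) (Wi.map piInvInf))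

end Existence

/-! ### The regular singular system of a connection -/

section Descent

variable {n : ℕ}

/-- A meromorphic solution with constant matrix at a fixed point of `z ↦ z ^ p` makes the system
regular singular there. -/
theorem regularSingularAt_of_solution {p : ℕ} {a : ℂ} {A F : ℂ → Matrix (Fin n) (Fin n) ℂ}
    (ha : Tendsto (fun z => z ^ p) (𝓝[≠] a) (𝓝[≠] a)) (hF : MatMeroAt F a)
    (hu : ∀ᶠ z in 𝓝[≠] a, IsUnit (F z)) {C : GL (Fin n) ℂ}
    (h : ∀ᶠ z in 𝓝[≠] a, F (z ^ p) * C.1 = A z * F z) : RegularSingularAt p a A := by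
  refine ⟨F, fun _ => C.1, ⟨hF, hu⟩, ⟨fun _ _ => analyticAt_const, C.isUnit⟩, ?_⟩
  filter_upwards [h, ha.eventually hu] with z hz hzu
  rw [Matrix.mul_assoc, ← hz, ← Matrix.mul_assoc,
    Matrix.nonsing_inv_mul _ ((Matrix.isUnit_iff_isUnit_det _).1 hzu), Matrix.one_mul]

variable {p : ℕ} [Fact (2 ≤ p)]

theorem regularSingularAt_of_phiBall {A : ℂ → Matrix (Fin n) (Fin n) ℂ}
    {M W : GL (Fin n) (Mero (Metric.ball (0 : ℂ) 1))} (hA : Represents A M.1) {C : GL (Fin n) ℂ}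
    (h : W.map (phiBall p) * C.map (Mero.const _) = M * W) : RegularSingularAt p 0 A := by
  obtain ⟨F, hF, hFm⟩ := exists_represents W.1
  have h0 : (0 : ℂ) ∈ Metric.ball (0 : ℂ) 1 := Metric.mem_ball_self one_pos
  have hu := (eventually_codiscreteWithin_iff Metric.isOpen_ball).1 hF.eventually_isUnit 0 h0
  refine regularSingularAt_of_solution (tendsto_pow_nhdsNE (p_ne_zero p)) (hFm 0 h0) hu (C := C) ?_
  have h1 := (hF.pullback (isHoloMap_pow (p := p))).mul (represents_const C.1)
  have h2 : Represents (fun z => F (z ^ p) * C.1) (M * W).1 := h ▸ h1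
  exact (eventually_codiscreteWithin_iff Metric.isOpen_ball).1
    (h2.eventually_eq (hA.mul hF)) 0 h0

theorem tendsto_log_nhdsNE : Tendsto Complex.log (𝓝[≠] 1) (𝓝[≠] 0) := by
  have h1 := (Complex.hasDerivAt_log Complex.one_mem_slitPlane).tendsto_nhdsNE (by simp)
  rwa [Complex.log_one] at h1

theorem eventually_log_pow (p : ℕ) :
    ∀ᶠ z in 𝓝 (1 : ℂ), Complex.log (z ^ p) = p * Complex.log z := by
  have h1 : ContinuousAt (fun z : ℂ => (p : ℝ) * z.arg) 1 :=
    continuousAt_const.mul (Complex.continuousAt_arg Complex.one_mem_slitPlane)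
  have h2 : Ioo (-Real.pi) Real.pi ∈ 𝓝 ((p : ℝ) * (1 : ℂ).arg) := by
    simpa using Ioo_mem_nhds (neg_lt_zero.2 Real.pi_pos) Real.pi_pos
  filter_upwards [h1.eventually h2, isOpen_ne.mem_nhds one_ne_zero] with z hz hz0
  have h3 : ((p : ℂ) * Complex.log z).im = p * z.arg := by simp [Complex.log_im]
  have h4 : z ^ p = Complex.exp (p * Complex.log z) := by
    rw [Complex.exp_nat_mul, Complex.exp_log hz0]
  rw [h4, Complex.log_exp]
  · rw [h3]
    exact hz.1
  · rw [h3]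
    exact hz.2.le

theorem tendsto_pow_nhdsNE_one {p : ℕ} (hp : p ≠ 0) :
    Tendsto (fun z : ℂ => z ^ p) (𝓝[≠] 1) (𝓝[≠] 1) := by
  have h1 := (hasDerivAt_pow p (1 : ℂ)).tendsto_nhdsNE (by simpa using hp)
  rwa [one_pow] at h1

theorem regularSingularAt_of_phiCover {A : GL (Fin n) (RatFunc ℂ)}
    {W : GL (Fin n) (Mero (univ : Set CStarCover))} {C : GL (Fin n) ℂ}
    (h : W.map (phiCover p) * C.map (Mero.const _) = A.map (ratCover univ) * W) :
    RegularSingularAt p 1 (evalMat A.1) := by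
  obtain ⟨F, hF, hFm⟩ := exists_represents_log W.1
  have hu := hF.eventually_isUnit
  rw [eventually_cover_iff mem_univ_iff_log (P := fun u => IsUnit (F u)),
    eventually_codiscreteWithin_iff isOpen_univ] at hu
  have h1 := (hF.pullback (isHoloMap_phi (p_ne_zero p) (mapsTo_univ _ _))).mul
    (represents_const C.1)
  have h2 : Represents (fun x => F (log (phi p x)) * C.1) (A.map (ratCover univ) * W).1 := h ▸ h1
  have h3 := h2.eventually_eq ((represents_ratCover A.1).mul hF)
  simp only [log_phi] at h3
  rw [eventually_cover_iff mem_univ_iff_log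
    (P := fun u => F (p * u) * C.1 = evalMat A.1 (Complex.exp u) * F u),
    eventually_codiscreteWithin_iff isOpen_univ] at h3
  have hlog := tendsto_log_nhdsNE
  refine regularSingularAt_of_solution (F := fun z => F (Complex.log z)) (C := C)
    (tendsto_pow_nhdsNE_one (p_ne_zero p)) ?_ (hlog.eventually (hu 0 (mem_univ _))) ?_
  · exact (hFm _).comp (analyticAt_clog Complex.one_mem_slitPlane)
  · filter_upwards [hlog.eventually (h3 0 (mem_univ _)), nhdsWithin_le_nhds (eventually_log_pow p),
      nhdsWithin_le_nhds (isOpen_ne.mem_nhds one_ne_zero)] with z hz hzp hz0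
    rw [Complex.exp_log hz0] at hz
    rw [hzp, hz]

/-- The coefficient matrix obtained from a family of solutions is compatible with the connection
matrix. -/
theorem glue_coefficient {G : Type*} [Group G] {M φM W0 φW0 W1 φW1 A0 A1 : G}
    (hM : φM = A1 * M * A0⁻¹) (h : W1 * M = W0) (hφ : φW1 * φM = φW0) :
    φW1 * A1 * W1⁻¹ = φW0 * A0 * W0⁻¹ := by
  rw [← hφ, ← h, hM]
  group

/-- Every connection is the connection of a regular singular system. -/
theorem exists_link_left (X : Connection p) :
    ∃ A : MahlerSystem p, isRegularSingular p A ∧ Nonempty (Link A X) := by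
  obtain ⟨W1, W0, Wext, h0, hi'⟩ := X.exists_W
  set Wi := Wext.map (Mero.pullback chartInf.symm isHoloMap_chartInf_symm) with hWi
  have hi : W1.map (restr SigmaInf) * X.Minf = Wi.map piInvInf := by
    rw [hi']
    exact Units.ext (Matrix.ext fun i j => (piInvInf_chartInf_symm _).symm)
  clear_value Wi
  -- the three candidates for the matrix of the system; they agree on the overlaps
  let Q1 := W1.map (phiCover p) * X.A1.map (Mero.const _) * W1⁻¹
  let Q0 := W0.map (phiBall p) * X.A0.map (Mero.const _) * W0⁻¹
  let Qi := Wi.map (phiBall p) * X.Ainf.map (Mero.const _) * Wi⁻¹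
  have e0 : Q1.map (restr Sigma0) = Q0.map piZero := by
    have h1 := congrArg (Matrix.GeneralLinearGroup.map (phiZero p)) h0
    rw [map_mul, GL_map_map_comm phiZero_restr, GL_map_map_comm phiZero_piZero] at h1
    have h2 := glue_coefficient X.phi_M0 h0 h1
    simp only [Q1, Q0, map_mul, map_inv]
    exact h2
  have ei : Q1.map (restr SigmaInf) = Qi.map piInvInf := by
    have h1 := congrArg (Matrix.GeneralLinearGroup.map (phiInf p)) hi
    rw [map_mul, GL_map_map_comm phiInf_restr, GL_map_map_comm phiInf_piInvInf] at h1
    have h2 := glue_coefficient X.phi_Minf hi h1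
    simp only [Q1, Qi, map_mul, map_inv]
    exact h2
  obtain ⟨R, hR1, hR0, hRi⟩ := exists_matrix_ratFunc_of_descent (congrArg Units.val e0)
    (congrArg Units.val ei)
  -- the inverses descend in the same way, which makes `R` invertible
  obtain ⟨R', hR1', -, -⟩ := exists_matrix_ratFunc_of_descent
    (f := (Q1⁻¹).1) (g := (Q0⁻¹).1) (h := (Qi⁻¹).1)
    (congrArg (fun Q => (Q⁻¹).1) e0) (congrArg (fun Q => (Q⁻¹).1) ei)
  have hone : ∀ {P P' : Matrix (Fin X.rank) (Fin X.rank) (RatFunc ℂ)},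
      P.map (ratCover univ) * P'.map (ratCover univ) = 1 → P * P' = 1 := by
    intro P P' h
    refine matrix_map_injective ratCover_univ_injective ?_
    rw [Matrix.map_mul, h, Matrix.map_one _ (map_zero _) (map_one _)]
  let A : GL (Fin X.rank) (RatFunc ℂ) := ⟨R, R', hone (by rw [← hR1, ← hR1', Units.mul_inv]),
    hone (by rw [← hR1, ← hR1', Units.inv_mul])⟩
  have g1 : W1.map (phiCover p) * X.A1.map (Mero.const _) = A.map (ratCover univ) * W1 := by
    have : A.map (ratCover univ) = Q1 := Units.ext hR1.symm
    rw [this, inv_mul_cancel_right]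
  have g0 : W0.map (phiBall p) * X.A0.map (Mero.const _) = A.map ratZero * W0 := by
    have : A.map ratZero = Q0 := Units.ext hR0.symm
    rw [this, inv_mul_cancel_right]
  have gi : Wi.map (phiBall p) * X.Ainf.map (Mero.const _) = A.map ratInf * Wi := by
    have : A.map ratInf = Qi := Units.ext hRi.symm
    rw [this, inv_mul_cancel_right]
  refine ⟨⟨X.rank, A⟩, ⟨?_, ?_, ?_⟩, ⟨⟨W1.1, W1⁻¹.1, W0.1, W0⁻¹.1, Wi.1, Wi⁻¹.1, .of_GL g1,
    .of_GL g0, .of_GL gi, congrArg Units.val h0, congrArg Units.val hi⟩⟩⟩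
  · exact regularSingularAt_of_phiBall (represents_ratZero A.1) g0
  · exact regularSingularAt_of_phiCover g1
  · exact regularSingularAt_of_phiBall (represents_ratInf A.1) gi

end Descent

/-! ### The equivalence of categories -/

section Equivalence

variable (p : ℕ) [Fact (2 ≤ p)]

/-- A connection of a regular singular system. -/
def connectionOf (A : RegSingSystem p) : Connection p := (exists_link_right A.obj A.property).choose

/-- Fundamental solutions giving the connection `connectionOf p A`. -/
def linkOf (A : RegSingSystem p) : Link A.obj (connectionOf p A) :=
  (exists_link_right A.obj A.property).choose_spec.some

/-- The functor that attaches to a regular singular system its connection. -/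
def connectionFunctor : RegSingSystem p ⥤ Connection p where
  obj := connectionOf p
  map {A B} f := ((linkOf p A).exists_right (linkOf p B) f.hom).choose
  map_id A := ((linkOf p A).exists_right (linkOf p A) _).choose_spec.right_unique
    (linkOf p A).rel_id
  map_comp {A B C} f g := ((linkOf p A).exists_right (linkOf p C) _).choose_spec.right_unique
    (((linkOf p A).exists_right (linkOf p B) f.hom).choose_spec.comp
      ((linkOf p B).exists_right (linkOf p C) g.hom).choose_spec)

theorem rel_connectionFunctor_map {A B : RegSingSystem p} (f : A ⟶ B) :
    (linkOf p A).Rel (linkOf p B) f.hom ((connectionFunctor p).map f) :=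
  ((linkOf p A).exists_right (linkOf p B) f.hom).choose_spec

instance : (connectionFunctor p).Faithful where
  map_injective {_ _ f g} h := ObjectProperty.hom_ext _
    ((rel_connectionFunctor_map p f).left_unique (h ▸ rel_connectionFunctor_map p g))

instance : (connectionFunctor p).Full where
  map_surjective {A B} S := by
    obtain ⟨R, hR⟩ := (linkOf p A).exists_left (linkOf p B) S
    exact ⟨⟨R⟩, (rel_connectionFunctor_map p ⟨R⟩).right_unique hR⟩

/-- Two connections of the same system are isomorphic. -/
theorem nonempty_iso_of_link {A : MahlerSystem p} {X Y : Connection p} (L : Link A X)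
    (L' : Link A Y) : Nonempty (X ≅ Y) := by
  obtain ⟨S, hS⟩ := L.exists_right L' (𝟙 A)
  obtain ⟨T, hT⟩ := L'.exists_right L (𝟙 A)
  refine ⟨⟨S, T, ?_, ?_⟩⟩
  · have h := hS.comp hT
    rw [Category.id_comp] at h
    exact h.right_unique L.rel_id
  · have h := hT.comp hS
    rw [Category.id_comp] at h
    exact h.right_unique L'.rel_id

instance : (connectionFunctor p).EssSurj where
  mem_essImage Y := by
    obtain ⟨A, hA, ⟨L⟩⟩ := exists_link_left Y
    exact ⟨⟨A, hA⟩, nonempty_iso_of_link p (linkOf p ⟨A, hA⟩) L⟩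

instance : (connectionFunctor p).IsEquivalence where

end Equivalence

end Mahler

end

theorem mainTheorem3 (p : ℕ) [Fact (2 ≤ p)] :
    Nonempty (Mahler.Connection p ≌ Mahler.RegSingSystem p) := by
  exact ⟨(Mahler.connectionFunctor p).asEquivalence.symm⟩
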